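/- Let $(W,S)$ be a finite Coxeter system with Coxeter matrix $m$. Let $V=\mathbb{R}^S$ have basis $\{\alpha_s\}_{s\in S}$ and bilinear form $(\alpha_s,\alpha_t)=-\cos(\pi/m(s,t))$, let $W$ act by $s(v)=v-2(v,\alpha_s)\alpha_s$, let $\Phi=\{w(\alpha_s): w\in W, s\in S\}$, let $\Phi^+$ be the set of roots with nonnegative coordinates, and let $M=M_\Phi$ be the matroid of linear dependencies on the ground set $E=\Phi^+$ (the matroid of the Coxeter arrangement). For $\omega\in\mathbb{R}^E$ let $M_\omega$ be the matroid whose bases are the bases of $M$ of minimum $\omega$-weight. The Bergman complex $\mathcal{B}(M)$ is the set of all $\omega\in\mathbb{R}^E$ with $\sum_e\omega_e=0$ and $\sum_e\omega_e^2=1$ for which $M_\omega$ has no loops; its coarse cells are the classes of the relation $M_\omega=M_\nu$ on $\mathcal{B}(M)$. Let $L$ be the lattice of flats of $M$. An element $y\neq\hat 0$ of $L$ is irreducible if $[\hat 0,y]$ is not isomorphic to a product $[\hat 0,x_1]\times[\hat 0,x_2]$ with $x_1,x_2<y$; the maximal irreducible elements are the connected components of $M$. A set of irreducible elements is nested if the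 join of any of its antichains with at least two elements is not irreducible; it is reduced if it contains no connected component of $M$. The nested set complex $\mathcal{N}(M)$ is the simplicial complex of the nonempty reduced nested sets. For a reduced nested set $N$ (possibly empty), let $C_N$ be the set of all $\omega$ with $\sum_e\omega_e=0$ and $\sum_e\omega_e^2=1$ of the form $$\omega=-\sum_{G\in N}a_G\,\mathbf 1_G-\sum_{C}a_C\,\mathbf 1_C,\qquad a_G>0 \ (G\in N),\quad a_C\in\mathbb{R},$$ where $C$ runs over the connected components of $M$ and $\mathbf 1_X\in\mathbb{R}^E$ is the indicator vector of $X$. Then the coarse subdivision of $\mathcal{B}(M_\Phi)$ is equal to the nested set complex, in the following sense. 1. The coarse cells of $\mathcal{B}(M)$ are exactly the nonempty sets among the $C_N$, $N$ a reduced nested set. 2. For reduced nested sets $N,N'$ with $C_N\neq\emptyset$, one has $C_N\subseteq\overline{C_{N'}}$ if and only if $N\subseteq N'$. 3. Let $U=\{\omega:\sum_{e\in C}\omega_e=0 \text{ for every connected component } C \text{ of } M\}$. There is a homeomorphism from the geometric realization of $\mathcal{N}(M)$ onto $\mathcal{B}(M)\cap U$ that maps the open simplex of each $N\in\mathcal{N}(M)$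 onto $C_N\cap U$. 4. In particular, if $(W,S)$ is irreducible, then $\mathcal{B}(M)$ with its coarse subdivision is a simplicial complex: there is a homeomorphism from the geometric realization of $\mathcal{N}(M)$ onto $\mathcal{B}(M)$ that maps the open simplex of each $N\in\mathcal{N}(M)$ onto the coarse cell $C_N$. -/

import Mathlib

open Set

noncomputable section

namespace CoxeterBergman

/-! ### Irreducible elements and nested sets of a finite lattice -/

section Nested

variable {L : Type*} [PartialOrder L]

/-- `y` is irreducible: it is not the bottom element (whose interval is the empty product), and
`[0, y]` is not a product of two smaller intervals `[0, x₁] × [0, x₂]`. -/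
def IsIrred (y : L) : Prop :=
  ¬ IsBot y ∧ ∀ x₁ x₂ : L, x₁ < y → x₂ < y → IsEmpty ((Iic x₁ × Iic x₂) ≃o Iic y)

/-- A set of irreducible elements is nested if the join of each of its antichains with at least
two elements is not irreducible. -/
def IsNested (X : Finset L) : Prop :=
  (∀ x ∈ X, IsIrred x) ∧
    ∀ A : Finset L, A ⊆ X → 2 ≤ A.card → IsAntichain (· ≤ ·) (A : Set L) →
      ∃ y, IsLUB (A : Set L) y ∧ ¬ IsIrred y

/-- A nested set none of whose elements is a maximal irreducible element.  In the lattice of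
flats the maximal irreducible elements are the connected components; they can be added to every
nested set, that is, they are cone points of the complex of all nested sets. -/
def IsReducedNested (X : Finset L) : Prop :=
  IsNested X ∧ ∀ x ∈ X, ¬ Maximal IsIrred x

lemma IsNested.mono {X Y : Finset L} (h : IsNested X) (hY : Y ⊆ X) : IsNested Y :=
  ⟨fun x hx ↦ h.1 x (hY hx), fun A hA ↦ h.2 A (hA.trans hY)⟩

lemma IsReducedNested.mono {X Y : Finset L} (h : IsReducedNested X) (hY : Y ⊆ X) :
    IsReducedNested Y :=
  ⟨h.1.mono hY, fun x hx ↦ h.2 x (hY hx)⟩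

variable (L) in
/-- The (reduced, minimal) nested set complex: its simplices are the nonempty nested sets without
maximal irreducible elements. -/
def nestedSetComplex : PreAbstractSimplicialComplex L where
  faces := {X | X.Nonempty ∧ IsReducedNested X}
  isRelLowerSet_faces := fun _ hX ↦ ⟨hX.1, fun _ hY hne ↦ ⟨hne, hX.2.mono hY⟩⟩

end Nested

/-! ### Geometric realization of a finite simplicial complex -/

section Realization

variable {ι : Type*} [Fintype ι]

/-- The open simplex on the vertex set `X`, in barycentric coordinates. -/
def openSimplex (X : Finset ι) : Set (ι → ℝ) :=
  {t | (∀ i ∈ X, 0 < t i) ∧ (∀ i ∉ X, t i = 0) ∧ ∑ i, t i = 1}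

/-- The standard geometric realization `|K|`: the union of the open simplices of the faces. -/
def realization (K : PreAbstractSimplicialComplex ι) : Set (ι → ℝ) :=
  ⋃ X ∈ K.faces, openSimplex X

/-- The space `Z`, with the cells `cell X` indexed by the faces `X` of `K`, is a simplicial complex
with face complex `K`: there is a homeomorphism `|K| ≃ Z` which maps the open simplex of each
face `X` onto `cell X`. -/
def IsRealizationOf {β : Type*} [TopologicalSpace β] (K : PreAbstractSimplicialComplex ι)
    (Z : Set β) (cell : Finset ι → Set β) : Prop :=
  ∃ h : realization K ≃ₜ Z, ∀ X ∈ K.faces,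
    (fun t ↦ (h t : β)) '' {t : realization K | (t : ι → ℝ) ∈ openSimplex X} = cell X

end Realization

/-! ### Bergman complexes of matroids -/

section Bergman

variable {α : Type*}

/-- The lattice of flats, ordered by inclusion. -/
abbrev Flats (M : Matroid α) : Type _ := {F : Set α // M.IsFlat F}

instance [Finite α] (M : Matroid α) : Fintype (Flats M) := Fintype.ofFinite _

/-- Symmetric exchange of bases. -/
lemma exists_symm_exchange (M : Matroid α) {X Y : Set α} (hX : M.IsBase X) (hY : M.IsBase Y)
    {e : α} (he : e ∈ X \ Y) :
    ∃ f ∈ Y \ X, M.IsBase (insert f (X \ {e})) ∧ M.IsBase (insert e (Y \ {f})) := by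
  have heE : e ∈ M.E := hX.subset_ground he.1
  have hcirc := hY.fundCircuit_isCircuit heE he.2
  have hcl := hcirc.mem_closure_sdiff_singleton_of_mem (M.mem_fundCircuit e Y)
  have hns : ¬ (M.fundCircuit e Y \ {e} ⊆ M.closure (X \ {e})) := fun hss ↦
    hX.indep.notMem_closure_sdiff_of_mem he.1 (M.closure_subset_closure_of_subset_closure hss hcl)
  obtain ⟨f, ⟨hfC, hfe⟩, hf⟩ := not_subset.1 hns
  have hfe' : f ≠ e := hfe
  have hfY : f ∈ Y := (M.fundCircuit_subset_insert e Y hfC).resolve_left hfe'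
  have hfE : f ∈ M.E := hY.subset_ground hfY
  have hfX : f ∉ X := fun hfX ↦ hf (M.mem_closure_of_mem' ⟨hfX, hfe⟩ hfE)
  refine ⟨f, ⟨hfY, hfX⟩, hX.exchange_base_of_notMem_closure he.1 hf, ?_⟩
  apply hY.exchange_isBase_of_indep he.2
  rw [hY.indep.mem_fundCircuit_iff (by rwa [hY.closure_eq]) he.2] at hfC
  rwa [insert_sdiff_of_notMem _ (by simpa using hfe'.symm)] at hfC

variable [Fintype α]

/-- The `ω`-weight of a set of elements. -/
def weight (ω : α → ℝ) (X : Set α) : ℝ := ∑ e, X.indicator ω e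

/-- `X` is a basis of `M` of minimum `ω`-weight. -/
def IsMinBase (M : Matroid α) (ω : α → ℝ) (X : Set α) : Prop :=
  M.IsBase X ∧ ∀ Y, M.IsBase Y → weight ω X ≤ weight ω Y

lemma weight_exchange (ω : α → ℝ) {X : Set α} {e f : α} (he : e ∈ X) (hf : f ∉ X) :
    weight ω (insert f (X \ {e})) = weight ω X - ω e + ω f := by
  classical
  have h : ∀ x, (insert f (X \ {e})).indicator ω x =
      X.indicator ω x - (if x = e then ω x else 0) + (if x = f then ω x else 0) := by
    intro x
    have hef : e ≠ f := fun h ↦ hf (h ▸ he)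
    by_cases h1 : x = e
    · subst h1; simp [indicator, he, hef]
    · by_cases h2 : x = f
      · subst h2; simp [indicator, hf, h1]
      · simp [indicator, h1, h2]
  simp only [weight, h, Finset.sum_add_distrib, Finset.sum_sub_distrib]
  simp

lemma isMinBase_exchange (M : Matroid α) (ω : α → ℝ) :
    Matroid.ExchangeProperty (IsMinBase M ω) := by
  intro X Y hX hY e he
  obtain ⟨f, hf, h1, h2⟩ := exists_symm_exchange M hX.1 hY.1 he
  refine ⟨f, hf, h1, fun Z hZ ↦ ?_⟩
  have w1 := weight_exchange ω he.1 hf.2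
  have w2 := weight_exchange ω hf.1 he.2
  have := hY.2 _ h2
  have := hX.2 _ hZ
  linarith

lemma exists_isMinBase (M : Matroid α) (ω : α → ℝ) : ∃ X, IsMinBase M ω X := by
  obtain ⟨X, hX, h⟩ := (Set.toFinite {X | M.IsBase X}).exists_minimalFor (weight ω) _
    M.exists_isBase
  refine ⟨X, hX, fun Y hY ↦ ?_⟩
  rcases le_total (weight ω X) (weight ω Y) with h' | h'
  · exact h'
  · exact h hY h'

/-- The matroid `M_ω` whose bases are the bases of `M` of minimum `ω`-weight. -/
def initialMatroid (M : Matroid α) (ω : α → ℝ) : Matroid α :=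
  Matroid.ofIsBaseOfFinite (E := M.E) (Set.toFinite _) (IsMinBase M ω) (exists_isMinBase M ω)
    (isMinBase_exchange M ω) (fun _ h ↦ h.1.subset_ground)

variable (α) in
/-- The sphere of weight vectors with sum of coordinates `0` and sum of squares `1`. -/
def weightSphere : Set (α → ℝ) := {ω | ∑ e, ω e = 0 ∧ ∑ e, ω e ^ 2 = 1}

/-- The Bergman complex of a matroid whose ground set is all of `α`. -/
def bergmanComplex (M : Matroid α) : Set (α → ℝ) :=
  {ω ∈ weightSphere α | (initialMatroid M ω).Loopless}

/-- The coarse subdivision: the classes of `ω ~ ν ↔ M_ω = M_ν` on the Bergman complex. -/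
def coarseCells (M : Matroid α) : Set (Set (α → ℝ)) :=
  (fun ω ↦ {ν ∈ bergmanComplex M | initialMatroid M ν = initialMatroid M ω}) '' bergmanComplex M

/-- The cell of a reduced nested set `N` of flats: the unit vectors of the form
`-∑_{G ∈ N} a_G 1_G - ∑_C a_C 1_C` with `a_G > 0` for `G ∈ N`, where `C` runs over the maximal
irreducible flats (the connected components) and the coefficients `a_C` are arbitrary. -/
def nestedCell (M : Matroid α) (N : Finset (Flats M)) : Set (α → ℝ) :=
  {ω ∈ weightSphere α | ∃ a : Flats M → ℝ, (∀ G ∈ N, 0 < a G) ∧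
    (∀ G ∉ N, ¬ Maximal IsIrred G → a G = 0) ∧
    ∀ e, ω e = -∑ G : Flats M, (G : Set α).indicator (fun _ ↦ a G) e}

/-- Weight vectors whose coordinates sum to `0` over each connected component (maximal irreducible
flat) of the matroid. -/
def componentSumZero (M : Matroid α) : Set (α → ℝ) :=
  {ω | ∀ C : Flats M, Maximal IsIrred C → weight ω (C : Set α) = 0}

end Bergman

/-! ### Coxeter systems, root systems and their matroids -/

section Coxeter

variable {B W : Type*} [Group W] [Fintype B] [DecidableEq B]

/-- The symmetric bilinear form `(α_s, α_t) = -cos (π / m(s,t))` on `ℝ^S`.  The value `m = 0`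
encodes `m = ∞`, where the formula gives `-1` as it should. -/
def coxeterForm (M : CoxeterMatrix B) : LinearMap.BilinForm ℝ (B → ℝ) :=
  Matrix.toBilin' (Matrix.of fun s t ↦ -Real.cos (Real.pi / (M s t : ℝ)))

/-- The simple root `α_s`, a standard basis vector. -/
def simpleRoot (s : B) : B → ℝ := Pi.single s 1

lemma coxeterForm_simpleRoot (M : CoxeterMatrix B) (s t : B) :
    coxeterForm M (simpleRoot s) (simpleRoot t) = -Real.cos (Real.pi / (M s t : ℝ)) := by
  simp [coxeterForm, simpleRoot, Matrix.toBilin'_single]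

/-- The linear functional `v ↦ 2 (v, α_s)`. -/
def coroot (M : CoxeterMatrix B) (s : B) : Module.Dual ℝ (B → ℝ) :=
  (2 : ℝ) • (coxeterForm M).flip (simpleRoot s)

lemma coroot_simpleRoot (M : CoxeterMatrix B) (s t : B) :
    coroot M s (simpleRoot t) = -2 * Real.cos (Real.pi / (M t s : ℝ)) := by
  simp [coroot, coxeterForm_simpleRoot]

lemma coroot_self (M : CoxeterMatrix B) (s : B) : coroot M s (simpleRoot s) = 2 := by
  simp [coroot_simpleRoot]

/-- The reflection `v ↦ v - 2 (v, α_s) α_s`. -/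
def simpleReflection (M : CoxeterMatrix B) (s : B) : (B → ℝ) ≃ₗ[ℝ] (B → ℝ) :=
  Module.reflection (coroot_self M s)

lemma simpleReflection_apply (M : CoxeterMatrix B) (s : B) (v : B → ℝ) :
    simpleReflection M s v = v - (2 * coxeterForm M v (simpleRoot s)) • simpleRoot s := by
  simp [simpleReflection, Module.reflection_apply, coroot]

/-- The reflections satisfy the Coxeter relations. -/
lemma isLiftable_simpleReflection (M : CoxeterMatrix B) :
    M.IsLiftable (simpleReflection M) := by
  intro s t
  by_cases hst : s = t
  · subst hst
    rw [M.diagonal, pow_one]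
    ext v : 1
    exact Module.involutive_reflection (coroot_self M s) v
  obtain hm | hm | hm : M s t = 0 ∨ M s t = 2 ∨ 3 ≤ M s t := by
    have := M.off_diagonal s t hst
    omega
  · rw [hm, pow_zero]
  · have h1 : coroot M s (simpleRoot t) = 0 := by
      rw [coroot_simpleRoot, M.symmetric t s, hm]; simp
    have h2 : coroot M t (simpleRoot s) = 0 := by
      rw [coroot_simpleRoot, hm]; simp
    have hs := coroot_self M s
    have ht := coroot_self M t
    rw [hm]
    apply LinearEquiv.ext
    intro v
    simp only [pow_two, LinearEquiv.mul_apply, simpleReflection, Module.reflection_apply, map_sub,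
      map_smul, h1, h2, hs, ht, LinearEquiv.coe_one, id_eq]
    module
  · have hm0 : (M s t : ℝ) ≠ 0 := by positivity
    have hm3 : (3 : ℝ) ≤ (M s t : ℝ) := by exact_mod_cast hm
    set θ : ℝ := 2 * (Real.pi / (M s t : ℝ)) with hθ
    have hmθ : (M s t : ℝ) * θ = 2 * Real.pi := by rw [hθ]; field_simp
    have hsin : Real.sin θ ≠ 0 := by
      apply ne_of_gt
      apply Real.sin_pos_of_pos_of_lt_pi
      · rw [hθ]; positivity
      · rw [hθ, ← mul_div_assoc, div_lt_iff₀ (by linarith)]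
        nlinarith [Real.pi_pos]
    have htt : 2 * Real.cos θ = coroot M s (simpleRoot t) * coroot M t (simpleRoot s) - 2 := by
      rw [coroot_simpleRoot, coroot_simpleRoot, M.symmetric t s, hθ, Real.cos_two_mul]
      ring
    have hS : ∀ n : ℤ, ((Polynomial.Chebyshev.S ℝ n).eval (2 * Real.cos θ)) =
        Real.sin ((n + 1) * θ) / Real.sin θ := by
      intro n
      rw [eq_div_iff hsin, Polynomial.Chebyshev.S_two_mul_real_cos]
    apply LinearEquiv.ext
    intro v
    rw [simpleReflection, simpleReflection,
      Module.reflection_mul_reflection_pow_apply _ _ _ _ _ htt]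
    obtain ⟨k, hk | hk⟩ := Nat.even_or_odd' (M s t)
    · have e1 : ((M s t : ℤ) - 2) / 2 = (k : ℤ) - 1 := by omega
      have e2 : ((M s t : ℤ) - 1) / 2 = (k : ℤ) - 1 := by omega
      have hkθ : (k : ℝ) * θ = Real.pi := by
        have : (M s t : ℝ) = 2 * k := by exact_mod_cast hk
        rw [this] at hmθ; linarith
      have z : ((Polynomial.Chebyshev.S ℝ ((k : ℤ) - 1)).eval (2 * Real.cos θ)) = 0 := by
        rw [hS]; push_cast; rw [sub_add_cancel, hkθ]; simp
      rw [e1, e2, z]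
      simp
    · have e1 : ((M s t : ℤ) - 2) / 2 = (k : ℤ) - 1 := by omega
      have e2 : ((M s t : ℤ) - 1) / 2 = (k : ℤ) := by omega
      have e3 : ((M s t : ℤ) - 3) / 2 = (k : ℤ) - 1 := by omega
      have e4 : (M s t : ℤ) / 2 = (k : ℤ) := by omega
      have hkθ : ((k : ℝ) + 1) * θ = 2 * Real.pi - k * θ := by
        have : (M s t : ℝ) = 2 * k + 1 := by exact_mod_cast hk
        rw [this] at hmθ; linarith
      have z : ((Polynomial.Chebyshev.S ℝ (k : ℤ)).eval (2 * Real.cos θ)) +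
          ((Polynomial.Chebyshev.S ℝ ((k : ℤ) - 1)).eval (2 * Real.cos θ)) = 0 := by
        rw [hS, hS]; push_cast
        rw [sub_add_cancel, hkθ, Real.sin_two_pi_sub]; ring
      rw [e1, e2, e3, e4, z]
      simp

variable {M : CoxeterMatrix B} (cs : CoxeterSystem M W)

/-- The geometric representation of `W` on `ℝ^S`. -/
def geometricRep : W →* ((B → ℝ) ≃ₗ[ℝ] (B → ℝ)) :=
  cs.lift ⟨simpleReflection M, isLiftable_simpleReflection M⟩

/-- The root system `Φ = {w(α_s)}`. -/
def rootSystem : Set (B → ℝ) :=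
  range fun p : W × B ↦ geometricRep cs p.1 (simpleRoot p.2)

/-- The positive roots: those with nonnegative coordinates in the basis of simple roots. -/
def positiveRoots : Set (B → ℝ) := {v ∈ rootSystem cs | ∀ s, 0 ≤ v s}

lemma finite_positiveRoots [Finite W] : (positiveRoots cs).Finite :=
  (Set.finite_range _).subset fun _ h ↦ h.1

instance [Finite W] : Fintype (positiveRoots cs) := (finite_positiveRoots cs).fintype

/-- The matroid `M_Φ` of linear dependencies of the positive roots; equivalently, the matroid of
the arrangement of their orthogonal hyperplanes in the dual space. -/
def rootMatroid : Matroid (positiveRoots cs) :=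
  (IndepMatroid.ofFinitaryCardAugment univ
    (fun I ↦ LinearIndepOn ℝ (Subtype.val : positiveRoots cs → (B → ℝ)) I)
    (linearIndepOn_empty _ _)
    (fun _ _ h hss ↦ h.mono hss)
    (by
      intro I J hI hIfin hJ hJfin hcard
      by_contra! hcon
      have hspan : ∀ e ∈ J, (e : B → ℝ) ∈ Submodule.span ℝ (Subtype.val '' I) := by
        intro e he
        by_cases heI : e ∈ I
        · exact Submodule.subset_span ⟨e, heI, rfl⟩
        · by_contra hnot
          exact hcon e he heI (hI.insert hnot)
      have hle : Submodule.span ℝ (Subtype.val '' J : Set (B → ℝ)) ≤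
          Submodule.span ℝ (Subtype.val '' I) :=
        Submodule.span_le.2 (by rintro _ ⟨e, he, rfl⟩; exact hspan e he)
      have h1 := Submodule.finrank_mono hle
      have := hIfin.to_subtype
      have := hJfin.to_subtype
      have := Fintype.ofFinite I
      have := Fintype.ofFinite J
      have hI' := finrank_span_eq_card hI.linearIndependent
      have hJ' := finrank_span_eq_card hJ.linearIndependent
      rw [← Set.image_eq_range, ← Nat.card_eq_fintype_card, Nat.card_coe_set_eq] at hI' hJ'
      omega)
    (fun I h ↦ linearIndepOn_of_finite I fun J hJ hfin ↦ h J hJ hfin)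
    (fun I _ ↦ subset_univ I)).matroid

/-- The Coxeter diagram: `s` and `t` are joined when `m(s,t) ≥ 3`, including `m(s,t) = ∞`. -/
def coxeterDiagram (M : CoxeterMatrix B) : SimpleGraph B where
  Adj s t := s ≠ t ∧ M s t ≠ 2
  symm := ⟨fun s t h ↦ ⟨h.1.symm, by rw [M.symmetric t s]; exact h.2⟩⟩
  loopless := ⟨fun _ h ↦ h.1 rfl⟩

end Coxeter

end CoxeterBergman

end

open CoxeterBergman

open Set

noncomputable section

namespace CoxeterBergman

/-! ### Roots are positive or negative -/

section Roots

/-! Most of the argument concerns an arbitrary matroid of nonzero vectors. Irreducible flats are the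
flats whose vectors do not split into two nonempty parts with complementary spans
(`connected_of_isIrred`, `isIrred_of_connected`), and every flat is the direct sum of its connected
components (`IsComponent.disjoint_vspan`).

If `ω` lies in the cone of a nested set `N`, its weight is, up to a constant, a positive combination
of the rank deficiencies of a basis in the members of `N`. Hence the minimal bases are those that
contain a basis of each member (`isMinBase_iff`). They depend only on `N`, and they cover the ground
set (`exists_adapted_isBase_mem`), so there are no loops. Conversely, a weight without loops has
flats as sublevel sets (`vclosure_sublevel`). The components of this chain of flats form a nested
set whose cone contains the weight (`exists_isConeVector_of_loopless`), and they recover that nested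
set (`mem_iff_isComponent`). So the nested cones partition the weights without loops and refine the
coarse subdivision.

The two subdivisions agree when every contraction `G / F` of a connected flat `G` by a flat `F` is
connected. An exchange inside a connected contraction forces each equivalent weight to be constant
there (`apply_eq_of_isMinBase_iff`). The equivalent weights thus lie in the span of the cone, and a
boundary argument puts them into the cone itself (`exists_isConeVector_of_isMinBase_iff`).

For root systems this condition follows from reflections (`hasConnectedContractions_rootVec`). In a
separation of `G / F` the two sides are orthogonal, since reflecting one root in a nonorthogonal one
gives a root that belongs to neither side nor to `F`. Taking all roots of `G` that are not
orthogonal to one side, against those that are, then splits `G` itself. Finiteness of `W` supplies a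
positive definite invariant form, so orthogonal sets of roots have complementary spans.

The homeomorphism projects `-∑ t_G 1_G` along the indicator vectors of the components and
normalizes; it is a continuous bijection on a compact space. -/

lemma simpleRoot_nonneg {B : Type*} [DecidableEq B] (s : B) : (0 : B → ℝ) ≤ simpleRoot s := by
  intro t
  by_cases h : t = s
  · subst h; simp [simpleRoot]
  · simp [simpleRoot, h]

variable {B W : Type*} [Group W] [Fintype B] [DecidableEq B] {M : CoxeterMatrix B}
  (cs : CoxeterSystem M W)

lemma geometricRep_simple (s : B) : geometricRep cs (cs.simple s) = simpleReflection M s :=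
  cs.lift_apply_simple (isLiftable_simpleReflection M) s

lemma geometricRep_mul_apply (w w' : W) (x : B → ℝ) :
    geometricRep cs (w * w') x = geometricRep cs w (geometricRep cs w' x) := by
  rw [map_mul]; rfl

lemma simpleReflection_simpleRoot (s t : B) : simpleReflection M s (simpleRoot t) =
    simpleRoot t + (2 * Real.cos (Real.pi / (M t s : ℝ))) • simpleRoot s := by
  rw [simpleReflection_apply, coxeterForm_simpleRoot]
  module

lemma simpleReflection_self (s : B) : simpleReflection M s (simpleRoot s) = -simpleRoot s := by
  rw [simpleReflection_simpleRoot]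
  simp only [M.diagonal, Nat.cast_one, div_one, Real.cos_pi]
  module

lemma coxeterForm_comm (x y : B → ℝ) : coxeterForm M x y = coxeterForm M y x := by
  have h : (coxeterForm M).IsSymm := by
    rw [coxeterForm, Matrix.isSymm_toBilin'_iff_isSymm]
    ext s t
    simp [M.symmetric t s]
  exact h.eq x y

lemma coxeterForm_self (s : B) : coxeterForm M (simpleRoot s) (simpleRoot s) = 1 := by
  simp [coxeterForm_simpleRoot]

lemma coxeterForm_geometricRep (w : W) (x y : B → ℝ) :
    coxeterForm M (geometricRep cs w x) (geometricRep cs w y) = coxeterForm M x y := by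
  induction w using cs.simple_induction_left with
  | one => simp
  | mul_simple_left w s ih =>
    rw [geometricRep_mul_apply, geometricRep_mul_apply, geometricRep_simple, ← ih]
    simp only [simpleReflection_apply, map_sub, map_smul, LinearMap.sub_apply,
      LinearMap.smul_apply, smul_eq_mul, coxeterForm_self,
      coxeterForm_comm (simpleRoot s)]
    ring

/-- The coefficients of the roots of a dihedral group: `sin (k π / m) / sin (π / m)`, and `k` for
`m = ∞`. -/
def dihedralCoeff (m k : ℕ) : ℝ :=
  if m = 0 then k else Real.sin (k * (Real.pi / m)) / Real.sin (Real.pi / m)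

lemma dihedralCoeff_add_two (m k : ℕ) : dihedralCoeff m (k + 2) =
    2 * Real.cos (Real.pi / m) * dihedralCoeff m (k + 1) - dihedralCoeff m k := by
  unfold dihedralCoeff
  split_ifs with h
  · subst h; push_cast; simp; ring
  · have h1 : ((k + 2 : ℕ) : ℝ) * (Real.pi / m) = (k + 1 : ℕ) * (Real.pi / m) + Real.pi / m := by
      push_cast; ring
    have h2 : (k : ℝ) * (Real.pi / m) = (k + 1 : ℕ) * (Real.pi / m) - Real.pi / m := by
      push_cast; ring
    rw [h1, h2, Real.sin_add, Real.sin_sub]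
    ring

lemma dihedralCoeff_zero (m : ℕ) : dihedralCoeff m 0 = 0 := by
  simp [dihedralCoeff]

lemma sin_pi_div_pos {m : ℕ} (hm : 2 ≤ m) : 0 < Real.sin (Real.pi / m) := by
  have : (2 : ℝ) ≤ m := by exact_mod_cast hm
  apply Real.sin_pos_of_pos_of_lt_pi
  · have := Real.pi_pos; positivity
  · rw [div_lt_iff₀ (by linarith)]
    nlinarith [Real.pi_pos]

lemma dihedralCoeff_one {m : ℕ} (hm : m ≠ 1) : dihedralCoeff m 1 = 1 := by
  unfold dihedralCoeff
  split_ifs with h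
  · simp
  · rw [Nat.cast_one, one_mul, div_self (sin_pi_div_pos (by omega)).ne']

lemma dihedralCoeff_nonneg {m k : ℕ} (hm : m ≠ 1) (hk : m = 0 ∨ k ≤ m) :
    0 ≤ dihedralCoeff m k := by
  unfold dihedralCoeff
  split_ifs with h
  · positivity
  · have hk' : (k : ℝ) ≤ m := by exact_mod_cast hk.resolve_left h
    have hm' : (0 : ℝ) < m := by positivity
    refine div_nonneg (Real.sin_nonneg_of_nonneg_of_le_pi ?_ ?_) (sin_pi_div_pos (by omega)).le
    · have := Real.pi_pos; positivity
    · rw [mul_div_assoc', div_le_iff₀ hm', mul_comm]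
      gcongr

/-- The word ends in `t`, so `t` acts first. Each further letter changes one of the two
coefficients, by the three-term recursion `dihedralCoeff_add_two`. -/
lemma geometricRep_alternatingWord {s t : B} (hst : s ≠ t) (k : ℕ) :
    geometricRep cs (cs.wordProd (CoxeterSystem.alternatingWord s t k)) (simpleRoot s) =
      if Even k then dihedralCoeff (M s t) (k + 1) • simpleRoot s +
        dihedralCoeff (M s t) k • simpleRoot t
      else dihedralCoeff (M s t) k • simpleRoot s +
        dihedralCoeff (M s t) (k + 1) • simpleRoot t := by
  induction k with
  | zero => simp [CoxeterSystem.alternatingWord, dihedralCoeff_zero,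
      dihedralCoeff_one (M.off_diagonal s t hst)]
  | succ k ih =>
    rw [CoxeterSystem.alternatingWord_succ', CoxeterSystem.wordProd_cons, geometricRep_mul_apply,
      ih, geometricRep_simple, dihedralCoeff_add_two]
    by_cases hk : Even k
    · have hk' : ¬ Even (k + 1) := by simpa [Nat.even_add_one] using hk
      simp only [hk, hk', if_true, if_false, map_add, map_smul, simpleReflection_self,
        simpleReflection_simpleRoot t s]
      module
    · have hk' : Even (k + 1) := by simpa [Nat.even_add_one] using hk
      simp only [hk, hk', if_true, if_false, map_add, map_smul, simpleReflection_self,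
        simpleReflection_simpleRoot s t, M.symmetric t s]
      module

/-- Induction on length. Write `w = u a` with lengths adding up and `a` a longest possible
alternating word in `s`, `t` ending in a right descent `t` of `w`. Then `a` sends `α_s` to a
nonnegative combination of `α_s` and `α_t`, and the shorter `u` has neither `s` nor `t` as a right
descent. -/
lemma geometricRep_simpleRoot_nonneg (w : W) (s : B) (h : ¬ cs.IsRightDescent w s) :
    0 ≤ geometricRep cs w (simpleRoot s) := by
  induction hn : cs.length w using Nat.strong_induction_on generalizing w s with
  | _ n ih =>
    subst hn
    by_cases hw : w = 1
    · subst hw; simpa using simpleRoot_nonneg s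
    obtain ⟨t, ht⟩ := cs.exists_rightDescent_of_ne_one hw
    have hst : s ≠ t := fun h' ↦ h (h' ▸ ht)
    set a : ℕ → W := fun k ↦ cs.wordProd (CoxeterSystem.alternatingWord s t k) with ha
    have hla : ∀ k, cs.length (a k) ≤ k := fun k ↦ by
      simpa using cs.length_wordProd_le (CoxeterSystem.alternatingWord s t k)
    let Q : ℕ → Prop := fun k ↦ ∃ u, w = u * a k ∧ cs.length u + k = cs.length w
    have hQ1 : Q 1 := by
      refine ⟨w * cs.simple t, ?_, ?_⟩
      · simp [ha, CoxeterSystem.alternatingWord]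
      · exact cs.isRightDescent_iff.1 ht
    have hQb : ∀ k, Q k → k ≤ cs.length w := by rintro k ⟨u, -, h⟩; omega
    classical
    obtain ⟨k, hkQ, hk1, hmax⟩ : ∃ k, Q k ∧ 1 ≤ k ∧ ¬ Q (k + 1) := by
      refine ⟨Nat.findGreatest Q (cs.length w), Nat.findGreatest_spec (hQb 1 hQ1) hQ1,
        Nat.le_findGreatest (hQb 1 hQ1) hQ1, fun hQ ↦ ?_⟩
      have := Nat.le_findGreatest (hQb _ hQ) hQ
      omega
    obtain ⟨u, hu, hlu⟩ := hkQ
    obtain ⟨j, rfl⟩ : ∃ j, k = j + 1 := ⟨k - 1, by omega⟩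
    have hsucc : ∀ k, a (k + 1) = cs.simple (if Even k then t else s) * a k := fun k ↦ by
      simp only [ha]
      rw [CoxeterSystem.alternatingWord_succ', CoxeterSystem.wordProd_cons]
    -- A right descent of `u` equal to the next letter would lengthen the alternating factor. One
    -- equal to its first letter would cancel and make `w` shorter than its length.
    have hx : ¬ cs.IsRightDescent u (if Even (j + 1) then t else s) := by
      intro hd
      apply hmax
      refine ⟨u * cs.simple (if Even (j + 1) then t else s), ?_, ?_⟩
      · rw [hsucc, mul_assoc, cs.simple_mul_simple_cancel_left, hu]
      · have := cs.isRightDescent_iff.1 hd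
        omega
    have hy : ¬ cs.IsRightDescent u (if Even j then t else s) := by
      intro hd
      have h1 := cs.isRightDescent_iff.1 hd
      have h2 : w = u * cs.simple (if Even j then t else s) * a j := by
        rw [hu, hsucc, mul_assoc]
      have h3 := cs.length_mul_le (u * cs.simple (if Even j then t else s)) (a j)
      rw [← h2] at h3
      have := hla j
      omega
    have hboth : ¬ cs.IsRightDescent u s ∧ ¬ cs.IsRightDescent u t := by
      by_cases hj : Even j
      · have hj' : ¬ Even (j + 1) := by simpa [Nat.even_add_one] using hj
        simp only [hj, hj', if_true, if_false] at hx hy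
        exact ⟨hx, hy⟩
      · have hj' : Even (j + 1) := by simpa [Nat.even_add_one] using hj
        simp only [hj, hj', if_true, if_false] at hx hy
        exact ⟨hy, hx⟩
    have hs := ih _ (by omega) u s hboth.1 rfl
    have ht' := ih _ (by omega) u t hboth.2 rfl
    -- The word for `w s` has an alternating factor of length `j + 2`. It would not be reduced if `j
    -- + 2` exceeded a finite `m(s,t)`, whereas `w s` is longer than `w`. This bound keeps the sines
    -- nonnegative.
    have hkm : M s t = 0 ∨ j + 1 + 1 ≤ M s t := by
      by_contra! hcon
      have hnr := cs.not_isReduced_alternatingWord t s (m := j + 1 + 1)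
        (by rw [M.symmetric t s]; exact hcon.1) (by rw [M.symmetric t s]; omega)
      have hle := cs.length_wordProd_le (CoxeterSystem.alternatingWord t s (j + 1 + 1))
      have hne : cs.length (cs.wordProd (CoxeterSystem.alternatingWord t s (j + 1 + 1))) ≠
          j + 1 + 1 := by simpa [CoxeterSystem.IsReduced] using hnr
      rw [CoxeterSystem.length_alternatingWord] at hle
      have heq : w * cs.simple s =
          u * cs.wordProd (CoxeterSystem.alternatingWord t s (j + 1 + 1)) := by
        rw [CoxeterSystem.alternatingWord_succ, CoxeterSystem.wordProd_concat, ← mul_assoc, hu]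
      have h4 := cs.length_mul_le u (cs.wordProd (CoxeterSystem.alternatingWord t s (j + 1 + 1)))
      rw [← heq, cs.not_isRightDescent_iff.1 h] at h4
      omega
    have hm1 := M.off_diagonal s t hst
    have hc1 := dihedralCoeff_nonneg hm1 hkm
    have hc2 : 0 ≤ dihedralCoeff (M s t) (j + 1) :=
      dihedralCoeff_nonneg hm1 (hkm.imp_right fun _ ↦ by omega)
    rw [hu, geometricRep_mul_apply, geometricRep_alternatingWord cs hst]
    split_ifs <;> simp only [map_add, map_smul] <;>
      exact add_nonneg (smul_nonneg (by assumption) hs) (smul_nonneg (by assumption) ht')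

lemma neg_mem_rootSystem {x : B → ℝ} (hx : x ∈ rootSystem cs) : -x ∈ rootSystem cs := by
  obtain ⟨⟨w, s⟩, rfl⟩ := hx
  refine ⟨(w * cs.simple s, s), ?_⟩
  simp [geometricRep_simple, simpleReflection_self]

/-- Every root is positive or the negative of a positive root. -/
lemma mem_positiveRoots_or_neg_mem {x : B → ℝ} (hx : x ∈ rootSystem cs) :
    x ∈ positiveRoots cs ∨ -x ∈ positiveRoots cs := by
  have hx' := neg_mem_rootSystem cs hx
  obtain ⟨⟨w, s⟩, rfl⟩ := hx
  by_cases h : cs.IsRightDescent w s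
  · right
    have h1 := geometricRep_simpleRoot_nonneg cs _ s
      (cs.isRightDescent_iff_not_isRightDescent_mul.1 h)
    rw [geometricRep_mul_apply, geometricRep_simple, simpleReflection_self, map_neg] at h1
    exact ⟨hx', h1⟩
  · exact .inl ⟨⟨(w, s), rfl⟩, geometricRep_simpleRoot_nonneg cs w s h⟩

lemma coxeterForm_root_self {x : B → ℝ} (hx : x ∈ rootSystem cs) : coxeterForm M x x = 1 := by
  obtain ⟨⟨w, s⟩, rfl⟩ := hx
  rw [coxeterForm_geometricRep, coxeterForm_self]

/-- The reflection in a root is given by an element of the group. -/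
lemma exists_reflection {x : B → ℝ} (hx : x ∈ rootSystem cs) :
    ∃ r : W, ∀ y, geometricRep cs r y = y - (2 * coxeterForm M y x) • x := by
  obtain ⟨⟨w, s⟩, rfl⟩ := hx
  refine ⟨w * cs.simple s * w⁻¹, fun y ↦ ?_⟩
  have hy : geometricRep cs w (geometricRep cs w⁻¹ y) = y := by
    rw [← geometricRep_mul_apply]; simp
  rw [geometricRep_mul_apply, geometricRep_mul_apply, geometricRep_simple, simpleReflection_apply,
    map_sub, map_smul, hy, ← coxeterForm_geometricRep cs w, hy]

lemma geometricRep_mem_rootSystem (w : W) {x : B → ℝ} (hx : x ∈ rootSystem cs) :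
    geometricRep cs w x ∈ rootSystem cs := by
  obtain ⟨⟨w', s⟩, rfl⟩ := hx
  exact ⟨(w * w', s), geometricRep_mul_apply cs w w' _⟩

lemma reflection_mem_rootSystem {x y : B → ℝ} (hx : x ∈ rootSystem cs) (hy : y ∈ rootSystem cs) :
    y - (2 * coxeterForm M y x) • x ∈ rootSystem cs := by
  obtain ⟨r, hr⟩ := exists_reflection cs hx
  rw [← hr]
  exact geometricRep_mem_rootSystem cs r hy

lemma simpleRoot_mem_positiveRoots (s : B) : simpleRoot s ∈ positiveRoots cs :=
  ⟨⟨(1, s), by simp⟩, simpleRoot_nonneg s⟩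

/-! ### Orthogonal sets of roots -/

/-- The average over the group of the standard inner product. -/
def invariantForm [Fintype W] (x y : B → ℝ) : ℝ :=
  ∑ w : W, geometricRep cs w x ⬝ᵥ geometricRep cs w y

lemma invariantForm_geometricRep [Fintype W] (g : W) (x y : B → ℝ) :
    invariantForm cs (geometricRep cs g x) (geometricRep cs g y) = invariantForm cs x y := by
  simp only [invariantForm, ← geometricRep_mul_apply]
  exact Fintype.sum_equiv (Equiv.mulRight g) _ _ fun w ↦ rfl

lemma invariantForm_pos [Fintype W] {x : B → ℝ} (hx : x ≠ 0) : 0 < invariantForm cs x x := by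
  refine Finset.sum_pos (fun w _ ↦ ?_) Finset.univ_nonempty
  refine lt_of_le_of_ne (Finset.sum_nonneg fun i _ ↦ mul_self_nonneg _) (Ne.symm ?_)
  rw [Ne, dotProduct_self_eq_zero]
  simpa using hx

/-- The averaged inner product as a bilinear form. -/
def invariantBilin [Fintype W] : LinearMap.BilinForm ℝ (B → ℝ) :=
  LinearMap.mk₂ ℝ (invariantForm cs)
    (fun x y z ↦ by simp [invariantForm, add_dotProduct, Finset.sum_add_distrib])
    (fun c x y ↦ by simp [invariantForm, Finset.mul_sum])
    (fun x y z ↦ by simp [invariantForm, dotProduct_add, Finset.sum_add_distrib])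
    (fun c x y ↦ by simp [invariantForm, Finset.mul_sum])

/-- Apply invariance to the reflection in `x`, which sends `x` to `-x`. It follows that
orthogonality to a root for the Coxeter form implies orthogonality for the positive definite
averaged form, so definiteness of the Coxeter form itself need not be shown. -/
lemma invariantBilin_root [Fintype W] {x : B → ℝ} (hx : x ∈ rootSystem cs) (y : B → ℝ) :
    invariantBilin cs y x = coxeterForm M y x * invariantBilin cs x x := by
  obtain ⟨r, hr⟩ := exists_reflection cs hx
  have h : invariantBilin cs (geometricRep cs r y) (geometricRep cs r x) =
    invariantBilin cs y x := invariantForm_geometricRep cs r y x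
  rw [hr, hr, coxeterForm_root_self cs hx] at h
  simp only [map_sub, map_smul, LinearMap.sub_apply, LinearMap.smul_apply, smul_eq_mul] at h
  linarith

/-- Orthogonal sets of roots span complementary subspaces. -/
lemma disjoint_span_of_orthogonal [Finite W] {X Y : Set (B → ℝ)} (hY : Y ⊆ rootSystem cs)
    (h : ∀ x ∈ X, ∀ y ∈ Y, coxeterForm M x y = 0) :
    Disjoint (Submodule.span ℝ X) (Submodule.span ℝ Y) := by
  have := Fintype.ofFinite W
  rw [Submodule.disjoint_def]
  intro z hzX hzY
  have h1 : ∀ x ∈ X, ∀ y ∈ Y, invariantBilin cs x y = 0 := fun x hx y hy ↦ by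
    rw [invariantBilin_root cs (hY hy), h x hx y hy, zero_mul]
  have h2 : ∀ x ∈ X, ∀ y ∈ Submodule.span ℝ Y, invariantBilin cs x y = 0 := fun x hx y hy ↦ by
    have : Submodule.span ℝ Y ≤ LinearMap.ker (invariantBilin cs x) :=
      Submodule.span_le.2 fun y hy ↦ h1 x hx y hy
    exact this hy
  have h3 : invariantBilin cs z z = 0 := by
    have : Submodule.span ℝ X ≤ LinearMap.ker ((invariantBilin cs).flip z) :=
      Submodule.span_le.2 fun x hx ↦ h2 x hx z hzY
    exact this hzX
  by_contra hz
  exact (invariantForm_pos cs hz).ne' h3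

end Roots

/-! ### Connected sets of vectors -/

section Connected

variable {α V : Type*} [AddCommGroup V] [Module ℝ V] (v : α → V)

/-- The subspace spanned by the vectors with index in `X`. -/
def vspan (X : Set α) : Submodule ℝ V := Submodule.span ℝ (v '' X)

/-- The closure of `X`: all indices of vectors in the span of `X`. -/
def vclosure (X : Set α) : Set α := {e | v e ∈ vspan v X}

/-- A nonempty set of vectors is connected if it is not the union of two nonempty sets with
complementary spans. -/
def VConnected (X : Set α) : Prop :=
  X.Nonempty ∧ ∀ Y Z, Y ∪ Z = X → Disjoint (vspan v Y) (vspan v Z) → Y = ∅ ∨ Z = ∅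

variable {v}

lemma mem_vspan {X : Set α} {e : α} (he : e ∈ X) : v e ∈ vspan v X :=
  Submodule.subset_span (mem_image_of_mem v he)

lemma vspan_mono {X Y : Set α} (h : X ⊆ Y) : vspan v X ≤ vspan v Y :=
  Submodule.span_mono (image_mono h)

lemma vspan_le {X : Set α} {p : Submodule ℝ V} : vspan v X ≤ p ↔ ∀ e ∈ X, v e ∈ p := by
  simp [vspan, Submodule.span_le, subset_def]

lemma vspan_union (X Y : Set α) : vspan v (X ∪ Y) = vspan v X ⊔ vspan v Y := by
  rw [vspan, image_union, Submodule.span_union]; rfl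

lemma subset_vclosure (X : Set α) : X ⊆ vclosure v X := fun _ ↦ mem_vspan

lemma vspan_vclosure (X : Set α) : vspan v (vclosure v X) = vspan v X :=
  le_antisymm (vspan_le.2 fun _ h ↦ h) (vspan_mono (subset_vclosure X))

lemma vclosure_mono {X Y : Set α} (h : X ⊆ Y) : vclosure v X ⊆ vclosure v Y :=
  fun _ he ↦ vspan_mono h he

lemma vclosure_vclosure (X : Set α) : vclosure v (vclosure v X) = vclosure v X := by
  simp only [vclosure.eq_def v (vclosure v X), vspan_vclosure]; rfl

lemma vclosure_subset {X F : Set α} (hF : vclosure v F = F) (h : X ⊆ F) : vclosure v X ⊆ F :=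
  hF ▸ vclosure_mono h

lemma mem_of_mem_vspan {F : Set α} (hF : vclosure v F = F) {e : α} (he : v e ∈ vspan v F) :
    e ∈ F := hF ▸ (show e ∈ vclosure v F from he)

lemma disjoint_of_disjoint_vspan (hv : ∀ e, v e ≠ 0) {X Y : Set α}
    (h : Disjoint (vspan v X) (vspan v Y)) : Disjoint X Y :=
  Set.disjoint_left.2 fun e hX hY ↦ hv e (Submodule.disjoint_def.1 h _ (mem_vspan hX) (mem_vspan hY))

lemma disjoint_vspan_mono {X Y X' Y' : Set α} (h : Disjoint (vspan v X) (vspan v Y))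
    (hX : X' ⊆ X) (hY : Y' ⊆ Y) : Disjoint (vspan v X') (vspan v Y') :=
  h.mono (vspan_mono hX) (vspan_mono hY)

lemma VConnected.subset_or_subset {K Y Z : Set α} (hK : VConnected v K) (h : K ⊆ Y ∪ Z)
    (hd : Disjoint (vspan v Y) (vspan v Z)) : K ⊆ Y ∨ K ⊆ Z := by
  have hKeq : K ∩ Y ∪ K ∩ Z = K := by rw [← inter_union_distrib_left, inter_eq_left.2 h]
  rcases hK.2 _ _ hKeq (disjoint_vspan_mono hd inter_subset_right inter_subset_right) with h' | h'
  · right; rw [h', empty_union] at hKeq; exact inter_eq_left.1 hKeq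
  · left; rw [h', union_empty] at hKeq; exact inter_eq_left.1 hKeq

lemma vconnected_singleton (hv : ∀ e, v e ≠ 0) (e : α) : VConnected v {e} := by
  refine ⟨singleton_nonempty e, fun Y Z h hd ↦ ?_⟩
  by_contra! hne
  have hY : Y = {e} := (hne.1.subset_singleton_iff).1 (h ▸ subset_union_left)
  have hZ : Z = {e} := (hne.2.subset_singleton_iff).1 (h ▸ subset_union_right)
  exact Set.disjoint_left.1 (disjoint_of_disjoint_vspan hv hd) (hY ▸ mem_singleton e)
    (hZ ▸ mem_singleton e)

lemma VConnected.vclosure (hv : ∀ e, v e ≠ 0) {K : Set α} (hK : VConnected v K) :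
    VConnected v (vclosure v K) := by
  refine ⟨hK.1.mono (subset_vclosure K), ?_⟩
  have key : ∀ Y Z, Y ∪ Z = CoxeterBergman.vclosure v K → Disjoint (vspan v Y) (vspan v Z) →
      K ⊆ Y → Z = ∅ := by
    intro Y Z h hd hKY
    by_contra! hne
    obtain ⟨e, he⟩ := hne
    have he' : e ∈ CoxeterBergman.vclosure v K := h ▸ Or.inr he
    exact hv e (Submodule.disjoint_def.1 hd _ (vspan_mono hKY he') (mem_vspan he))
  intro Y Z h hd
  rcases hK.subset_or_subset (h ▸ subset_vclosure K) hd with h' | h'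
  · exact .inr (key Y Z h hd h')
  · exact .inl (key Z Y (union_comm Y Z ▸ h) hd.symm h')

variable (v) in
/-- `C` is a connected component of `F`. -/
def IsComponent (F C : Set α) : Prop := Maximal (fun K ↦ VConnected v K ∧ K ⊆ F) C

lemma IsComponent.connected {F C : Set α} (h : IsComponent v F C) : VConnected v C := h.prop.1

lemma IsComponent.subset {F C : Set α} (h : IsComponent v F C) : C ⊆ F := h.prop.2

lemma IsComponent.eq_of_subset {F C K : Set α} (h : IsComponent v F C) (hK : VConnected v K)
    (hKF : K ⊆ F) (hCK : C ⊆ K) : C = K :=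
  Maximal.eq_of_subset h ⟨hK, hKF⟩ hCK

lemma exists_isComponent [Finite α] {F K : Set α} (hK : VConnected v K) (hKF : K ⊆ F) :
    ∃ C, IsComponent v F C ∧ K ⊆ C := by
  obtain ⟨C, hKC, hC⟩ := (Set.toFinite {K | VConnected v K ∧ K ⊆ F}).exists_le_maximal
    (show K ∈ {K | VConnected v K ∧ K ⊆ F} from ⟨hK, hKF⟩)
  exact ⟨C, hC, hKC⟩

/-- A component splits off as a direct summand. If `F` is not connected, it splits as `Y ∪ Z` with
`C` inside one part, say `Y`. There `C` is again a component, so it splits off from `Y` by induction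
on the cardinality, and the two splittings combine. -/
lemma IsComponent.disjoint_vspan [Finite α] (hv : ∀ e, v e ≠ 0) {F C : Set α}
    (h : IsComponent v F C) : Disjoint (vspan v C) (vspan v (F \ C)) := by
  induction hn : F.ncard using Nat.strong_induction_on generalizing F with
  | _ n ih =>
    subst hn
    by_cases hF : VConnected v F
    · obtain rfl := h.eq_of_subset hF Subset.rfl h.subset
      simp [vspan]
    have hne : F.Nonempty := h.connected.1.mono h.subset
    simp only [VConnected, hne, true_and, not_forall, not_or] at hF
    obtain ⟨Y, Z, hYZ, hd, hY, hZ⟩ := hF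
    have key : ∀ Y Z, Y ∪ Z = F → Disjoint (vspan v Y) (vspan v Z) → Z ≠ ∅ → C ⊆ Y →
        Disjoint (vspan v C) (vspan v (F \ C)) := by
      rintro Y Z rfl hd hZ hCY
      have hlt : Y ⊂ Y ∪ Z := by
        refine ⟨subset_union_left, fun hss ↦ ?_⟩
        obtain ⟨e, he⟩ := nonempty_iff_ne_empty.2 hZ
        exact Set.disjoint_left.1 (disjoint_of_disjoint_vspan hv hd) (hss (Or.inr he)) he
      have hC : IsComponent v Y C :=
        ⟨⟨h.connected, hCY⟩, fun K hK hCK ↦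
          (h.eq_of_subset hK.1 (hK.2.trans subset_union_left) hCK).ge⟩
      have h1 := ih _ (ncard_lt_ncard hlt) hC rfl
      have h2 : Disjoint (vspan v C ⊔ vspan v (Y \ C)) (vspan v Z) :=
        hd.mono_left (sup_le (vspan_mono hCY) (vspan_mono sdiff_subset))
      have h3 := h1.disjoint_sup_right_of_disjoint_sup_left h2
      rw [← vspan_union] at h3
      exact disjoint_vspan_mono h3 Subset.rfl (by
        rintro e ⟨he | he, heC⟩
        exacts [.inl ⟨he, heC⟩, .inr he])
    rcases h.connected.subset_or_subset (hYZ ▸ h.subset) hd with h' | h'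
    · exact key Y Z hYZ hd hZ h'
    · exact key Z Y (union_comm Y Z ▸ hYZ) hd.symm hY h'

lemma IsComponent.subset_or_disjoint [Finite α] (hv : ∀ e, v e ≠ 0) {F C K : Set α}
    (h : IsComponent v F C) (hK : VConnected v K) (hKF : K ⊆ F) : K ⊆ C ∨ K ⊆ F \ C :=
  hK.subset_or_subset (by rwa [union_sdiff_cancel h.subset]) (h.disjoint_vspan hv)

lemma IsComponent.vclosure_eq (hv : ∀ e, v e ≠ 0) {F C : Set α} (hF : vclosure v F = F)
    (h : IsComponent v F C) : vclosure v C = C :=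
  (h.eq_of_subset (h.connected.vclosure hv) (vclosure_subset hF h.subset)
    (subset_vclosure C)).symm

/-! ### Linearly independent sets of vectors -/

/-- The span of `X \ Y` meets that of `Y` trivially, so the modular law removes it from the
intersection. -/
lemma vspan_inf_le {I X Y : Set α} (hI : LinearIndepOn ℝ v I) (hX : X ⊆ I) (hY : Y ⊆ I) :
    vspan v X ⊓ vspan v Y ≤ vspan v (X ∩ Y) := by
  have hdj : Disjoint (X \ Y) Y := disjoint_sdiff_left
  have hd : Disjoint (vspan v (X \ Y)) (vspan v Y) :=
    ((linearIndepOn_union_iff hdj).1 (hI.mono (union_subset (sdiff_subset.trans hX) hY))).2.2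
  rw [← inter_union_sdiff X Y, vspan_union, sup_inf_assoc_of_le _ (vspan_mono inter_subset_right),
    hd.eq_bot, sup_bot_eq, inter_union_sdiff]

/-- The element found has a nonzero coordinate in the expansion of `x` in the basis `I`. If all
coordinates on `T` vanished, intersecting spans would put `x` into the span of `I \ T`. -/
lemma exists_notMem_vspan_sdiff_singleton [Finite α] {I T : Set α} (hI : LinearIndepOn ℝ v I)
    {x : V} (hx : x ∈ vspan v I) (hxT : x ∉ vspan v (I \ T)) :
    ∃ e ∈ T, e ∈ I ∧ x ∉ vspan v (I \ {e}) := by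
  induction T, Set.toFinite T using Set.Finite.induction_on with
  | empty => simp [hx] at hxT
  | @insert a T _ _ ih =>
    by_cases h : x ∈ vspan v (I \ T)
    · have h' : x ∉ vspan v (I \ {a}) := fun h' ↦ hxT <| by
        have := vspan_inf_le hI sdiff_subset sdiff_subset ⟨h, h'⟩
        convert this using 2
        ext; simp; tauto
      refine ⟨a, mem_insert _ _, ?_, h'⟩
      by_contra ha
      rw [sdiff_singleton_eq_self ha] at h'
      exact h' hx
    · obtain ⟨e, he, h'⟩ := ih h
      exact ⟨e, mem_insert_of_mem _ he, h'⟩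

lemma exists_extension {I X : Set α} (hI : LinearIndepOn ℝ v I) (hIX : I ⊆ X) :
    ∃ J, I ⊆ J ∧ J ⊆ X ∧ LinearIndepOn ℝ v J ∧ vspan v J = vspan v X := by
  obtain ⟨J, hJX, hIJ, hs, hJ⟩ := exists_linearIndepOn_extension hI hIX
  exact ⟨J, hIJ, hJX, hJ, le_antisymm (vspan_mono hJX) (Submodule.span_le.2 hs)⟩

lemma ncard_eq_finrank [Finite α] {I : Set α} (hI : LinearIndepOn ℝ v I) :
    I.ncard = Module.finrank ℝ (vspan v I) := by
  have := Fintype.ofFinite I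
  have h := finrank_span_eq_card hI.linearIndependent
  rw [← Nat.card_eq_fintype_card, Nat.card_coe_set_eq] at h
  rw [← h, vspan, image_eq_range]

instance [Finite α] (X : Set α) : FiniteDimensional ℝ (vspan v X) :=
  FiniteDimensional.span_of_finite ℝ ((Set.toFinite X).image v)

lemma ncard_le_finrank [Finite α] {I X : Set α} (hI : LinearIndepOn ℝ v I) (h : I ⊆ X) :
    I.ncard ≤ Module.finrank ℝ (vspan v X) :=
  (ncard_eq_finrank hI).trans_le (Submodule.finrank_mono (vspan_mono h))

lemma ncard_eq_finrank_iff [Finite α] {I X : Set α} (hI : LinearIndepOn ℝ v I) (h : I ⊆ X) :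
    I.ncard = Module.finrank ℝ (vspan v X) ↔ vspan v X ≤ vspan v I := by
  rw [ncard_eq_finrank hI]
  constructor
  · exact fun h' ↦ (Submodule.eq_of_le_of_finrank_eq (vspan_mono h) h').ge
  · intro h'
    rw [le_antisymm h' (vspan_mono h)]

end Connected

/-! ### Vector matroids and irreducible flats -/

section VectorMatroid

variable {α V : Type*} [AddCommGroup V] [Module ℝ V]

/-- `M` is the matroid of linear dependencies of the nonzero vectors `v`. -/
structure IsVectorMatroid (M : Matroid α) (v : α → V) : Prop where
  ground_eq : M.E = univ
  indep_iff (I : Set α) : M.Indep I ↔ LinearIndepOn ℝ v I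
  ne_zero (e : α) : v e ≠ 0

variable {M : Matroid α} {v : α → V}

namespace IsVectorMatroid

lemma closure_eq (h : IsVectorMatroid M v) (X : Set α) : M.closure X = vclosure v X := by
  obtain ⟨I, hI⟩ := M.exists_isBasis X (by simp [h.ground_eq])
  have hli := (h.indep_iff I).1 hI.indep
  have hI' : ∀ e, e ∈ M.closure I ↔ e ∈ vclosure v I := fun e ↦ by
    rw [hI.indep.mem_closure_iff', h.ground_eq, h.indep_iff]
    simp only [mem_univ, true_and]
    exact hli.mem_span_iff.symm
  have hIX : vspan v I = vspan v X :=
    le_antisymm (vspan_mono hI.subset) (vspan_le.2 fun e he ↦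
      (hI' e).1 (hI.subset_closure he))
  rw [← hI.closure_eq_closure]
  ext e
  rw [hI', vclosure, vclosure, hIX]

lemma isFlat_iff (h : IsVectorMatroid M v) {F : Set α} : M.IsFlat F ↔ vclosure v F = F := by
  rw [Matroid.isFlat_iff_closure_eq, h.closure_eq]

lemma vclosure_flat (h : IsVectorMatroid M v) (F : Flats M) : vclosure v F.1 = F.1 :=
  h.isFlat_iff.1 F.2

lemma isBase_iff (h : IsVectorMatroid M v) {X : Set α} :
    M.IsBase X ↔ LinearIndepOn ℝ v X ∧ ∀ e, v e ∈ vspan v X := by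
  rw [Matroid.isBase_iff_indep_closure_eq, h.indep_iff, h.closure_eq, h.ground_eq,
    eq_univ_iff_forall]
  rfl

/-- The closure of a set as an element of the lattice of flats. -/
def flat (h : IsVectorMatroid M v) (X : Set α) : Flats M :=
  ⟨vclosure v X, h.isFlat_iff.2 (vclosure_vclosure X)⟩

lemma flat_le_iff (h : IsVectorMatroid M v) {X : Set α} {F : Flats M} : h.flat X ≤ F ↔ X ⊆ F.1 :=
  ⟨fun hle ↦ (subset_vclosure X).trans hle, fun hss ↦ vclosure_subset (h.vclosure_flat F) hss⟩

lemma vclosure_empty (h : IsVectorMatroid M v) : vclosure v ∅ = ∅ := by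
  rw [eq_empty_iff_forall_notMem]
  intro e he
  exact h.ne_zero e (by simpa [vclosure, vspan] using he)

lemma flat_empty_val (h : IsVectorMatroid M v) : (h.flat ∅).1 = ∅ := h.vclosure_empty

lemma isBot_iff (h : IsVectorMatroid M v) {F : Flats M} : IsBot F ↔ F.1 = ∅ := by
  constructor
  · intro hF
    exact subset_eq_empty (hF (h.flat ∅)) h.flat_empty_val
  · intro hF G
    change F.1 ⊆ G.1
    simp [hF]

lemma mem_of_mem_flat_singleton (h : IsVectorMatroid M v) {e f : α} {F : Flats M}
    (hfF : f ∈ F.1) (hf : f ∈ (h.flat {e}).1) : e ∈ F.1 := by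
  obtain ⟨c, hc⟩ := Submodule.mem_span_singleton.1
    (show v f ∈ Submodule.span ℝ {v e} by simpa [flat, vclosure, vspan] using hf)
  have hc0 : c ≠ 0 := by rintro rfl; exact h.ne_zero f (by simpa using hc.symm)
  apply mem_of_mem_vspan (h.vclosure_flat F)
  rw [← inv_smul_smul₀ hc0 (v e), hc]
  exact Submodule.smul_mem _ _ (mem_vspan hfF)

lemma isFlat_of_union_eq (h : IsVectorMatroid M v) {F : Flats M} {Y Z : Set α} (hYZ : Y ∪ Z = F.1)
    (hd : Disjoint (vspan v Y) (vspan v Z)) : M.IsFlat Y := by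
  refine h.isFlat_iff.2 (Subset.antisymm (fun e he ↦ ?_) (subset_vclosure Y))
  have heF : e ∈ Y ∪ Z :=
    hYZ ▸ vclosure_subset (h.vclosure_flat F) (hYZ ▸ subset_union_left) he
  refine heF.resolve_right fun heZ ↦ ?_
  exact h.ne_zero e (Submodule.disjoint_def.1 hd _ he (mem_vspan heZ))

/-- Projection to the first summand of a direct sum. It is the device by which spanning sets are
restricted to a summand. -/
lemma mem_vspan_of_mem_vspan_union {X Y A A' : Set α} (hd : Disjoint (vspan v X) (vspan v Y))
    (hA : A ⊆ X) (hA' : A' ⊆ Y) {x : V} (hx : x ∈ vspan v X) (hxA : x ∈ vspan v (A ∪ A')) :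
    x ∈ vspan v A := by
  rw [vspan_union] at hxA
  obtain ⟨a, ha, b, hb, rfl⟩ := Submodule.mem_sup.1 hxA
  have hb' : b ∈ vspan v X := by
    have := Submodule.sub_mem _ hx (vspan_mono hA ha)
    rwa [add_sub_cancel_left] at this
  rw [Submodule.disjoint_def.1 hd b hb' (vspan_mono hA' hb), add_zero]
  exact ha

lemma isFlat_union (h : IsVectorMatroid M v) {F : Flats M} {Y Z A A' : Set α} (hYZ : Y ∪ Z = F.1)
    (hd : Disjoint (vspan v Y) (vspan v Z)) (hA : M.IsFlat A) (hA' : M.IsFlat A') (hAY : A ⊆ Y)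
    (hAZ : A' ⊆ Z) : M.IsFlat (A ∪ A') := by
  refine h.isFlat_iff.2 (Subset.antisymm (fun e he ↦ ?_) (subset_vclosure _))
  have heF : e ∈ Y ∪ Z :=
    hYZ ▸ vclosure_subset (h.vclosure_flat F) (hYZ ▸ union_subset_union hAY hAZ) he
  rcases heF with heY | heZ
  · exact .inl <| mem_of_mem_vspan (h.isFlat_iff.1 hA) <|
      mem_vspan_of_mem_vspan_union hd hAY hAZ (mem_vspan heY) he
  · exact .inr <| mem_of_mem_vspan (h.isFlat_iff.1 hA') <|
      mem_vspan_of_mem_vspan_union hd.symm hAZ hAY (mem_vspan heZ) (by rwa [union_comm])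

lemma isFlat_inter (h : IsVectorMatroid M v) {A A' : Set α} (hA : M.IsFlat A) (hA' : M.IsFlat A') :
    M.IsFlat (A ∩ A') := by
  rw [h.isFlat_iff] at *
  exact Subset.antisymm (subset_inter (vclosure_subset hA inter_subset_left)
    (vclosure_subset hA' inter_subset_right)) (subset_vclosure _)

/-- A decomposition of a flat into two sets with complementary spans is a decomposition of the
interval below it. -/
def iicProdOrderIso (h : IsVectorMatroid M v) {F Y Z : Flats M} (hYZ : Y.1 ∪ Z.1 = F.1)
    (hd : Disjoint (vspan v Y.1) (vspan v Z.1)) : (Iic Y × Iic Z) ≃o Iic F where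
  toFun p := ⟨⟨p.1.1.1 ∪ p.2.1.1, h.isFlat_union hYZ hd p.1.1.2 p.2.1.2 p.1.2 p.2.2⟩,
    (union_subset_union p.1.2 p.2.2).trans hYZ.subset⟩
  invFun G := (⟨⟨G.1.1 ∩ Y.1, h.isFlat_inter G.1.2 Y.2⟩, inter_subset_right⟩,
    ⟨⟨G.1.1 ∩ Z.1, h.isFlat_inter G.1.2 Z.2⟩, inter_subset_right⟩)
  left_inv := by
    rintro ⟨⟨⟨A, hA⟩, hAY⟩, ⟨⟨A', hA'⟩, hAZ⟩⟩
    have hYZ' := Set.disjoint_left.1 (disjoint_of_disjoint_vspan h.ne_zero hd)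
    have hAY : A ⊆ Y.1 := hAY
    have hAZ : A' ⊆ Z.1 := hAZ
    refine Prod.ext (Subtype.ext (Subtype.ext ?_)) (Subtype.ext (Subtype.ext ?_))
    · change (A ∪ A') ∩ Y.1 = A
      ext e
      have := @hYZ' e
      have := @hAY e
      have := @hAZ e
      simp only [mem_inter_iff, mem_union]; tauto
    · change (A ∪ A') ∩ Z.1 = A'
      ext e
      have := @hYZ' e
      have := @hAY e
      have := @hAZ e
      simp only [mem_inter_iff, mem_union]; tauto
  right_inv := by
    rintro ⟨⟨A, hA⟩, hAF⟩
    have hAF : A ⊆ F.1 := hAF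
    refine Subtype.ext (Subtype.ext ?_)
    change A ∩ Y.1 ∪ A ∩ Z.1 = A
    rw [← inter_union_distrib_left, hYZ, inter_eq_left.2 hAF]
  map_rel_iff' := by
    rintro ⟨⟨⟨A, hA⟩, hAY⟩, ⟨⟨A', hA'⟩, hAZ⟩⟩ ⟨⟨⟨C, hC⟩, hCY⟩, ⟨⟨C', hC'⟩, hCZ⟩⟩
    have hYZ' := Set.disjoint_left.1 (disjoint_of_disjoint_vspan h.ne_zero hd)
    have hAY : A ⊆ Y.1 := hAY
    have hAZ : A' ⊆ Z.1 := hAZ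
    have hCY : C ⊆ Y.1 := hCY
    have hCZ : C' ⊆ Z.1 := hCZ
    change A ∪ A' ⊆ C ∪ C' ↔ A ⊆ C ∧ A' ⊆ C'
    constructor
    · intro hss
      constructor
      · intro e he
        exact (hss (.inl he)).resolve_right fun he' ↦ hYZ' (hAY he) (hCZ he')
      · intro e he
        exact (hss (.inr he)).resolve_left fun he' ↦ hYZ' (hCY he') (hAZ he)
    · exact fun h ↦ union_subset_union h.1 h.2

/-- The parts of a proper splitting are themselves smaller flats, and `iicProdOrderIso` makes the
interval the product of theirs. -/
lemma connected_of_isIrred (h : IsVectorMatroid M v) {F : Flats M} (hF : IsIrred F) :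
    VConnected v F.1 := by
  refine ⟨nonempty_iff_ne_empty.2 (mt h.isBot_iff.2 hF.1), fun Y Z hYZ hd ↦ ?_⟩
  by_contra! hne
  have hYZ' := Set.disjoint_left.1 (disjoint_of_disjoint_vspan h.ne_zero hd)
  let Y' : Flats M := ⟨Y, h.isFlat_of_union_eq hYZ hd⟩
  let Z' : Flats M := ⟨Z, h.isFlat_of_union_eq (union_comm Y Z ▸ hYZ) hd.symm⟩
  have hY : Y' < F := by
    refine lt_of_le_of_ne (hYZ ▸ subset_union_left : Y ⊆ F.1) fun heq ↦ ?_
    obtain ⟨e, he⟩ := hne.2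
    have : e ∈ Y'.1 := heq ▸ (hYZ ▸ Or.inr he : e ∈ F.1)
    exact hYZ' this he
  have hZ : Z' < F := by
    refine lt_of_le_of_ne (hYZ ▸ subset_union_right : Z ⊆ F.1) fun heq ↦ ?_
    obtain ⟨e, he⟩ := hne.1
    have : e ∈ Z'.1 := heq ▸ (hYZ ▸ Or.inl he : e ∈ F.1)
    exact hYZ' he this
  exact (hF.2 Y' Z' hY hZ).false (h.iicProdOrderIso (Y := Y') (Z := Z') hYZ hd)

/-! ### Product decompositions of intervals split the vectors of a flat -/

section Product

variable {F x₁ x₂ : Flats M} (φ : (Iic x₁ × Iic x₂) ≃o Iic F)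

/-- The bottom element of an interval of flats. -/
def iicBot (h : IsVectorMatroid M v) (x : Flats M) : Iic x :=
  ⟨h.flat ∅, h.flat_le_iff.2 (empty_subset _)⟩

lemma iicBot_le (h : IsVectorMatroid M v) {x : Flats M} (y : Iic x) : h.iicBot x ≤ y :=
  h.flat_le_iff.2 (empty_subset _)

lemma map_iicBot (h : IsVectorMatroid M v) : (φ (h.iicBot x₁, h.iicBot x₂)).1.1 = ∅ := by
  have h1 : φ (h.iicBot x₁, h.iicBot x₂) ≤ h.iicBot F := by
    rw [← φ.le_symm_apply]
    exact ⟨h.iicBot_le _, h.iicBot_le _⟩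
  exact subset_eq_empty h1 h.flat_empty_val

lemma eq_iicBot_of_map_eq_empty (h : IsVectorMatroid M v) {p : Iic x₁ × Iic x₂}
    (hp : (φ p).1.1 = ∅) : p = (h.iicBot x₁, h.iicBot x₂) := by
  apply φ.injective
  exact Subtype.ext (Subtype.ext (hp.trans (h.map_iicBot φ).symm))

/-- The closure of `{e}` is an atom, so its preimage is an atom of the product and lies in one of
the two factors. -/
lemma mem_map_prod (h : IsVectorMatroid M v) {p : Iic x₁ × Iic x₂} {e : α} (he : e ∈ (φ p).1.1) :
    e ∈ (φ (p.1, h.iicBot x₂)).1.1 ∨ e ∈ (φ (h.iicBot x₁, p.2)).1.1 := by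
  have hle : h.flat {e} ≤ (φ p).1 := h.flat_le_iff.2 (singleton_subset_iff.2 he)
  set q := φ.symm ⟨h.flat {e}, hle.trans (φ p).2⟩ with hq
  have hφq : (φ q).1 = h.flat {e} := by rw [hq, φ.apply_symm_apply]
  have hqp : q ≤ p := by
    rw [hq, φ.symm_apply_le]; exact hle
  have h1 : φ (q.1, h.iicBot x₂) ≤ φ q := φ.monotone ⟨le_rfl, h.iicBot_le _⟩
  have h2 : φ (h.iicBot x₁, q.2) ≤ φ q := φ.monotone ⟨h.iicBot_le _, le_rfl⟩
  rcases (φ (q.1, h.iicBot x₂)).1.1.eq_empty_or_nonempty with h3 | ⟨f, hf⟩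
  · rcases (φ (h.iicBot x₁, q.2)).1.1.eq_empty_or_nonempty with h4 | ⟨f, hf⟩
    · have h5 := h.eq_iicBot_of_map_eq_empty φ h3
      have h6 := h.eq_iicBot_of_map_eq_empty φ h4
      have h7 : q = (h.iicBot x₁, h.iicBot x₂) :=
        Prod.ext (Prod.ext_iff.1 h5).1 (Prod.ext_iff.1 h6).2
      have h8 : (h.flat {e}).1 = ∅ := by rw [← hφq, h7, h.map_iicBot φ]
      exact (notMem_empty e (h8 ▸ subset_vclosure {e} rfl)).elim
    · right
      have h5 : φ (h.iicBot x₁, q.2) ≤ φ (h.iicBot x₁, p.2) := φ.monotone ⟨le_rfl, hqp.2⟩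
      have h2 : (φ (h.iicBot x₁, q.2)).1 ≤ (φ q).1 := h2
      rw [hφq] at h2
      exact h5 (h.mem_of_mem_flat_singleton hf (h2 hf))
  · left
    have h5 : φ (q.1, h.iicBot x₂) ≤ φ (p.1, h.iicBot x₂) := φ.monotone ⟨hqp.1, le_rfl⟩
    have h1 : (φ (q.1, h.iicBot x₂)).1 ≤ (φ q).1 := h1
    rw [hφq] at h1
    exact h5 (h.mem_of_mem_flat_singleton hf (h1 hf))

/-- Let a nonzero `z` lie in both spans and let `i` be an element of a basis `I` of the first flat
that `z` needs. Enlarging the preimage of the flat of `I \ {i}` by the whole second factor gives a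
flat containing `I \ {i}` and `z`, hence `i`. By `mem_map_prod`, `i` then lies in the closure of `I
\ {i}`, against independence, or in both flats, whose preimages meet only in the bottom element. -/
lemma disjoint_vspan_map [Finite α] (h : IsVectorMatroid M v) (p : Iic x₁ × Iic x₂) :
    Disjoint (vspan v (φ (p.1, h.iicBot x₂)).1.1) (vspan v (φ (h.iicBot x₁, p.2)).1.1) := by
  set X := (φ (p.1, h.iicBot x₂)).1 with hX
  set Y := (φ (h.iicBot x₁, p.2)).1 with hY
  rw [Submodule.disjoint_def]
  intro z hzX hzY
  by_contra hz
  obtain ⟨I, -, hIX, hI, hIs⟩ := exists_extension (linearIndepOn_empty ℝ v) (empty_subset X.1)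
  obtain ⟨i, hiI, -, hi⟩ := exists_notMem_vspan_sdiff_singleton (T := I) hI (hIs ▸ hzX)
    (by simpa [vspan] using hz)
  have hle : h.flat (I \ {i}) ≤ X := h.flat_le_iff.2 (sdiff_subset.trans hIX)
  set q := φ.symm ⟨h.flat (I \ {i}), hle.trans (φ (p.1, h.iicBot x₂)).2⟩ with hq
  have hφq : (φ q).1 = h.flat (I \ {i}) := by rw [hq, φ.apply_symm_apply]
  have hq2 : q.2 = h.iicBot x₂ := by
    have : q ≤ (p.1, h.iicBot x₂) := by rw [hq, φ.symm_apply_le]; exact hle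
    exact le_antisymm this.2 (h.iicBot_le _)
  have hiX : i ∈ X.1 := hIX hiI
  -- the flat of the pair `(q.1, p.2)` contains `I \ {i}` and `z`, hence `i`
  have hmem : i ∈ (φ (q.1, p.2)).1.1 := by
    apply mem_of_mem_vspan (h.vclosure_flat _)
    have h1 : φ q ≤ φ (q.1, p.2) := φ.monotone ⟨le_rfl, hq2 ▸ h.iicBot_le _⟩
    have h1' : h.flat (I \ {i}) ≤ (φ (q.1, p.2)).1 := hφq ▸ h1
    have h2 : φ (h.iicBot x₁, p.2) ≤ φ (q.1, p.2) := φ.monotone ⟨h.iicBot_le _, le_rfl⟩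
    have hzm : z ∈ vspan v (φ (q.1, p.2)).1.1 := vspan_mono h2 hzY
    have hIm : vspan v (I \ {i}) ≤ vspan v (φ (q.1, p.2)).1.1 :=
      vspan_mono (h.flat_le_iff.1 h1')
    have hzI : z ∈ vspan v (insert i (I \ {i})) := by
      rw [insert_sdiff_self_of_mem hiI]; exact hIs ▸ hzX
    rw [vspan, image_insert_eq] at hzI
    have h3 := mem_span_insert_exchange hzI hi
    rw [Submodule.mem_span_insert] at h3
    obtain ⟨a, y, hy, hiy⟩ := h3
    rw [hiy]
    exact add_mem (Submodule.smul_mem _ _ hzm) (hIm hy)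
  rcases h.mem_map_prod φ hmem with h' | h'
  · have h4 : (q.1, h.iicBot x₂) = q := Prod.ext rfl hq2.symm
    simp only [h4, hφq] at h'
    exact hI.notMem_span hiI h'
  · have hY' : i ∈ Y.1 := h'
    set r := φ.symm ⟨h.flat {i}, (h.flat_le_iff.2 (singleton_subset_iff.2 hY')).trans
      (φ (h.iicBot x₁, p.2)).2⟩ with hr
    have hr1 : r ≤ (p.1, h.iicBot x₂) := by
      rw [hr, φ.symm_apply_le]; exact h.flat_le_iff.2 (singleton_subset_iff.2 hiX)
    have hr2 : r ≤ (h.iicBot x₁, p.2) := by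
      rw [hr, φ.symm_apply_le]; exact h.flat_le_iff.2 (singleton_subset_iff.2 hY')
    have hr3 : r = (h.iicBot x₁, h.iicBot x₂) :=
      Prod.ext (le_antisymm hr2.1 (h.iicBot_le _)) (le_antisymm hr1.2 (h.iicBot_le _))
    have h8 : (h.flat {i}).1 = ∅ := by
      rw [← h.map_iicBot φ, ← hr3, hr, φ.apply_symm_apply]
    exact notMem_empty i (h8 ▸ subset_vclosure {i} rfl)

end Product

/-- The intervals are finite, so a trivial first factor would force the intervals below `x₂` and `F`
to have equal size. This is where the strict inequality in the definition of irreducibility enters.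
-/
lemma ncard_iic_ne [Finite α] {x₁ x₂ F : Flats M} (φ : (Iic x₁ × Iic x₂) ≃o Iic F) (hx : x₂ < F)
    [Subsingleton (Iic x₁)] : False := by
  have : Nonempty (Iic x₁) := ⟨⟨x₁, self_mem_Iic⟩⟩
  have h1 : Nat.card (Iic x₁) = 1 := Nat.card_unique
  have h2 := Nat.card_congr φ.toEquiv
  rw [Nat.card_prod, h1, one_mul, Nat.card_coe_set_eq, Nat.card_coe_set_eq] at h2
  exact (ncard_lt_ncard (Iic_ssubset_Iic.2 hx)).ne h2

/-- The images of the two factors cover `F` and have complementary spans. Connectedness makes one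
image empty and its factor trivial, which the count of elements excludes. -/
lemma isIrred_of_connected [Finite α] (h : IsVectorMatroid M v) {F : Flats M}
    (hF : VConnected v F.1) : IsIrred F := by
  refine ⟨mt h.isBot_iff.1 hF.1.ne_empty, fun x₁ x₂ hx₁ hx₂ ↦ ⟨fun φ ↦ ?_⟩⟩
  have hd := h.disjoint_vspan_map φ (⟨x₁, self_mem_Iic⟩, ⟨x₂, self_mem_Iic⟩)
  have hF' : (φ (⟨x₁, self_mem_Iic⟩, ⟨x₂, self_mem_Iic⟩)).1 = F := by
    apply le_antisymm (φ _).2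
    have : (⟨F, self_mem_Iic⟩ : Iic F) ≤ φ (⟨x₁, self_mem_Iic⟩, ⟨x₂, self_mem_Iic⟩) := by
      rw [← φ.symm_apply_le]
      exact ⟨(φ.symm _).1.2, (φ.symm _).2.2⟩
    exact this
  have hcover : F.1 ⊆ (φ (⟨x₁, self_mem_Iic⟩, h.iicBot x₂)).1.1 ∪ (φ (h.iicBot x₁, ⟨x₂, self_mem_Iic⟩)).1.1 :=
    fun e he ↦ h.mem_map_prod φ (p := (⟨x₁, self_mem_Iic⟩, ⟨x₂, self_mem_Iic⟩)) (hF'.symm ▸ he)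
  have hsub : ∀ (x : Flats M), (⟨x, self_mem_Iic⟩ : Iic x) = h.iicBot x → Subsingleton (Iic x) := by
    intro x hx
    refine ⟨fun a b ↦ ?_⟩
    have key : ∀ a : Iic x, a = h.iicBot x := fun a ↦
      le_antisymm (hx ▸ a.2 : a ≤ h.iicBot x) (h.iicBot_le a)
    rw [key a, key b]
  have hempty : ∀ X Y : Set α, F.1 ⊆ X → Y ⊆ F.1 → Disjoint (vspan v X) (vspan v Y) → Y = ∅ :=
    fun X Y h1 h2 h3 ↦ eq_empty_of_forall_notMem fun e he ↦
      Set.disjoint_left.1 (disjoint_of_disjoint_vspan h.ne_zero h3) (h1 (h2 he)) he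
  rcases hF.subset_or_subset hcover hd with h1 | h1
  · have h2 := hempty _ _ h1 (φ _).2 hd
    have h3 := congrArg Prod.snd (h.eq_iicBot_of_map_eq_empty φ h2)
    have := hsub x₂ h3
    exact ncard_iic_ne ((OrderIso.prodComm).trans φ) hx₁
  · have h2 := hempty _ _ h1 (φ _).2 hd.symm
    have h3 := congrArg Prod.fst (h.eq_iicBot_of_map_eq_empty φ h2)
    have := hsub x₁ h3
    exact ncard_iic_ne φ hx₂

end IsVectorMatroid

end VectorMatroid

/-! ### Nested sets of flats of a vector matroid -/

section NestedFlats

variable {α V : Type*} [AddCommGroup V] [Module ℝ V] {M : Matroid α} {v : α → V}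

lemma vclosure_univ : vclosure v univ = univ :=
  Subset.antisymm (subset_univ _) (subset_vclosure _)

/-- The union of a finite set of flats. -/
def flatUnion (S : Finset (Flats M)) : Set α := ⋃ G ∈ S, G.1

lemma mem_flatUnion {S : Finset (Flats M)} {e : α} : e ∈ flatUnion S ↔ ∃ G ∈ S, e ∈ G.1 := by
  simp [flatUnion]

lemma subset_flatUnion {S : Finset (Flats M)} {G : Flats M} (hG : G ∈ S) : G.1 ⊆ flatUnion S :=
  fun _ he ↦ mem_flatUnion.2 ⟨G, hG, he⟩

lemma flatUnion_subset {S : Finset (Flats M)} {X : Set α} :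
    flatUnion S ⊆ X ↔ ∀ G ∈ S, G.1 ⊆ X := by
  simp [flatUnion]

lemma flatUnion_mono {S T : Finset (Flats M)} (h : S ⊆ T) :
    flatUnion S ⊆ flatUnion T := flatUnion_subset.2 fun _ hG ↦ subset_flatUnion (h hG)

variable (v) in
/-- `I` contains a spanning subset of every member of `S`. -/
def IsAdapted (S : Finset (Flats M)) (I : Set α) : Prop :=
  ∀ G ∈ S, vspan v G.1 ≤ vspan v (I ∩ G.1)

lemma IsAdapted.mono {S : Finset (Flats M)} {I J : Set α} (hI : IsAdapted v S I) (hIJ : I ⊆ J) :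
    IsAdapted v S J :=
  fun G hG ↦ (hI G hG).trans (vspan_mono (inter_subset_inter_left _ hIJ))

lemma IsVectorMatroid.isLUB_flat_flatUnion (h : IsVectorMatroid M v)
    (A : Finset (Flats M)) : IsLUB (A : Set (Flats M)) (h.flat (flatUnion A)) := by
  refine ⟨fun G hG ↦ ?_, fun F hF ↦ ?_⟩
  · exact (subset_flatUnion hG).trans (subset_vclosure _)
  · exact h.flat_le_iff.2 (flatUnion_subset.2 fun G hG ↦ hF hG)

variable [Finite α]

namespace IsVectorMatroid

variable (h : IsVectorMatroid M v)

include h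

/-- A connected set in the closure of a union of members of a nested set lies in one of them. -/
lemma exists_subset_of_subset_vclosure {P S : Finset (Flats M)} (hP : IsNested P) (hS : S ⊆ P)
    {K : Set α} (hK : VConnected v K) (hKS : K ⊆ vclosure v (flatUnion S)) :
    ∃ H ∈ S, K ⊆ H.1 := by
  classical
  set F := vclosure v (flatUnion S)
  obtain ⟨C, hC, hKC⟩ := exists_isComponent hK hKS
  have hCflat := hC.vclosure_eq h.ne_zero (vclosure_vclosure _)
  let c : Flats M := ⟨C, h.isFlat_iff.2 hCflat⟩
  have hc : IsIrred c := h.isIrred_of_connected hC.connected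
  set SC := S.filter (· ≤ c)
  -- Each member of `S` is connected, so it lies inside `C` or in `F \ C`. As `C` is a direct
  -- summand, the members inside `C` already span it.
  have hCSC : C ⊆ vclosure v (flatUnion SC) := by
    intro e he
    refine mem_vspan_of_mem_vspan_union (A' := F \ C) (hC.disjoint_vspan h.ne_zero)
      (flatUnion_subset.2 fun G hG ↦ (Finset.mem_filter.1 hG).2) Subset.rfl (mem_vspan he) ?_
    refine vspan_mono ?_ (hC.subset he)
    refine flatUnion_subset.2 fun G hG ↦ ?_
    rcases hC.subset_or_disjoint h.ne_zero (h.connected_of_isIrred (hP.1 G (hS hG)))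
      ((subset_flatUnion hG).trans (subset_vclosure _)) with h' | h'
    · exact (subset_flatUnion (Finset.mem_filter.2 ⟨hG, h'⟩)).trans subset_union_left
    · exact h'.trans subset_union_right
  set A := SC.filter fun G ↦ Maximal (· ∈ SC) G
  have hA : ∀ G ∈ SC, ∃ H ∈ A, G ≤ H := fun G hG ↦ by
    obtain ⟨H, hGH, hH⟩ := SC.finite_toSet.exists_le_maximal hG
    exact ⟨H, Finset.mem_filter.2 ⟨hH.prop, hH⟩, hGH⟩
  have hCA : C ⊆ vclosure v (flatUnion A) := hCSC.trans <| vclosure_mono <|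
    flatUnion_subset.2 fun G hG ↦ by
      obtain ⟨H, hH, hGH⟩ := hA G hG
      exact Subset.trans hGH (subset_flatUnion hH)
  have hAS : A ⊆ S := (Finset.filter_subset _ _).trans (Finset.filter_subset _ _)
  have hanti : IsAntichain (· ≤ ·) (A : Set (Flats M)) := by
    intro G hG H hH hne hle
    exact hne ((Finset.mem_filter.1 hG).2.eq_of_le (Finset.mem_filter.1 hH).1 hle)
  -- The maximal members inside `C` form an antichain with join `C`, which is irreducible.
  -- Nestedness allows this only if there are fewer than two of them.
  have hcard : A.card < 2 := by
    by_contra! hcard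
    obtain ⟨y, hy, hyirr⟩ := hP.2 A (hAS.trans hS) hcard hanti
    obtain rfl := hy.unique (h.isLUB_flat_flatUnion A)
    apply hyirr
    convert hc
    refine le_antisymm (h.flat_le_iff.2 (flatUnion_subset.2 fun G hG ↦ ?_)) hCA
    exact (Finset.mem_filter.1 (Finset.mem_filter.1 hG).1).2
  obtain ⟨e, he⟩ := hC.connected.1
  have hAne : A.Nonempty := by
    by_contra hne
    rw [Finset.not_nonempty_iff_eq_empty] at hne
    have := hCA he
    simp [hne, flatUnion, h.vclosure_empty] at this
  obtain ⟨H, hH⟩ : ∃ H, A = {H} := Finset.card_eq_one.1 (by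
    have := hAne.card_pos; omega)
  refine ⟨H, hAS (by simp [hH]), hKC.trans (hCA.trans ?_)⟩
  rw [hH]
  exact vclosure_subset (h.vclosure_flat H) (flatUnion_subset.2 (by simp))

/-- The component containing `G` of the closure of all these flats lies in one of them, and
incomparability leaves only `G`. So `G` is itself a component and splits off from the others. -/
lemma disjoint_vspan_flatUnion {P S : Finset (Flats M)} (hP : IsNested P) (hS : S ⊆ P)
    {G : Flats M} (hG : G ∈ P) (hinc : ∀ H ∈ S, ¬ H ≤ G ∧ ¬ G ≤ H) :
    Disjoint (vspan v G.1) (vspan v (flatUnion S)) := by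
  classical
  have hGc := h.connected_of_isIrred (hP.1 G hG)
  obtain ⟨C, hC, hGC⟩ := exists_isComponent (F := vclosure v (flatUnion (insert G S))) hGc
    ((subset_flatUnion (Finset.mem_insert_self _ _)).trans (subset_vclosure _))
  obtain ⟨H, hH, hCH⟩ := h.exists_subset_of_subset_vclosure hP (Finset.insert_subset hG hS)
    hC.connected hC.subset
  obtain rfl : H = G := by
    rcases Finset.mem_insert.1 hH with h' | h'
    · exact h'
    · exact absurd (hGC.trans hCH) (hinc H h').2
  obtain rfl : C = H.1 := hCH.antisymm hGC
  refine disjoint_vspan_mono (hC.disjoint_vspan h.ne_zero) Subset.rfl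
    (flatUnion_subset.2 fun K hK ↦ ?_)
  exact (hC.subset_or_disjoint h.ne_zero (h.connected_of_isIrred (hP.1 K (hS hK)))
    ((subset_flatUnion (Finset.mem_insert_of_mem hK)).trans (subset_vclosure _))).resolve_left
    (hinc K hK).1

/-- Every element covered by a nested set lies in a smallest member. -/
lemma exists_minimal_member {P : Finset (Flats M)} (hP : IsNested P) {e : α}
    (he : e ∈ flatUnion P) : ∃ G ∈ P, ∀ K ∈ P, e ∈ K.1 ↔ G ≤ K := by
  classical
  obtain ⟨G₀, hG₀, heG₀⟩ := mem_flatUnion.1 he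
  obtain ⟨G, -, hG⟩ := (P.filter fun G ↦ e ∈ G.1).finite_toSet.exists_le_minimal
    (Finset.mem_filter.2 ⟨hG₀, heG₀⟩)
  obtain ⟨hGP, heG⟩ := Finset.mem_filter.1 hG.prop
  refine ⟨G, hGP, fun K hK ↦ ⟨fun heK ↦ ?_, fun hle ↦ hle heG⟩⟩
  by_contra hGK
  have hKG : ¬ K ≤ G := fun hKG ↦ hGK (hG.le_of_le (Finset.mem_filter.2 ⟨hK, heK⟩) hKG)
  have hd := h.disjoint_vspan_flatUnion hP (S := {K}) (by simpa using hK) hGP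
    (by simpa using ⟨hKG, hGK⟩)
  exact Set.disjoint_left.1 (disjoint_of_disjoint_vspan h.ne_zero hd) heG
    (mem_flatUnion.2 ⟨K, by simp, heK⟩)

/-- Every member of a nested set has an element which lies in no smaller member. -/
lemma exists_generic_element {P : Finset (Flats M)} (hP : IsNested P) {G : Flats M} (hG : G ∈ P) :
    ∃ e, ∀ K ∈ P, e ∈ K.1 ↔ G ≤ K := by
  classical
  by_contra! hcon
  -- Without such an element, `G` is covered by the members not above it. Being connected, `G` would
  -- then lie in one of them.
  have hsub : G.1 ⊆ flatUnion (P.filter fun K ↦ ¬ G ≤ K) := by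
    intro e he
    obtain ⟨K, hK, h' | h'⟩ := hcon e
    · exact mem_flatUnion.2 ⟨K, Finset.mem_filter.2 ⟨hK, h'.2⟩, h'.1⟩
    · exact absurd (h'.2 he) h'.1
  obtain ⟨H, hH, hGH⟩ := h.exists_subset_of_subset_vclosure hP (Finset.filter_subset _ P)
    (h.connected_of_isIrred (hP.1 G hG)) (hsub.trans (subset_vclosure _))
  exact (Finset.mem_filter.1 hH).2 hGH

lemma maximal_isIrred_iff {C : Flats M} : Maximal IsIrred C ↔ IsComponent v univ C.1 := by
  constructor
  · intro hC
    refine ⟨⟨h.connected_of_isIrred hC.prop, subset_univ _⟩, fun K hK hCK ↦ ?_⟩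
    have := hC.le_of_ge (y := h.flat K) (h.isIrred_of_connected (hK.1.vclosure h.ne_zero))
      (Subset.trans hCK (subset_vclosure K))
    exact h.flat_le_iff.1 this
  · intro hC
    exact ⟨h.isIrred_of_connected hC.connected, fun K hK hCK ↦
      (hC.eq_of_subset (h.connected_of_isIrred hK) (subset_univ _) hCK).ge⟩

lemma exists_maximal_ge {K : Set α} (hK : VConnected v K) :
    ∃ C : Flats M, Maximal IsIrred C ∧ K ⊆ C.1 := by
  obtain ⟨C, hC, hKC⟩ := exists_isComponent hK (subset_univ K)
  let c : Flats M := ⟨C, h.isFlat_iff.2 (hC.vclosure_eq h.ne_zero vclosure_univ)⟩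
  exact ⟨c, h.maximal_isIrred_iff.2 hC, hKC⟩

lemma eq_of_maximal_of_mem {C C' : Flats M} (hC : Maximal IsIrred C) (hC' : Maximal IsIrred C')
    {e : α} (he : e ∈ C.1) (he' : e ∈ C'.1) : C = C' := by
  rcases (h.maximal_isIrred_iff.1 hC').subset_or_disjoint h.ne_zero
    (h.connected_of_isIrred hC.prop) (subset_univ _) with h' | h'
  · exact hC.eq_of_le hC'.prop h'
  · exact absurd he' (h' he).2

end IsVectorMatroid

/-! ### Adjoining the connected components to a nested set -/

open Classical in
/-- A set of flats together with all maximal irreducible flats. -/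
def withMaximal (N : Finset (Flats M)) : Finset (Flats M) :=
  N ∪ (Set.toFinite {C : Flats M | Maximal IsIrred C}).toFinset

lemma mem_withMaximal {N : Finset (Flats M)} {G : Flats M} :
    G ∈ withMaximal N ↔ G ∈ N ∨ Maximal IsIrred G := by
  simp [withMaximal]

namespace IsVectorMatroid

variable (h : IsVectorMatroid M v)

include h

/-- The join of an antichain with a member which is a component of some set containing the whole
antichain is not irreducible. -/
lemma not_isIrred_flatUnion {A : Finset (Flats M)} (hcard : 2 ≤ A.card)
    (hA : IsAntichain (· ≤ ·) (A : Set (Flats M))) {C F : Flats M} (hCA : C ∈ A)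
    (hC : IsComponent v F.1 C.1) (hF : ∀ G ∈ A, G ≤ F) : ¬ IsIrred (h.flat (flatUnion A)) := by
  intro hy
  have hub := (h.isLUB_flat_flatUnion A).1
  obtain ⟨K, hK, hKC⟩ := Finset.exists_mem_ne (by omega : 1 < A.card) C
  rcases hC.subset_or_disjoint h.ne_zero (h.connected_of_isIrred hy)
    (h.flat_le_iff.2 (flatUnion_subset.2 hF)) with h' | h'
  · exact hA hK hCA hKC ((hub hK).trans h')
  · obtain ⟨e, he⟩ := hC.connected.1
    exact (h' (hub hCA he)).2 he

/-- An antichain that is not inside `N` contains a connected component of the whole matroid, so its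
join splits. -/
lemma isNested_withMaximal {N : Finset (Flats M)} (hN : IsNested N) :
    IsNested (withMaximal N) := by
  refine ⟨fun G hG ↦ ?_, fun A hA hcard hanti ↦ ?_⟩
  · rcases mem_withMaximal.1 hG with h' | h'
    · exact hN.1 G h'
    · exact h'.prop
  · by_cases hAN : A ⊆ N
    · exact hN.2 A hAN hcard hanti
    obtain ⟨C, hCA, hCN⟩ := Finset.not_subset.1 hAN
    have hC := h.maximal_isIrred_iff.1 ((mem_withMaximal.1 (hA hCA)).resolve_left hCN)
    let E : Flats M := ⟨univ, h.isFlat_iff.2 vclosure_univ⟩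
    exact ⟨_, h.isLUB_flat_flatUnion A, h.not_isIrred_flatUnion hcard hanti (F := E) hCA hC
      fun G _ ↦ subset_univ G.1⟩

lemma flatUnion_withMaximal (N : Finset (Flats M)) : flatUnion (withMaximal N) = univ := by
  rw [eq_univ_iff_forall]
  intro e
  obtain ⟨C, hC, heC⟩ := h.exists_maximal_ge (vconnected_singleton h.ne_zero e)
  exact mem_flatUnion.2 ⟨C, mem_withMaximal.2 (.inr hC), heC rfl⟩

end IsVectorMatroid

/-! ### Bases adapted to nested sets -/

namespace IsVectorMatroid

variable (h : IsVectorMatroid M v)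

include h

-- Extend `I` to a basis `J` of the span of all the flats. The elements of `J` outside `G` lie in
-- members of `S` incomparable with `G`, whose joint span is complementary to that of `G`.
-- Projecting to `G` shows that `J ∩ G` spans it.
open Classical in
lemma exists_adapted_insert {P S : Finset (Flats M)} (hP : IsNested P) (hS : S ⊆ P) {G : Flats M}
    (hG : G ∈ P) (hGS : ∀ H ∈ S, ¬ G ≤ H) {I : Set α} (hI : LinearIndepOn ℝ v I)
    (hIS : I ⊆ flatUnion (insert G S)) (hIa : IsAdapted v S I) :
    ∃ J, I ⊆ J ∧ J ⊆ flatUnion (insert G S) ∧ LinearIndepOn ℝ v J ∧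
      IsAdapted v (insert G S) J := by
  obtain ⟨J, hIJ, hJS, hJ, hJs⟩ := exists_extension hI hIS
  refine ⟨J, hIJ, hJS, hJ, fun H hH ↦ ?_⟩
  rcases Finset.mem_insert.1 hH with rfl | hH
  · have hd := h.disjoint_vspan_flatUnion hP (S := S.filter (¬ · ≤ H))
      ((Finset.filter_subset _ _).trans hS) hG
      fun K hK ↦ ⟨(Finset.mem_filter.1 hK).2, hGS K (Finset.mem_filter.1 hK).1⟩
    refine vspan_le.2 fun e he ↦ mem_vspan_of_mem_vspan_union (A' := J \ H.1) hd
      inter_subset_right ?_ (mem_vspan he) ?_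
    · rintro f ⟨hfJ, hfH⟩
      obtain ⟨K, hK, hfK⟩ := mem_flatUnion.1 (hJS hfJ)
      rcases Finset.mem_insert.1 hK with rfl | hK
      · exact absurd hfK hfH
      · exact mem_flatUnion.2 ⟨K, Finset.mem_filter.2 ⟨hK, fun hle ↦ hfH (hle hfK)⟩, hfK⟩
    · rw [inter_union_sdiff, hJs]
      exact vspan_mono (subset_flatUnion (Finset.mem_insert_self _ _)) (mem_vspan he)
  · exact hIa.mono hIJ H hH

/-- The missing members are inserted from the bottom up, a minimal one at each step, so that
`exists_adapted_insert` always applies. -/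
lemma exists_adapted_extension {P S : Finset (Flats M)} (hP : IsNested P) (hS : S ⊆ P)
    (hlow : ∀ H ∈ S, ∀ K ∈ P, K ≤ H → K ∈ S) {I : Set α} (hI : LinearIndepOn ℝ v I)
    (hIS : I ⊆ flatUnion S) (hIa : IsAdapted v S I) :
    ∃ J, I ⊆ J ∧ J ⊆ flatUnion P ∧ LinearIndepOn ℝ v J ∧ IsAdapted v P J := by
  classical
  induction hn : (P \ S).card using Nat.strong_induction_on generalizing S I with
  | _ n ih =>
    subst hn
    rcases (P \ S).eq_empty_or_nonempty with hPS | ⟨G₀, hG₀⟩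
    · obtain rfl := hS.antisymm (Finset.sdiff_eq_empty_iff_subset.1 hPS)
      exact ⟨I, Subset.rfl, hIS, hI, hIa⟩
    obtain ⟨G, -, hG⟩ := (P \ S).finite_toSet.exists_le_minimal hG₀
    obtain ⟨hGP, hGS⟩ := Finset.mem_sdiff.1 hG.prop
    obtain ⟨J, hIJ, hJS, hJ, hJa⟩ := h.exists_adapted_insert hP hS hGP
      (fun H hH hle ↦ hGS (hlow H hH G hGP hle)) hI
      (hIS.trans (flatUnion_mono (Finset.subset_insert _ _))) hIa
    have hlt : (P \ insert G S).card < (P \ S).card := by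
      apply Finset.card_lt_card
      refine Finset.ssubset_iff_subset_ne.2
        ⟨Finset.sdiff_subset_sdiff Subset.rfl (Finset.subset_insert _ _), fun heq ↦ ?_⟩
      have : G ∈ P \ insert G S := heq ▸ hG.prop
      simp at this
    obtain ⟨J', hJJ', hJ'⟩ := ih _ hlt (S := insert G S) (Finset.insert_subset hGP hS) (by
      intro H hH K hK hKH
      rcases Finset.mem_insert.1 hH with rfl | hH
      · by_contra hcon
        rw [Finset.mem_insert, not_or] at hcon
        exact hcon.1 (hG.eq_of_le (Finset.mem_sdiff.2 ⟨hK, hcon.2⟩) hKH)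
      · exact Finset.mem_insert_of_mem (hlow H hH K hK hKH)) hJ hJS hJa rfl
    exact ⟨J', hIJ.trans hJJ', hJ'⟩

/-- This shows that the initial matroid has no loops. The members avoiding `e` are treated first. As
`{e}` is connected, `e` is not in the closure of their union and can be added independently before
the members containing `e` are inserted, the smallest one first. -/
lemma exists_adapted_isBase_mem {P : Finset (Flats M)} (hP : IsNested P) {e : α}
    (he : e ∈ flatUnion P) : ∃ X, M.IsBase X ∧ e ∈ X ∧ IsAdapted v P X := by
  classical
  obtain ⟨G, hG, hGe⟩ := h.exists_minimal_member hP he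
  set S := P.filter fun H ↦ e ∉ H.1
  have hSP : S ⊆ P := Finset.filter_subset _ _
  obtain ⟨I, -, hIS, hI, hIa⟩ := h.exists_adapted_extension (hP.mono hSP) (S := ∅)
    (Finset.empty_subset _) (by simp) (linearIndepOn_empty ℝ v) (empty_subset _)
    (fun G hG ↦ by simp at hG)
  have heI : v e ∉ vspan v I := fun heI ↦ by
    obtain ⟨H, hH, heH⟩ := h.exists_subset_of_subset_vclosure hP hSP
      (vconnected_singleton h.ne_zero e) (singleton_subset_iff.2 (vspan_mono hIS heI))
    exact (Finset.mem_filter.1 hH).2 (heH rfl)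
  obtain ⟨J, hIJ, hJS, hJ, hJa⟩ := h.exists_adapted_insert hP hSP hG
    (fun H hH hle ↦ (Finset.mem_filter.1 hH).2 ((hGe H (hSP hH)).2 hle)) (hI.insert heI)
    (insert_subset (subset_flatUnion (Finset.mem_insert_self _ _) ((hGe G hG).2 le_rfl))
      (hIS.trans (flatUnion_mono (Finset.subset_insert _ _))))
    (hIa.mono (subset_insert _ _))
  obtain ⟨J', hJJ', -, hJ', hJ'a⟩ := h.exists_adapted_extension hP (Finset.insert_subset hG hSP) (by
    intro H hH K hK hKH
    by_cases heK : e ∈ K.1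
    · have hGK := (hGe K hK).1 heK
      rcases Finset.mem_insert.1 hH with rfl | hH
      · exact Finset.mem_insert.2 (.inl (le_antisymm hKH hGK))
      · exact absurd (hKH heK) (Finset.mem_filter.1 hH).2
    · exact Finset.mem_insert_of_mem (Finset.mem_filter.2 ⟨hK, heK⟩)) hJ hJS hJa
  obtain ⟨X, hJX, -, hX, hXs⟩ := exists_extension hJ' (subset_univ J')
  exact ⟨X, h.isBase_iff.2 ⟨hX, fun f ↦ hXs ▸ mem_vspan (mem_univ f)⟩,
    hJX (hJJ' (hIJ (mem_insert _ _))), hJ'a.mono hJX⟩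

lemma exists_adapted_isBase {P : Finset (Flats M)} (hP : IsNested P) :
    ∃ X, M.IsBase X ∧ IsAdapted v P X := by
  obtain ⟨J, -, -, hJ, hJa⟩ := h.exists_adapted_extension hP (S := ∅)
    (Finset.empty_subset _) (by simp) (linearIndepOn_empty ℝ v) (empty_subset _)
    (fun G hG ↦ by simp at hG)
  obtain ⟨X, hJX, -, hX, hXs⟩ := exists_extension hJ (subset_univ J)
  exact ⟨X, h.isBase_iff.2 ⟨hX, fun f ↦ hXs ▸ mem_vspan (mem_univ f)⟩, hJa.mono hJX⟩

end IsVectorMatroid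

end NestedFlats

/-! ### Combinations of indicator vectors of nested flats -/

section Combination

variable {α V : Type*} [AddCommGroup V] [Module ℝ V] {M : Matroid α} {v : α → V}

open Classical in
/-- Extension by zero of a coefficient vector. -/
def extendByZero (P : Finset (Flats M)) (c : P → ℝ) (G : Flats M) : ℝ :=
  if hG : G ∈ P then c ⟨G, hG⟩ else 0

lemma extendByZero_apply (P : Finset (Flats M)) (c : P → ℝ) (G : P) :
    extendByZero P c G = c G := by simp [extendByZero]

lemma extendByZero_of_notMem (P : Finset (Flats M)) (c : P → ℝ) :
    ∀ G ∉ P, extendByZero P c G = 0 := fun G hG ↦ by simp [extendByZero, hG]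

variable [Fintype α]

/-- The vector `∑ a_G 1_G`. -/
def flatComb (a : Flats M → ℝ) (e : α) : ℝ := ∑ G : Flats M, (G : Set α).indicator (fun _ ↦ a G) e

lemma flatComb_add (a b : Flats M → ℝ) (e : α) :
    flatComb (a + b) e = flatComb a e + flatComb b e := by
  simp only [flatComb, ← Finset.sum_add_distrib]
  refine Finset.sum_congr rfl fun G _ ↦ ?_
  by_cases he : e ∈ G.1 <;> simp [he]

lemma flatComb_smul (c : ℝ) (a : Flats M → ℝ) (e : α) :
    flatComb (c • a) e = c * flatComb a e := by
  simp only [flatComb, Finset.mul_sum]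
  refine Finset.sum_congr rfl fun G _ ↦ ?_
  by_cases he : e ∈ G.1 <;> simp [he]

open Classical in
lemma flatComb_eq_sum {P : Finset (Flats M)} {a : Flats M → ℝ} (ha : ∀ G ∉ P, a G = 0) {e : α}
    {G : Flats M} (hG : ∀ K ∈ P, e ∈ K.1 ↔ G ≤ K) :
    flatComb a e = ∑ K ∈ P with G ≤ K, a K := by
  rw [flatComb, Finset.sum_filter, ← Finset.sum_subset (Finset.subset_univ P)]
  · refine Finset.sum_congr rfl fun K hK ↦ ?_
    by_cases he : G ≤ K
    · simp [he, (hG K hK).2 he]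
    · simp [he, mt (hG K hK).1 he]
  · intro K _ hK
    simp [ha K hK]

open Classical in
lemma flatComb_congr {P : Finset (Flats M)} {a : Flats M → ℝ} (ha : ∀ G ∉ P, a G = 0) {e f : α}
    (hef : ∀ K ∈ P, e ∈ K.1 ↔ f ∈ K.1) : flatComb a e = flatComb a f := by
  rw [flatComb, flatComb]
  refine Finset.sum_congr rfl fun K _ ↦ ?_
  by_cases hK : K ∈ P
  · simp only [indicator, hef K hK]
  · simp [ha K hK]

/-- The linear map `c ↦ ∑ c_G 1_G` on coefficient vectors indexed by `P`. -/
def flatCombLinear (P : Finset (Flats M)) : (P → ℝ) →ₗ[ℝ] (α → ℝ) where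
  toFun c := flatComb (extendByZero P c)
  map_add' c d := by
    have : extendByZero P (c + d) = extendByZero P c + extendByZero P d := by
      funext G; by_cases hG : G ∈ P <;> simp [extendByZero, hG]
    funext e
    rw [this, flatComb_add, Pi.add_apply]
  map_smul' r c := by
    have : extendByZero P (r • c) = r • extendByZero P c := by
      funext G; by_cases hG : G ∈ P <;> simp [extendByZero, hG]
    funext e
    rw [this, flatComb_smul, RingHom.id_apply, Pi.smul_apply, smul_eq_mul]

lemma flatCombLinear_apply (P : Finset (Flats M)) (c : P → ℝ) :
    flatCombLinear P c = flatComb (extendByZero P c) := rfl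

lemma weight_neg_flatComb (a : Flats M → ℝ) (X : Set α) :
    weight (fun e ↦ -flatComb a e) X = -∑ G, a G * (X ∩ G.1).ncard := by
  classical
  have h1 : ∀ G : Flats M, a G * ((X ∩ G.1).ncard : ℝ) = ∑ e, (X ∩ G.1).indicator (fun _ ↦ a G) e := by
    intro G
    rw [Finset.sum_indicator_eq_sum_filter, Finset.sum_const, nsmul_eq_mul, mul_comm,
      ncard_eq_toFinset_card']
    congr 3
    ext; simp
  rw [weight, Finset.sum_congr rfl fun G _ ↦ h1 G, Finset.sum_comm, ← Finset.sum_neg_distrib]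
  refine Finset.sum_congr rfl fun e _ ↦ ?_
  by_cases he : e ∈ X
  · simp only [indicator, he, if_true, flatComb, mem_inter_iff, true_and]
  · simp [indicator, he]

namespace IsVectorMatroid

variable (h : IsVectorMatroid M v)

include h

/-- The indicator vectors of a nested set are linearly independent. At a generic element of `G` only
the members above `G` contribute, so the system is triangular and is solved from the top down. -/
lemma flatComb_injective {P : Finset (Flats M)} (hP : IsNested P) {a b : Flats M → ℝ}
    (ha : ∀ G ∉ P, a G = 0) (hb : ∀ G ∉ P, b G = 0) (hab : ∀ e, flatComb a e = flatComb b e) :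
    a = b := by
  classical
  funext G
  induction G using WellFoundedGT.induction with
  | ind G ih =>
    by_cases hG : G ∈ P
    · obtain ⟨e, he⟩ := h.exists_generic_element hP hG
      have h1 := hab e
      have hmem : G ∈ P.filter (G ≤ ·) := Finset.mem_filter.2 ⟨hG, le_rfl⟩
      rw [flatComb_eq_sum ha he, flatComb_eq_sum hb he, ← Finset.add_sum_erase _ _ hmem,
        ← Finset.add_sum_erase _ _ hmem] at h1
      have h2 : ∑ K ∈ (P.filter (G ≤ ·)).erase G, a K = ∑ K ∈ (P.filter (G ≤ ·)).erase G, b K := by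
        refine Finset.sum_congr rfl fun K hK ↦ ih K ?_
        rw [Finset.mem_erase, Finset.mem_filter] at hK
        exact lt_of_le_of_ne hK.2.2 hK.1.symm
      linarith
    · rw [ha G hG, hb G hG]

lemma flatCombLinear_injective {P : Finset (Flats M)} (hP : IsNested P) :
    Function.Injective (flatCombLinear P) := by
  intro c d hcd
  have := h.flatComb_injective hP (extendByZero_of_notMem P c) (extendByZero_of_notMem P d)
    (congrFun hcd)
  funext G
  rw [← extendByZero_apply P c, this, extendByZero_apply]

/-- Evaluation at one generic element per member is an injective linear map between spaces of the
same dimension `|P|`, hence surjective. Every element lies in the same members as one of these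
generic elements. -/
lemma exists_flatComb_eq {P : Finset (Flats M)} (hP : IsNested P) (hcov : flatUnion P = univ)
    {ν : α → ℝ} (hν : ∀ e f, (∀ K ∈ P, e ∈ K.1 ↔ f ∈ K.1) → ν e = ν f) :
    ∃ b : Flats M → ℝ, (∀ G ∉ P, b G = 0) ∧ ∀ e, ν e = flatComb b e := by
  choose g hg using fun G : P ↦ h.exists_generic_element hP G.2
  have hrep : ∀ e, ∃ G : P, ∀ K ∈ P, e ∈ K.1 ↔ g G ∈ K.1 := fun e ↦ by
    obtain ⟨G, hG, hGe⟩ := h.exists_minimal_member hP (hcov ▸ mem_univ e)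
    exact ⟨⟨G, hG⟩, fun K hK ↦ (hGe K hK).trans (hg ⟨G, hG⟩ K hK).symm⟩
  let T : (P → ℝ) →ₗ[ℝ] (P → ℝ) := LinearMap.funLeft ℝ ℝ g ∘ₗ flatCombLinear P
  have hT : Function.Injective T := by
    intro c d hcd
    refine h.flatCombLinear_injective hP (funext fun e ↦ ?_)
    obtain ⟨G, hG⟩ := hrep e
    rw [flatCombLinear_apply, flatCombLinear_apply,
      flatComb_congr (extendByZero_of_notMem P c) hG,
      flatComb_congr (extendByZero_of_notMem P d) hG]
    exact congrFun hcd G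
  obtain ⟨c, hc⟩ := (LinearMap.injective_iff_surjective.1 hT) fun G ↦ ν (g G)
  refine ⟨extendByZero P c, extendByZero_of_notMem P c, fun e ↦ ?_⟩
  obtain ⟨G, hG⟩ := hrep e
  rw [hν e _ hG, flatComb_congr (extendByZero_of_notMem P c) hG]
  exact (congrFun hc G).symm

end IsVectorMatroid

end Combination

/-! ### The cones of nested sets -/

section Cone

variable {α V : Type*} [AddCommGroup V] [Module ℝ V] [Fintype α] {M : Matroid α} {v : α → V}

/-- `ω = -∑ a_G 1_G` with positive coefficients on `N`, and arbitrary ones on the maximal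
irreducible flats. -/
structure IsConeVector (N : Finset (Flats M)) (a : Flats M → ℝ) (ω : α → ℝ) : Prop where
  pos : ∀ G ∈ N, 0 < a G
  eq_zero : ∀ G ∉ N, ¬ Maximal IsIrred G → a G = 0
  eq : ∀ e, ω e = -flatComb a e

lemma mem_nestedCell {N : Finset (Flats M)} {ω : α → ℝ} :
    ω ∈ nestedCell M N ↔ ω ∈ weightSphere α ∧ ∃ a, IsConeVector N a ω :=
  ⟨fun ⟨h1, a, h2, h3, h4⟩ ↦ ⟨h1, a, h2, h3, h4⟩, fun ⟨h1, a, h2, h3, h4⟩ ↦ ⟨h1, a, h2, h3, h4⟩⟩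

lemma IsConeVector.support {N : Finset (Flats M)} {a : Flats M → ℝ} {ω : α → ℝ}
    (ha : IsConeVector N a ω) : ∀ G ∉ withMaximal N, a G = 0 := fun G hG ↦ by
  rw [mem_withMaximal, not_or] at hG
  exact ha.eq_zero G hG.1 hG.2

lemma initialMatroid_eq_iff {ω ν : α → ℝ} :
    initialMatroid M ω = initialMatroid M ν ↔ ∀ X, IsMinBase M ω X ↔ IsMinBase M ν X := by
  constructor
  · intro h X
    have := congrArg (fun M' : Matroid α ↦ M'.IsBase X) h
    exact iff_of_eq this
  · intro h
    exact Matroid.ext_isBase rfl fun X _ ↦ h X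

lemma initialMatroid_loopless_iff (hE : M.E = univ) {ω : α → ℝ} :
    (initialMatroid M ω).Loopless ↔ ∀ e, ∃ X, IsMinBase M ω X ∧ e ∈ X := by
  rw [Matroid.loopless_iff_forall_isNonloop]
  constructor
  · intro h e
    obtain ⟨X, hX, heX⟩ := (h e (by simp [initialMatroid, hE])).exists_mem_isBase
    exact ⟨X, hX, heX⟩
  · intro h e _
    obtain ⟨X, hX, heX⟩ := h e
    have hX' : (initialMatroid M ω).IsBase X := hX
    exact hX'.indep.isNonloop_of_mem heX

/-- The weights with prescribed minimal bases form a convex set. -/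
lemma isMinBase_segment_iff {ω ν : α → ℝ} (hων : ∀ X, IsMinBase M ω X ↔ IsMinBase M ν X)
    {s : ℝ} (hs0 : 0 ≤ s) (hs1 : s ≤ 1) (X : Set α) :
    IsMinBase M (fun e ↦ (1 - s) * ω e + s * ν e) X ↔ IsMinBase M ω X := by
  have hw : ∀ X, weight (fun e ↦ (1 - s) * ω e + s * ν e) X =
      (1 - s) * weight ω X + s * weight ν X := fun X ↦ by
    simp only [weight, Finset.mul_sum, ← Finset.sum_add_distrib]
    refine Finset.sum_congr rfl fun e _ ↦ ?_
    by_cases he : e ∈ X <;> simp [he]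
  have h1s : 0 ≤ 1 - s := by linarith
  constructor
  · intro hX
    obtain ⟨Y, hY⟩ := exists_isMinBase M ω
    have hY' := (hων Y).1 hY
    have h1 := hX.2 Y hY.1
    rw [hw, hw] at h1
    have h2 := mul_le_mul_of_nonneg_left (hY.2 X hX.1) h1s
    have h3 := mul_le_mul_of_nonneg_left (hY'.2 X hX.1) hs0
    rcases hs1.lt_or_eq with hlt | rfl
    · have h4 : weight ω X ≤ weight ω Y := by
        have : (1 - s) * weight ω X ≤ (1 - s) * weight ω Y := by linarith
        exact le_of_mul_le_mul_left this (by linarith)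
      exact ⟨hX.1, fun Z hZ ↦ h4.trans (hY.2 Z hZ)⟩
    · refine (hων X).2 ⟨hX.1, fun Z hZ ↦ ?_⟩
      have := hY'.2 Z hZ
      linarith
  · intro hX
    refine ⟨hX.1, fun Z hZ ↦ ?_⟩
    rw [hw, hw]
    have h2 := mul_le_mul_of_nonneg_left (hX.2 Z hZ) h1s
    have h3 := mul_le_mul_of_nonneg_left (((hων X).1 hX).2 Z hZ) hs0
    linarith

namespace IsVectorMatroid

variable (h : IsVectorMatroid M v)

include h

/-- The matroid is the direct sum of its components, so every basis meets a component in a basis of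
it. This is why the coefficients of the components may have any sign. -/
lemma vspan_le_of_maximal {X : Set α} (hX : M.IsBase X) {C : Flats M} (hC : Maximal IsIrred C) :
    vspan v C.1 ≤ vspan v (X ∩ C.1) := by
  have hd := (h.maximal_isIrred_iff.1 hC).disjoint_vspan h.ne_zero
  refine vspan_le.2 fun e he ↦ mem_vspan_of_mem_vspan_union (A' := X \ C.1) hd inter_subset_right
    (sdiff_subset_sdiff_left (subset_univ _)) (mem_vspan he) ?_
  rw [inter_union_sdiff]
  exact (h.isBase_iff.1 hX).2 e

/-- The bases of minimum weight are the bases adapted to the nested set. -/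
lemma isMinBase_iff {N : Finset (Flats M)} (hN : IsNested N) {a : Flats M → ℝ} {ω : α → ℝ}
    (ha : IsConeVector N a ω) {X : Set α} :
    IsMinBase M ω X ↔ M.IsBase X ∧ IsAdapted v (withMaximal N) X := by
  have hω : ω = fun e ↦ -flatComb a e := funext ha.eq
  set ρ : Flats M → ℝ := fun G ↦ Module.finrank ℝ (vspan v G.1) with hρ
  -- Up to a constant independent of the basis, the weight is the sum of the rank deficiencies of
  -- `X` in the flats `G`, weighted by `a G`.
  have hw : ∀ X, weight ω X = ∑ G, a G * (ρ G - (X ∩ G.1).ncard) - ∑ G, a G * ρ G := fun X ↦ by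
    rw [hω, weight_neg_flatComb, ← Finset.sum_sub_distrib, ← Finset.sum_neg_distrib]
    exact Finset.sum_congr rfl fun G _ ↦ by ring
  have hli : ∀ {X}, M.IsBase X → ∀ G : Flats M, LinearIndepOn ℝ v (X ∩ G.1) := fun hX G ↦
    (h.isBase_iff.1 hX).1.mono inter_subset_left
  have hterm : ∀ {X}, M.IsBase X → ∀ G, 0 ≤ a G * (ρ G - (X ∩ G.1).ncard) := by
    intro X hX G
    by_cases hG : G ∈ N
    · have h1 : ((X ∩ G.1).ncard : ℝ) ≤ ρ G :=
        Nat.cast_le.2 (ncard_le_finrank (hli hX G) inter_subset_right)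
      exact mul_nonneg (ha.pos G hG).le (by linarith)
    by_cases hG' : Maximal IsIrred G
    · have h1 : ((X ∩ G.1).ncard : ℝ) = ρ G :=
        congrArg Nat.cast ((ncard_eq_finrank_iff (hli hX G) inter_subset_right).2
          (h.vspan_le_of_maximal hX hG'))
      rw [h1, sub_self, mul_zero]
    · simp [ha.eq_zero G hG hG']
  have hiff : ∀ {X}, M.IsBase X →
      (∑ G, a G * (ρ G - (X ∩ G.1).ncard) = 0 ↔ IsAdapted v (withMaximal N) X) := by
    intro X hX
    rw [Finset.sum_eq_zero_iff_of_nonneg fun G _ ↦ hterm hX G]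
    constructor
    · intro h0 G hG
      by_cases hGm : Maximal IsIrred G
      · exact h.vspan_le_of_maximal hX hGm
      have hGN := (mem_withMaximal.1 hG).resolve_right hGm
      have h1 := (mul_eq_zero.1 (h0 G (Finset.mem_univ G))).resolve_left (ha.pos G hGN).ne'
      refine (ncard_eq_finrank_iff (hli hX G) inter_subset_right).1 ?_
      have h2 : ρ G = (X ∩ G.1).ncard := sub_eq_zero.1 h1
      exact Nat.cast_injective (R := ℝ) h2.symm
    · intro hA G _
      by_cases hG : G ∈ withMaximal N
      · have h1 : ((X ∩ G.1).ncard : ℝ) = ρ G :=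
          congrArg Nat.cast ((ncard_eq_finrank_iff (hli hX G) inter_subset_right).2 (hA G hG))
        rw [h1, sub_self, mul_zero]
      · rw [ha.support G hG, zero_mul]
  constructor
  · intro hX
    refine ⟨hX.1, (hiff hX.1).1 (le_antisymm ?_ (Finset.sum_nonneg fun G _ ↦ hterm hX.1 G))⟩
    -- Some basis has total deficiency zero, so zero is the minimum.
    obtain ⟨X₀, hX₀, hX₀a⟩ := h.exists_adapted_isBase (h.isNested_withMaximal hN)
    have h1 := hX.2 X₀ hX₀
    rw [hw, hw X₀, (hiff hX₀).2 hX₀a] at h1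
    linarith
  · rintro ⟨hX, hXa⟩
    refine ⟨hX, fun Y hY ↦ ?_⟩
    rw [hw, hw Y, (hiff hX).2 hXa]
    have := Finset.sum_nonneg fun G (_ : G ∈ Finset.univ) ↦ hterm hY G
    linarith

lemma loopless_of_isConeVector {N : Finset (Flats M)} (hN : IsNested N) {a : Flats M → ℝ}
    {ω : α → ℝ} (ha : IsConeVector N a ω) : (initialMatroid M ω).Loopless := by
  rw [initialMatroid_loopless_iff h.ground_eq]
  intro e
  obtain ⟨X, hX, heX, hXa⟩ := h.exists_adapted_isBase_mem (h.isNested_withMaximal hN)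
    (e := e) (h.flatUnion_withMaximal N ▸ mem_univ e)
  exact ⟨X, (h.isMinBase_iff hN ha).2 ⟨hX, hXa⟩, heX⟩

end IsVectorMatroid

/-! ### Weights with the same minimal bases lie in the same cone -/

/-- All contractions of connected flats by flats are connected. -/
def HasConnectedContractions (v : α → V) : Prop :=
  ∀ F G : Set α, vclosure v F = F → vclosure v G = G → F ⊆ G → VConnected v G →
    ∀ T T', T ∪ T' = G \ F → vspan v (F ∪ T) ⊓ vspan v (F ∪ T') ≤ vspan v F → T = ∅ ∨ T' = ∅

namespace IsVectorMatroid

variable (h : IsVectorMatroid M v)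

include h

/-- The fundamental circuit of `f` in `X` stays inside `G` but not inside `F ∪ T'`. It therefore
contains an element of `T`, which can be traded for `f`. -/
lemma exists_exchange {X F G T T' : Set α} (hX : M.IsBase X) (hG : vspan v G ≤ vspan v (X ∩ G))
    (hT : T ∪ T' = G \ F) {f : α} (hf : f ∈ T') (hfX : v f ∉ vspan v (X ∩ (F ∪ T'))) :
    ∃ e ∈ T, e ∈ X ∧ f ∉ X ∧ M.IsBase (insert f (X \ {e})) := by
  have hX' := h.isBase_iff.1 hX
  have hT'G : T' ⊆ G := fun x hx ↦ (hT ▸ Or.inr hx : x ∈ G \ F).1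
  obtain ⟨e, heT, heX, hfe⟩ := exists_notMem_vspan_sdiff_singleton (T := T) hX'.1 (hX'.2 f) (by
    intro hmem
    refine hfX (vspan_mono ?_ (vspan_inf_le hX'.1 sdiff_subset inter_subset_left
      ⟨hmem, hG (mem_vspan (hT'G hf))⟩))
    rintro x ⟨⟨hxX, hxT⟩, -, hxG⟩
    refine ⟨hxX, ?_⟩
    by_cases hxF : x ∈ F
    · exact .inl hxF
    · exact .inr ((hT.symm ▸ ⟨hxG, hxF⟩ : x ∈ T ∪ T').resolve_left hxT))
  refine ⟨e, heT, heX, fun hfX' ↦ ?_, hX.exchange_base_of_notMem_closure heX ?_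
    (by simp [h.ground_eq])⟩
  · exact hfX (mem_vspan ⟨hfX', .inr hf⟩)
  · rwa [h.closure_eq]

/-- A weight with the same minimal bases as a vector of the cone of `N` is constant on the sets of
elements which lie in the same members of `N`. -/
lemma apply_eq_of_isMinBase_iff (hc : HasConnectedContractions v) {N : Finset (Flats M)}
    (hN : IsNested N) {a : Flats M → ℝ} {ω ν : α → ℝ} (ha : IsConeVector N a ω)
    (hων : ∀ X, IsMinBase M ω X ↔ IsMinBase M ν X) {e f : α}
    (hef : ∀ K ∈ withMaximal N, e ∈ K.1 ↔ f ∈ K.1) : ν e = ν f := by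
  classical
  set P := withMaximal N with hPdef
  have hP : IsNested P := h.isNested_withMaximal hN
  by_contra hne
  obtain ⟨G, hG, hGe⟩ := h.exists_minimal_member hP (e := e)
    (h.flatUnion_withMaximal N ▸ mem_univ e)
  obtain ⟨X, hX, hXa⟩ := h.exists_adapted_isBase hP
  set S := P.filter (· < G)
  have hSP : S ⊆ P := Finset.filter_subset _ _
  set F := flatUnion S
  have hFG : F ⊆ G.1 := flatUnion_subset.2 fun K hK ↦ (Finset.mem_filter.1 hK).2.le
  have hFflat : vclosure v F = F := by
    refine Subset.antisymm (fun x hx ↦ ?_) (subset_vclosure F)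
    obtain ⟨H, hH, hxH⟩ := h.exists_subset_of_subset_vclosure hP hSP
      (vconnected_singleton h.ne_zero x) (singleton_subset_iff.2 hx)
    exact subset_flatUnion hH (hxH rfl)
  -- The elements of `G \ F` are those with smallest member `G`, that is, the elements lying in the
  -- same members as `e`. This and the next claim are the two directions.
  have hGF : ∀ x ∈ G.1 \ F, ∀ K ∈ P, x ∈ K.1 ↔ G ≤ K := by
    rintro x ⟨hxG, hxF⟩
    obtain ⟨H, hH, hHx⟩ := h.exists_minimal_member hP (mem_flatUnion.2 ⟨G, hG, hxG⟩)
    obtain rfl | hlt := ((hHx G hG).1 hxG).eq_or_lt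
    · exact hHx
    · exact absurd (mem_flatUnion.2 ⟨H, Finset.mem_filter.2 ⟨hH, hlt⟩, (hHx H hH).2 le_rfl⟩) hxF
  have hGF' : ∀ x, (∀ K ∈ P, x ∈ K.1 ↔ G ≤ K) → x ∈ G.1 \ F := by
    intro x hx
    refine ⟨(hx G hG).2 le_rfl, fun hxF ↦ ?_⟩
    obtain ⟨K, hK, hxK⟩ := mem_flatUnion.1 hxF
    exact (Finset.mem_filter.1 hK).2.not_ge ((hx K (hSP hK)).1 hxK)
  have hFX : vspan v F ≤ vspan v (X ∩ F) := by
    refine vspan_le.2 fun x hx ↦ ?_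
    obtain ⟨K, hK, hxK⟩ := mem_flatUnion.1 hx
    exact vspan_mono (inter_subset_inter_right _ (subset_flatUnion hK))
      (hXa K (hSP hK) (mem_vspan hxK))
  -- If `ν` took another value on this class, `T` and `T'` would separate the contraction of `G` by
  -- `F`.
  set T := {x ∈ G.1 \ F | ν x = ν e}
  set T' := {x ∈ G.1 \ F | ν x ≠ ν e}
  have hTT' : T ∪ T' = G.1 \ F := by
    ext x; simp only [T, T', mem_union, mem_ofPred_eq]; tauto
  have heT : e ∈ T := ⟨hGF' e hGe, rfl⟩
  have hfT : f ∈ T' := ⟨hGF' f fun K hK ↦ (hef K hK).symm.trans (hGe K hK), fun h' ↦ hne h'.symm⟩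
  -- an exchange inside `G \ F` preserves the weights of minimal bases
  have hexch : ∀ x ∈ G.1 \ F, ∀ y ∈ G.1 \ F, x ∈ X → y ∉ X → M.IsBase (insert y (X \ {x})) →
      ν x = ν y := by
    intro x hx y hy hxX hyX hbase
    have hXmin := (h.isMinBase_iff hN ha).2 ⟨hX, hXa⟩
    have hω : ω x = ω y := by
      rw [ha.eq, ha.eq, flatComb_congr ha.support fun K hK ↦
        (hGF x hx K hK).trans (hGF y hy K hK).symm]
    have hYmin : IsMinBase M ω (insert y (X \ {x})) := by
      refine ⟨hbase, fun Z hZ ↦ ?_⟩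
      rw [weight_exchange ω hxX hyX, hω, sub_add_cancel]
      exact hXmin.2 Z hZ
    have h1 := ((hων _).1 hXmin).2 _ hbase
    have h2 := ((hων _).1 hYmin).2 _ hX
    rw [weight_exchange ν hxX hyX] at h1 h2
    linarith
  have hGspan := hXa G hG
  rcases hc F G.1 hFflat (h.vclosure_flat G) hFG (h.connected_of_isIrred (hP.1 G hG)) T T' hTT' (by
    by_cases h1 : ∀ x ∈ T, v x ∈ vspan v (X ∩ (F ∪ T))
    · by_cases h2 : ∀ y ∈ T', v y ∈ vspan v (X ∩ (F ∪ T'))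
      · have h3 : ∀ U, (∀ x ∈ U, v x ∈ vspan v (X ∩ (F ∪ U))) →
            vspan v (F ∪ U) ≤ vspan v (X ∩ (F ∪ U)) := by
          intro U hU
          rw [vspan_union]
          exact sup_le (hFX.trans (vspan_mono (inter_subset_inter_right _ subset_union_left)))
            (vspan_le.2 hU)
        refine (inf_le_inf (h3 T h1) (h3 T' h2)).trans
          ((vspan_inf_le (h.isBase_iff.1 hX).1 inter_subset_left inter_subset_left).trans
          (vspan_mono ?_))
        rintro x ⟨⟨-, hxF | hxT⟩, -, hxF' | hxT'⟩
        · exact hxF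
        · exact hxF
        · exact hxF'
        · exact absurd hxT.2 hxT'.2
      · push Not at h2
        obtain ⟨y, hy, hyX⟩ := h2
        obtain ⟨x, hx, hxX, hyX', hb⟩ := h.exists_exchange hX hGspan hTT' hy hyX
        exact absurd ((hexch x hx.1 y hy.1 hxX hyX' hb).symm.trans hx.2) hy.2
    · push Not at h1
      obtain ⟨y, hy, hyX⟩ := h1
      obtain ⟨x, hx, hxX, hyX', hb⟩ := h.exists_exchange hX hGspan (union_comm T T' ▸ hTT') hy hyX
      exact absurd ((hexch x hx.1 y hy.1 hxX hyX' hb).trans hy.2) hx.2) with h' | h'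
  · exact notMem_empty e (h' ▸ heT)
  · exact notMem_empty f (h' ▸ hfT)

lemma exists_flatComb_of_isMinBase_iff (hc : HasConnectedContractions v) {N : Finset (Flats M)}
    (hN : IsNested N) {a : Flats M → ℝ} {ω ν : α → ℝ} (ha : IsConeVector N a ω)
    (hων : ∀ X, IsMinBase M ω X ↔ IsMinBase M ν X) :
    ∃ b : Flats M → ℝ, (∀ G ∉ withMaximal N, b G = 0) ∧ ∀ e, ν e = -flatComb b e := by
  obtain ⟨b, hb, hνb⟩ := h.exists_flatComb_eq (h.isNested_withMaximal hN)
    (h.flatUnion_withMaximal N) fun e f hef ↦ h.apply_eq_of_isMinBase_iff hc hN ha hων hef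
  refine ⟨(-1 : ℝ) • b, fun G hG ↦ by simp [hb G hG], fun e ↦ ?_⟩
  rw [flatComb_smul, hνb]
  ring

/-- The weights with the same minimal bases as a vector of the cone of `N` belong to this cone. -/
lemma exists_isConeVector_of_isMinBase_iff (hc : HasConnectedContractions v)
    {N : Finset (Flats M)} (hN : IsReducedNested N) {a : Flats M → ℝ} {ω ν : α → ℝ}
    (ha : IsConeVector N a ω) (hων : ∀ X, IsMinBase M ω X ↔ IsMinBase M ν X) :
    ∃ b, IsConeVector N b ν := by
  classical
  obtain ⟨b, hb, hνb⟩ := h.exists_flatComb_of_isMinBase_iff hc hN.1 ha hων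
  refine ⟨b, ?_, fun G hG hGm ↦ hb G (by simp [mem_withMaximal, hG, hGm]), hνb⟩
  by_contra! hneg
  obtain ⟨G₁, hG₁, hbG₁⟩ := hneg
  -- Here `a G / (a G - b G)` is the parameter at which the coefficient of `G` vanishes on the
  -- segment from `a` to `b`. The smallest of these is where the segment leaves the open cone, at a
  -- point in the cone of a proper subset `N'` of `N`.
  obtain ⟨G₀, hG₀, hmin⟩ := (N.filter (b · ≤ 0)).exists_min_image (fun G ↦ a G / (a G - b G))
    ⟨G₁, Finset.mem_filter.2 ⟨hG₁, hbG₁⟩⟩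
  obtain ⟨hG₀N, hbG₀⟩ := Finset.mem_filter.1 hG₀
  have haG₀ := ha.pos G₀ hG₀N
  set s := a G₀ / (a G₀ - b G₀)
  have hs0 : 0 ≤ s := div_nonneg haG₀.le (by linarith)
  have hs1 : s ≤ 1 := div_le_one_of_le₀ (by linarith) (by linarith)
  set c : Flats M → ℝ := (1 - s) • a + s • b with hcdef
  have hcapp : ∀ G, c G = (1 - s) * a G + s * b G := fun G ↦ by simp [c]
  have hc0 : c G₀ = 0 := by
    have : s * (a G₀ - b G₀) = a G₀ := div_mul_cancel₀ _ (by linarith)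
    rw [hcapp]; linarith
  have hcN : ∀ G ∈ N, 0 ≤ c G := fun G hG ↦ by
    have haG := ha.pos G hG
    rw [hcapp]
    rcases le_or_gt (b G) 0 with hbG | hbG
    · have h1 := hmin G (Finset.mem_filter.2 ⟨hG, hbG⟩)
      rw [le_div_iff₀ (by linarith)] at h1
      linarith
    · have := mul_nonneg (by linarith : 0 ≤ 1 - s) haG.le
      have := mul_nonneg hs0 hbG.le
      linarith
  set N' := N.filter (0 < c ·)
  have hN' : IsNested N' := hN.1.mono (Finset.filter_subset _ _)
  have hcone : IsConeVector N' c fun e ↦ (1 - s) * ω e + s * ν e := by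
    refine ⟨fun G hG ↦ (Finset.mem_filter.1 hG).2, fun G hG hGm ↦ ?_, fun e ↦ ?_⟩
    · by_cases hGN : G ∈ N
      · have : ¬ 0 < c G := fun hpos ↦ hG (Finset.mem_filter.2 ⟨hGN, hpos⟩)
        exact le_antisymm (not_lt.1 this) (hcN G hGN)
      · rw [hcapp, ha.eq_zero G hGN hGm, hb G (by simp [mem_withMaximal, hGN, hGm])]
        ring
    · rw [hcdef, flatComb_add, flatComb_smul, flatComb_smul, ha.eq, hνb]
      ring
  -- The roles are now reversed: `ω` has the same minimal bases as this boundary point, so it lies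
  -- in the span of the smaller cone. Uniqueness of coefficients contradicts `a G₀ > 0`.
  obtain ⟨d, hd, hωd⟩ := h.exists_flatComb_of_isMinBase_iff hc hN' hcone
    (isMinBase_segment_iff hων hs0 hs1)
  have had : a = d := by
    refine h.flatComb_injective (h.isNested_withMaximal hN.1) ha.support (fun G hG ↦ hd G ?_)
      fun e ↦ ?_
    · rw [mem_withMaximal, not_or] at hG ⊢
      exact ⟨fun hG' ↦ hG.1 (Finset.filter_subset _ _ hG'), hG.2⟩
    · have h1 := ha.eq e
      have h2 := hωd e
      linarith
  have hdG₀ : d G₀ = 0 := hd G₀ (by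
    rw [mem_withMaximal, not_or]
    exact ⟨fun hG' ↦ (Finset.mem_filter.1 hG').2.ne' hc0, hN.2 G₀ hG₀N⟩)
  exact haG₀.ne' (had ▸ hdG₀)

end IsVectorMatroid

end Cone

/-! ### The cone of a nested set and the sublevel sets of its vectors -/

section Sublevel

variable {α V : Type*} [AddCommGroup V] [Module ℝ V] [Fintype α] {M : Matroid α} {v : α → V}

lemma flatComb_sum {ι : Type*} (T : Finset ι) (a : ι → Flats M → ℝ) (e : α) :
    flatComb (∑ t ∈ T, a t) e = ∑ t ∈ T, flatComb (a t) e := by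
  simp only [flatComb]
  rw [Finset.sum_comm]
  refine Finset.sum_congr rfl fun G _ ↦ ?_
  by_cases he : e ∈ G.1 <;> simp [he]

/-- A finite set of reals below `m` has positive successive differences. -/
lemma exists_pos_eq_sub_sum (T : Finset ℝ) (m : ℝ) (hm : ∀ t ∈ T, t < m) :
    ∃ δ : ℝ → ℝ, (∀ t ∈ T, 0 < δ t) ∧ ∀ x ∈ T, x = m - ∑ t ∈ T with x ≤ t, δ t := by
  induction T using Finset.induction_on_max generalizing m with
  | empty => exact ⟨0, by simp, by simp⟩
  | insert a T hT ih =>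
    have haT : a ∉ T := fun h ↦ lt_irrefl a (hT a h)
    obtain ⟨δ, hδ, hδT⟩ := ih a hT
    have hne : ∀ t ∈ T, t ≠ a := fun t ht h ↦ haT (h ▸ ht)
    refine ⟨Function.update δ a (m - a), fun t ht ↦ ?_, fun x hx ↦ ?_⟩
    · rcases Finset.mem_insert.1 ht with rfl | ht
      · simpa using hm t (Finset.mem_insert_self _ _)
      · simpa [hne t ht] using hδ t ht
    · have hsum : ∑ t ∈ T with x ≤ t, Function.update δ a (m - a) t = ∑ t ∈ T with x ≤ t, δ t :=
        Finset.sum_congr rfl fun t ht ↦ by simp [hne t (Finset.mem_filter.1 ht).1]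
      have hxa : x ≤ a := by
        rcases Finset.mem_insert.1 hx with rfl | hx
        exacts [le_rfl, (hT x hx).le]
      rw [Finset.filter_insert, if_pos hxa, Finset.sum_insert (by simp [haT]), hsum,
        Function.update_self]
      rcases Finset.mem_insert.1 hx with rfl | hx
      · have : T.filter (x ≤ ·) = ∅ := Finset.filter_eq_empty_iff.2 fun t ht ↦ (hT t ht).not_ge
        rw [this]; simp
      · have := hδT x hx
        linarith

namespace IsVectorMatroid

variable (h : IsVectorMatroid M v)

include h

/-- Suppose `e` is in the closure of the sublevel set but not in the set, and take a minimal basis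
containing `e`. Some element of the sublevel set can replace `e` in it, which lowers the weight. -/
lemma vclosure_sublevel {ω : α → ℝ} (hω : (initialMatroid M ω).Loopless) (t : ℝ) :
    vclosure v {x | ω x ≤ t} = {x | ω x ≤ t} := by
  refine Subset.antisymm (fun e he ↦ ?_) (subset_vclosure _)
  by_contra het
  rw [initialMatroid_loopless_iff h.ground_eq] at hω
  obtain ⟨X, hX, heX⟩ := hω e
  have hX' := h.isBase_iff.1 hX.1
  obtain ⟨f, hf, hfX⟩ : ∃ f, ω f ≤ t ∧ v f ∉ vspan v (X \ {e}) := by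
    by_contra! hcon
    exact hX'.1.notMem_span heX (vspan_le.2 hcon he)
  have hlt : ω f < ω e := hf.trans_lt (not_le.1 het)
  have hfX' : f ∉ X := fun hf' ↦ hfX (mem_vspan ⟨hf', fun h' ↦ by
    rw [mem_singleton_iff.1 h'] at hlt; exact lt_irrefl _ hlt⟩)
  have hbase := hX.1.exchange_base_of_notMem_closure (f := f) heX (by rwa [h.closure_eq])
    (by simp [h.ground_eq])
  have := hX.2 _ hbase
  rw [weight_exchange ω heX hfX'] at this
  linarith

open Classical in
/-- The components of a flat partition it. -/
lemma flatComb_component {F : Set α} (hF : vclosure v F = F) (c : ℝ) (e : α) :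
    flatComb (fun G : Flats M ↦ if IsComponent v F G.1 then c else 0) e =
      F.indicator (fun _ ↦ c) e := by
  rw [flatComb]
  by_cases he : e ∈ F
  · obtain ⟨C, hC, heC⟩ := exists_isComponent (vconnected_singleton h.ne_zero e)
      (singleton_subset_iff.2 he)
    rw [Finset.sum_eq_single (⟨C, h.isFlat_iff.2 (hC.vclosure_eq h.ne_zero hF)⟩ : Flats M)]
    · simp [he, heC rfl, hC]
    · intro G _ hG
      by_cases hGc : IsComponent v F G.1
      · rw [indicator_of_notMem]
        intro heG
        rcases hGc.subset_or_disjoint h.ne_zero hC.connected hC.subset with h' | h'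
        · exact hG (Subtype.ext (hC.eq_of_subset hGc.connected hGc.subset h').symm)
        · exact (h' (heC rfl)).2 heG
      · simp [hGc]
    · simp
  · rw [indicator_of_notMem he, Finset.sum_eq_zero]
    intro G _
    by_cases hGc : IsComponent v F G.1
    · exact indicator_of_notMem (fun heG ↦ he (hGc.subset heG)) _
    · simp [hGc]

open Classical in
lemma flatComb_maximal (c : ℝ) (e : α) :
    flatComb (fun G : Flats M ↦ if Maximal IsIrred G then c else 0) e = c := by
  simp only [h.maximal_isIrred_iff]
  rw [h.flatComb_component vclosure_univ, indicator_of_mem (mem_univ e)]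

/-- Every weight without loops in its initial matroid lies in the cone of a nested set. -/
lemma exists_isConeVector_of_loopless {ω : α → ℝ} (hω : (initialMatroid M ω).Loopless) :
    ∃ N a, IsReducedNested N ∧ IsConeVector (M := M) N a ω := by
  classical
  set T : Finset ℝ := Finset.univ.image ω
  have hωT : ∀ e, ω e ∈ T := fun e ↦ Finset.mem_image_of_mem ω (Finset.mem_univ e)
  obtain ⟨m, hm⟩ : ∃ m, ∀ t ∈ T, t < m := by
    obtain ⟨m, hm⟩ := T.bddAbove
    exact ⟨m + 1, fun t ht ↦ (hm ht).trans_lt (lt_add_one m)⟩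
  obtain ⟨δ, hδ, hδω⟩ := exists_pos_eq_sub_sum T m hm
  set L : ℝ → Set α := fun t ↦ {x | ω x ≤ t}
  have hL : ∀ t, vclosure v (L t) = L t := h.vclosure_sublevel hω
  -- By telescoping, `ω` is the constant `m` minus the sum of the `δ t` times the indicators of the
  -- sublevel flats. Each indicator is the sum of those of its components, and the constant is
  -- absorbed by the components of the matroid.
  set N : Finset (Flats M) :=
    {G | ¬ Maximal IsIrred G ∧ ∃ t ∈ T, IsComponent v (L t) G.1}
  have hN : ∀ {G}, G ∈ N ↔ ¬ Maximal IsIrred G ∧ ∃ t ∈ T, IsComponent v (L t) G.1 := by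
    intro G; simp [N]
  set a₁ : ℝ → Flats M → ℝ := fun t G ↦ if IsComponent v (L t) G.1 then δ t else 0
  set a₂ : Flats M → ℝ := fun G ↦ if Maximal IsIrred G then m else 0
  refine ⟨N, ∑ t ∈ T, a₁ t + (-1 : ℝ) • a₂, ⟨⟨fun G hG ↦ ?_, fun A hA hcard hanti ↦ ?_⟩, ?_⟩,
    fun G hG ↦ ?_, fun G hG hGm ↦ ?_, fun e ↦ ?_⟩
  · obtain ⟨-, t, -, ht⟩ := hN.1 hG
    exact h.isIrred_of_connected ht.connected
  · have hA' : ∀ G : Flats M, ∃ t, G ∈ A → IsComponent v (L t) G.1 := fun G ↦ by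
      by_cases hG : G ∈ A
      · obtain ⟨-, t, -, ht⟩ := hN.1 (hA hG)
        exact ⟨t, fun _ ↦ ht⟩
      · exact ⟨0, fun h' ↦ absurd h' hG⟩
    choose τ hτ using hA'
    -- Sublevel sets form a chain. A member of the antichain of highest level is a component of a
    -- flat containing all the others, so the join is not irreducible.
    obtain ⟨C, hC, hmax⟩ := A.exists_max_image τ (Finset.card_pos.1 (by omega))
    refine ⟨_, h.isLUB_flat_flatUnion A, h.not_isIrred_flatUnion hcard hanti
      (F := ⟨L (τ C), h.isFlat_iff.2 (hL _)⟩) hC (hτ C hC) fun G hG x hx ↦ ?_⟩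
    exact ((hτ G hG).subset hx : ω x ≤ τ G).trans (hmax G hG)
  · exact fun G hG ↦ (hN.1 hG).1
  · obtain ⟨hGm, t, htT, ht⟩ := hN.1 hG
    have h2 : a₂ G = 0 := by simp [a₂, hGm]
    simp only [Pi.add_apply, Pi.smul_apply, h2, smul_zero, add_zero, Finset.sum_apply]
    refine Finset.sum_pos' (fun s hs ↦ ?_) ⟨t, htT, ?_⟩
    · simp only [a₁]
      split_ifs
      exacts [(hδ s hs).le, le_rfl]
    · simpa [a₁, ht] using hδ t htT
  · have h2 : a₂ G = 0 := by simp [a₂, hGm]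
    simp only [Pi.add_apply, Pi.smul_apply, h2, smul_zero, add_zero, Finset.sum_apply]
    refine Finset.sum_eq_zero fun t ht ↦ ?_
    have : ¬ IsComponent v (L t) G.1 := fun hc ↦ hG (hN.2 ⟨hGm, t, ht, hc⟩)
    simp [a₁, this]
  · rw [flatComb_add, flatComb_smul, flatComb_sum, h.flatComb_maximal]
    simp only [a₁, h.flatComb_component (hL _)]
    have h1 := hδω (ω e) (hωT e)
    rw [Finset.sum_filter] at h1
    have h2 : ∑ t ∈ T, (L t).indicator (fun _ ↦ δ t) e = ∑ t ∈ T, if ω e ≤ t then δ t else 0 :=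
      Finset.sum_congr rfl fun t _ ↦ by simp [indicator, L]
    linarith

lemma le_or_le_of_mem {P : Finset (Flats M)} (hP : IsNested P) {G H : Flats M} (hG : G ∈ P)
    (hH : H ∈ P) {e : α} (heG : e ∈ G.1) (heH : e ∈ H.1) : G ≤ H ∨ H ≤ G := by
  by_contra! hcon
  have hd := h.disjoint_vspan_flatUnion hP (S := {H}) (by simpa using hH) hG
    (by simpa using ⟨hcon.2, hcon.1⟩)
  exact Set.disjoint_left.1 (disjoint_of_disjoint_vspan h.ne_zero hd) heG
    (mem_flatUnion.2 ⟨H, by simp, heH⟩)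

/-- A nested set is determined by the vectors in its cone: its members are the components of their
sublevel sets. -/
lemma mem_iff_isComponent {N : Finset (Flats M)} (hN : IsReducedNested N) {a : Flats M → ℝ}
    {ω : α → ℝ} (ha : IsConeVector N a ω) {G : Flats M} :
    G ∈ N ↔ ¬ Maximal IsIrred G ∧ ∃ t, IsComponent v {x | ω x ≤ t} G.1 := by
  classical
  set P := withMaximal N
  have hP : IsNested P := h.isNested_withMaximal hN.1
  -- `g H` is the value of `ω` at the elements whose smallest member is `H`.
  set g : Flats M → ℝ := fun H ↦ -∑ K ∈ P with H ≤ K, a K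
  have hωg : ∀ e, ∃ H ∈ P, e ∈ H.1 ∧ ω e = g H ∧ ∀ K ∈ P, e ∈ K.1 → H ≤ K := fun e ↦ by
    obtain ⟨H, hH, he⟩ := h.exists_minimal_member hP (e := e)
      (h.flatUnion_withMaximal N ▸ mem_univ e)
    exact ⟨H, hH, (he H hH).2 le_rfl, by rw [ha.eq, flatComb_eq_sum ha.support he],
      fun K hK ↦ (he K hK).1⟩
  -- Only the coefficients of connected components can fail to be positive, and no member lies
  -- strictly above a component.
  have hpos : ∀ K ∈ P, ∀ H ∈ P, K < H → 0 < a K := fun K hK H hH hlt ↦ by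
    rcases mem_withMaximal.1 hK with hK | hK
    · exact ha.pos K hK
    · exact absurd (hK.eq_of_le (hP.1 H hH) hlt.le) hlt.ne
  have hmono : ∀ K ∈ P, ∀ H ∈ P, K < H → g K < g H := by
    intro K hK H hH hlt
    simp only [g, neg_lt_neg_iff]
    obtain ⟨e, he⟩ := h.exists_generic_element hP hK
    -- A member `J` above `K` but not above `H` shares an element of `K` with `H`, so it lies
    -- strictly below `H` and has a positive coefficient.
    refine Finset.sum_lt_sum_of_subset (i := K) (fun J hJ ↦ ?_) (by simp [hK])
      (by simp [hlt.not_ge]) (hpos K hK H hH hlt) fun J hJ hJ' ↦ ?_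
    · rw [Finset.mem_filter] at hJ ⊢
      exact ⟨hJ.1, hlt.le.trans hJ.2⟩
    · rw [Finset.mem_filter] at hJ hJ'
      have hHJ : ¬ H ≤ J := fun h' ↦ hJ' ⟨hJ.1, h'⟩
      have hJH := (h.le_or_le_of_mem hP hJ.1 hH ((he J hJ.1).2 hJ.2)
        ((he H hH).2 hlt.le)).resolve_right hHJ
      exact (hpos J hJ.1 H hH (lt_of_le_of_ne hJH fun h' ↦ hHJ h'.ge)).le
  have hsub : ∀ H ∈ P, ∀ e ∈ H.1, ω e ≤ g H := fun H hH e he ↦ by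
    obtain ⟨K, hK, -, hKω, hKmin⟩ := hωg e
    rw [hKω]
    obtain rfl | hlt := (hKmin H hH he).eq_or_lt
    exacts [le_rfl, (hmono K hK H hH hlt).le]
  have hlevel : ∀ t, {x | ω x ≤ t} ⊆ vclosure v (flatUnion (P.filter (g · ≤ t))) := fun t e he ↦ by
    obtain ⟨K, hK, heK, hKω, -⟩ := hωg e
    exact subset_vclosure _ (mem_flatUnion.2 ⟨K, Finset.mem_filter.2 ⟨hK, hKω ▸ he⟩, heK⟩)
  constructor
  · intro hG
    have hGP : G ∈ P := mem_withMaximal.2 (.inl hG)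
    refine ⟨hN.2 G hG, g G, ⟨h.connected_of_isIrred (hP.1 G hGP), hsub G hGP⟩, fun K hK hGK ↦ ?_⟩
    -- A connected set at this level that contains `G` lies in a member `H` with `g H ≤ g G`; strict
    -- monotonicity leaves `H = G`.
    obtain ⟨H, hH, hKH⟩ := h.exists_subset_of_subset_vclosure hP (Finset.filter_subset _ _) hK.1
      (hK.2.trans (hlevel _))
    obtain ⟨hHP, hHg⟩ := Finset.mem_filter.1 hH
    obtain rfl | hlt := (show G ≤ H from Subset.trans hGK hKH).eq_or_lt
    · exact hKH
    · exact absurd (hmono G hGP H hHP hlt) hHg.not_gt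
  · rintro ⟨hGm, t, hGt⟩
    obtain ⟨H, hH, hGH⟩ := h.exists_subset_of_subset_vclosure hP (Finset.filter_subset _ _)
      hGt.connected (hGt.subset.trans (hlevel t))
    obtain ⟨hHP, hHg⟩ := Finset.mem_filter.1 hH
    obtain rfl : G = H := Subtype.ext (hGt.eq_of_subset (h.connected_of_isIrred (hP.1 H hHP))
      (fun e he ↦ (hsub H hHP e he).trans hHg) hGH)
    exact (mem_withMaximal.1 hHP).resolve_right hGm

lemma isConeVector_unique {N N' : Finset (Flats M)} (hN : IsReducedNested N)
    (hN' : IsReducedNested N') {a b : Flats M → ℝ} {ω : α → ℝ} (ha : IsConeVector N a ω)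
    (hb : IsConeVector N' b ω) : N = N' ∧ a = b := by
  obtain rfl : N = N' := by
    ext G
    rw [h.mem_iff_isComponent hN ha, h.mem_iff_isComponent hN' hb]
  refine ⟨rfl, h.flatComb_injective (h.isNested_withMaximal hN.1) ha.support hb.support
    fun e ↦ ?_⟩
  have h1 := ha.eq e
  have h2 := hb.eq e
  linarith

/-- The coarse cells are the nonempty cells of the nested sets. -/
lemma coarseCells_eq (hc : HasConnectedContractions v) : coarseCells M =
    {C | C.Nonempty ∧ ∃ N, IsReducedNested N ∧ C = nestedCell M N} := by
  have key : ∀ N a ω, IsReducedNested N → IsConeVector (M := M) N a ω →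
      {ν ∈ bergmanComplex M | initialMatroid M ν = initialMatroid M ω} = nestedCell M N := by
    intro N a ω hN ha
    ext ν
    rw [mem_nestedCell]
    constructor
    · rintro ⟨hν, heq⟩
      exact ⟨hν.1, h.exists_isConeVector_of_isMinBase_iff hc hN ha
        (initialMatroid_eq_iff.1 heq.symm)⟩
    · rintro ⟨hν, b, hb⟩
      refine ⟨⟨hν, h.loopless_of_isConeVector hN.1 hb⟩, initialMatroid_eq_iff.2 fun X ↦ ?_⟩
      rw [h.isMinBase_iff hN.1 hb, h.isMinBase_iff hN.1 ha]
  ext C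
  constructor
  · rintro ⟨ω, hω, rfl⟩
    obtain ⟨N, a, hN, ha⟩ := h.exists_isConeVector_of_loopless hω.2
    exact ⟨⟨ω, hω, rfl⟩, N, hN, key N a ω hN ha⟩
  · rintro ⟨⟨ω, hω⟩, N, hN, rfl⟩
    obtain ⟨hωs, a, ha⟩ := mem_nestedCell.1 hω
    exact ⟨ω, ⟨hωs, h.loopless_of_isConeVector hN.1 ha⟩, key N a ω hN ha⟩

end IsVectorMatroid

end Sublevel

section Realization

variable {α V : Type*} [AddCommGroup V] [Module ℝ V] [Fintype α] {M : Matroid α} {v : α → V}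

/-! ### The projection to the vectors with sum zero on each component -/

lemma IsConeVector.smul {N : Finset (Flats M)} {a : Flats M → ℝ} {ω : α → ℝ}
    (ha : IsConeVector N a ω) {c : ℝ} (hc : 0 < c) : IsConeVector N (c • a) (c • ω) where
  pos G hG := mul_pos hc (ha.pos G hG)
  eq_zero G hG hGm := by simp [ha.eq_zero G hG hGm]
  eq e := by rw [flatComb_smul, Pi.smul_apply, ha.eq, smul_eq_mul, mul_neg]

open Classical in
lemma isConeVector_indicator (N : Finset (Flats M)) :
    IsConeVector N (fun G ↦ if G ∈ N then 1 else 0)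
      (fun e ↦ -flatComb (fun G : Flats M ↦ if G ∈ N then (1 : ℝ) else 0) e) :=
  ⟨fun G hG ↦ by simp [hG], fun G hG _ ↦ by simp [hG], fun _ ↦ rfl⟩

open Classical in
/-- The mean values of `ω` on the maximal irreducible flats. -/
def componentMean (M : Matroid α) (ω : α → ℝ) (G : Flats M) : ℝ :=
  if Maximal IsIrred G then weight ω G.1 / G.1.ncard else 0

/-- The projection of `ω` to the vectors with sum zero on each maximal irreducible flat. -/
def componentProj (M : Matroid α) (ω : α → ℝ) (e : α) : ℝ := ω e - flatComb (componentMean M ω) e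

lemma weight_add (ω ν : α → ℝ) (X : Set α) : weight (ω + ν) X = weight ω X + weight ν X := by
  simp [weight, indicator_add', Finset.sum_add_distrib]

lemma weight_smul (c : ℝ) (ω : α → ℝ) (X : Set α) : weight (c • ω) X = c * weight ω X := by
  simp only [weight, Finset.mul_sum]
  refine Finset.sum_congr rfl fun e _ ↦ ?_
  by_cases he : e ∈ X <;> simp [he]

lemma weight_const (c : ℝ) (X : Set α) : weight (fun _ ↦ c) X = X.ncard * c := by
  classical
  rw [weight, Finset.sum_indicator_eq_sum_filter, Finset.sum_const, nsmul_eq_mul,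
    ncard_eq_toFinset_card']
  congr 3
  ext; simp

lemma weight_congr {ω ν : α → ℝ} {X : Set α} (h : ∀ e ∈ X, ω e = ν e) : weight ω X = weight ν X :=
  Finset.sum_congr rfl fun e _ ↦ congrFun (indicator_congr h) e

lemma componentMean_add (ω ν : α → ℝ) :
    componentMean M (ω + ν) = componentMean M ω + componentMean M ν := by
  funext G
  by_cases hG : Maximal IsIrred G <;> simp [componentMean, hG, weight_add, add_div]

lemma componentMean_smul (c : ℝ) (ω : α → ℝ) :
    componentMean M (c • ω) = c • componentMean M ω := by
  funext G
  by_cases hG : Maximal IsIrred G <;> simp [componentMean, hG, weight_smul, mul_div_assoc]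

lemma componentProj_add (ω ν : α → ℝ) :
    componentProj M (ω + ν) = componentProj M ω + componentProj M ν := by
  funext e
  simp only [componentProj, componentMean_add, flatComb_add, Pi.add_apply]
  ring

lemma componentProj_smul (c : ℝ) (ω : α → ℝ) :
    componentProj M (c • ω) = c • componentProj M ω := by
  funext e
  simp only [componentProj, componentMean_smul, flatComb_smul, Pi.smul_apply, smul_eq_mul]
  ring

lemma IsConeVector.componentProj {N : Finset (Flats M)} (hN : IsReducedNested N)
    {a : Flats M → ℝ} {ω : α → ℝ} (ha : IsConeVector N a ω) :
    IsConeVector N (a + componentMean M ω) (componentProj M ω) where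
  pos G hG := by simpa [componentMean, hN.2 G hG] using ha.pos G hG
  eq_zero G hG hGm := by simpa [componentMean, hGm] using ha.eq_zero G hG hGm
  eq e := by rw [flatComb_add, CoxeterBergman.componentProj, ha.eq]; ring

lemma componentProj_eq_self {ω : α → ℝ} (hω : ω ∈ componentSumZero M) :
    componentProj M ω = ω := by
  funext e
  have : componentMean M ω = (0 : ℝ) • 0 := by
    funext G
    by_cases hG : Maximal IsIrred G
    · simp [componentMean, hω G hG]
    · simp [componentMean, hG]
  rw [componentProj, this, flatComb_smul]
  simp

lemma smul_mem_componentSumZero {ω : α → ℝ} (hω : ω ∈ componentSumZero M) (c : ℝ) :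
    c • ω ∈ componentSumZero M := fun C hC ↦ by rw [weight_smul, hω C hC, mul_zero]

namespace IsVectorMatroid

variable (h : IsVectorMatroid M v)

include h

lemma flatComb_apply_of_mem {d : Flats M → ℝ} (hd : ∀ G, ¬ Maximal IsIrred G → d G = 0)
    {C : Flats M} (hC : Maximal IsIrred C) {e : α} (he : e ∈ C.1) : flatComb d e = d C := by
  rw [flatComb, Finset.sum_eq_single C]
  · simp [he]
  · intro G _ hG
    by_cases hGm : Maximal IsIrred G
    · exact indicator_of_notMem (fun heG ↦ hG (h.eq_of_maximal_of_mem hGm hC heG he)) _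
    · simp [hd G hGm]
  · simp

lemma componentMean_flatComb {d : Flats M → ℝ} (hd : ∀ G, ¬ Maximal IsIrred G → d G = 0) :
    componentMean M (flatComb d) = d := by
  funext C
  by_cases hC : Maximal IsIrred C
  · have hne : (C.1.ncard : ℝ) ≠ 0 :=
      Nat.cast_ne_zero.2 (h.connected_of_isIrred hC.prop).1.ncard_pos.ne'
    rw [componentMean, if_pos hC, weight_congr fun e he ↦ h.flatComb_apply_of_mem hd hC he,
      weight_const, mul_div_cancel_left₀ _ hne]
  · rw [componentMean, if_neg hC, hd C hC]

lemma componentProj_flatComb {d : Flats M → ℝ} (hd : ∀ G, ¬ Maximal IsIrred G → d G = 0) :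
    componentProj M (flatComb d) = 0 := by
  funext e
  rw [componentProj, h.componentMean_flatComb hd, sub_self, Pi.zero_apply]

lemma componentProj_mem (ω : α → ℝ) : componentProj M ω ∈ componentSumZero M := by
  intro C hC
  have hne : (C.1.ncard : ℝ) ≠ 0 :=
    Nat.cast_ne_zero.2 (h.connected_of_isIrred hC.prop).1.ncard_pos.ne'
  have h1 : ∀ e ∈ C.1, componentProj M ω e = 
      (ω + fun _ ↦ -componentMean M ω C : α → ℝ) e := fun e he ↦ by
    rw [componentProj,
      h.flatComb_apply_of_mem (fun G hG ↦ by simp [componentMean, hG]) hC he]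
    rfl
  rw [weight_congr h1, weight_add, weight_const, componentMean, if_pos hC, mul_neg,
    mul_div_cancel₀ _ hne, add_neg_cancel]

lemma sum_eq_zero_of_mem_componentSumZero {ω : α → ℝ} (hω : ω ∈ componentSumZero M) :
    ∑ e, ω e = 0 := by
  classical
  have h1 : ∀ e, ω e = ∑ G : Flats M, if Maximal IsIrred G then G.1.indicator ω e else 0 := by
    intro e
    conv_lhs => rw [← h.flatComb_maximal (ω e) e]
    rw [flatComb]
    refine Finset.sum_congr rfl fun G _ ↦ ?_
    by_cases hG : Maximal IsIrred G <;> by_cases he : e ∈ G.1 <;> simp [hG, he]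
  rw [Finset.sum_congr rfl fun e _ ↦ h1 e, Finset.sum_comm]
  refine Finset.sum_eq_zero fun G _ ↦ ?_
  by_cases hG : Maximal IsIrred G
  · simpa [hG, weight] using hω G hG
  · simp [hG]

end IsVectorMatroid

/-! ### Normalization -/

/-- The positive multiple of `ω` with sum of squares `1`. -/
def normalize (ω : α → ℝ) : α → ℝ := (√(∑ e, ω e ^ 2))⁻¹ • ω

lemma sum_sq_pos {ω : α → ℝ} (hω : ω ≠ 0) : 0 < ∑ e, ω e ^ 2 := by
  obtain ⟨e, he⟩ := Function.ne_iff.1 hω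
  exact Finset.sum_pos' (fun _ _ ↦ sq_nonneg _) ⟨e, Finset.mem_univ e, by
    have : ω e ≠ 0 := he
    positivity⟩

lemma inv_sqrt_sum_sq_pos {ω : α → ℝ} (hω : ω ≠ 0) : 0 < (√(∑ e, ω e ^ 2))⁻¹ :=
  inv_pos.2 (Real.sqrt_pos.2 (sum_sq_pos hω))

lemma normalize_mem_weightSphere {ω : α → ℝ} (hω : ω ≠ 0) (h0 : ∑ e, ω e = 0) :
    normalize ω ∈ weightSphere α := by
  constructor
  · simp [normalize, ← Finset.mul_sum, h0]
  · simp only [normalize, Pi.smul_apply, smul_eq_mul, mul_pow, ← Finset.mul_sum, inv_pow]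
    rw [Real.sq_sqrt (sum_sq_pos hω).le, inv_mul_cancel₀ (sum_sq_pos hω).ne']

lemma normalize_smul {c : ℝ} (hc : 0 < c) (ω : α → ℝ) : normalize (c • ω) = normalize ω := by
  simp only [normalize, Pi.smul_apply, smul_eq_mul, mul_pow, ← Finset.mul_sum]
  rw [Real.sqrt_mul (sq_nonneg c), Real.sqrt_sq hc.le, smul_smul, mul_inv, mul_right_comm,
    inv_mul_cancel₀ hc.ne', one_mul]

lemma normalize_eq_self {ω : α → ℝ} (hω : ω ∈ weightSphere α) : normalize ω = ω := by
  simp [normalize, hω.2]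

lemma continuousAt_normalize {ω : α → ℝ} (hω : ω ≠ 0) : ContinuousAt normalize ω := by
  have hcont : Continuous fun ω : α → ℝ ↦ √(∑ e, ω e ^ 2) := by fun_prop
  refine ContinuousAt.smul (hcont.continuousAt.inv₀ ?_) continuousAt_id
  exact (Real.sqrt_pos.2 (sum_sq_pos hω)).ne'

lemma ne_zero_of_mem_weightSphere {ω : α → ℝ} (hω : ω ∈ weightSphere α) : ω ≠ 0 := by
  rintro rfl
  simpa using hω.2

/-! ### Incidences of cells -/

namespace IsVectorMatroid

variable (h : IsVectorMatroid M v)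

include h

/-- Perturb `ω` by a small positive multiple of a vector `ψ` in the cone of `N'`, chosen with
coordinate sum zero, and normalize. -/
lemma nestedCell_subset_closure {N N' : Finset (Flats M)} (hN' : IsReducedNested N')
    (hNN' : N ⊆ N') : nestedCell M N ⊆ closure (nestedCell M N') := by
  classical
  intro ω hω
  obtain ⟨hωs, a, ha⟩ := mem_nestedCell.1 hω
  obtain ⟨b, ψ, hb, hψ0⟩ : ∃ b ψ, IsConeVector N' b ψ ∧ ∑ e, ψ e = 0 :=
    ⟨_, _, (isConeVector_indicator N').componentProj hN',
      h.sum_eq_zero_of_mem_componentSumZero (h.componentProj_mem _)⟩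
  have hcone : ∀ ε : ℝ, 0 < ε → IsConeVector N' (a + ε • b) (ω + ε • ψ) := by
    intro ε hε
    refine ⟨fun G hG ↦ ?_, fun G hG hGm ↦ ?_, fun e ↦ ?_⟩
    · have h1 := mul_pos hε (hb.pos G hG)
      have h2 : 0 ≤ a G := by
        by_cases hGN : G ∈ N
        · exact (ha.pos G hGN).le
        · exact (ha.eq_zero G hGN (hN'.2 G hG)).ge
      simp only [Pi.add_apply, Pi.smul_apply, smul_eq_mul]
      linarith
    · simp [ha.eq_zero G (fun hG' ↦ hG (hNN' hG')) hGm, hb.eq_zero G hG hGm]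
    · rw [flatComb_add, flatComb_smul, Pi.add_apply, Pi.smul_apply, smul_eq_mul, ha.eq, hb.eq]
      ring
  have hω0 := ne_zero_of_mem_weightSphere hωs
  have hlim : Filter.Tendsto (fun ε : ℝ ↦ ω + ε • ψ) (nhdsWithin 0 (Ioi 0)) (nhds ω) := by
    have : Continuous fun ε : ℝ ↦ ω + ε • ψ := by fun_prop
    simpa using (this.tendsto 0).mono_left nhdsWithin_le_nhds
  have hlim' : Filter.Tendsto (fun ε : ℝ ↦ normalize (ω + ε • ψ)) (nhdsWithin 0 (Ioi 0))
      (nhds ω) := by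
    have := (continuousAt_normalize hω0).tendsto.comp hlim
    rwa [normalize_eq_self hωs] at this
  refine mem_closure_of_tendsto hlim' ?_
  filter_upwards [self_mem_nhdsWithin, hlim.eventually_ne hω0] with ε hε hne
  refine mem_nestedCell.2 ⟨normalize_mem_weightSphere hne ?_, _,
    (hcone ε hε).smul (inv_sqrt_sum_sq_pos hne)⟩
  simp [Finset.sum_add_distrib, ← Finset.mul_sum, hωs.1, hψ0]

/-- The coefficients of a vector in the cell of `N'` are nonnegative on `N'`. An injective linear
map sends this closed set to a closed set, so every limit lies in the cone of a subset of `N'`, and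
uniqueness identifies that subset with `N`. -/
lemma subset_of_mem_closure {N N' : Finset (Flats M)} (hN : IsReducedNested N)
    (hN' : IsReducedNested N') {ω : α → ℝ} (hω : ω ∈ nestedCell M N)
    (hcl : ω ∈ closure (nestedCell M N')) : N ⊆ N' := by
  classical
  obtain ⟨hωs, a, ha⟩ := mem_nestedCell.1 hω
  set P := withMaximal N'
  set T := -flatCombLinear P
  have hT : Function.Injective T := fun c d hcd ↦
    h.flatCombLinear_injective (h.isNested_withMaximal hN'.1) (neg_injective hcd)
  have hTc : Topology.IsClosedEmbedding T := LinearMap.isClosedEmbedding_of_injective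
    (LinearMap.ker_eq_bot.2 hT)
  set Q : Set (P → ℝ) := {c | ∀ G : P, G.1 ∈ N' → 0 ≤ c G}
  have hQ : IsClosed Q := by
    simp only [Q, ofPred_forall]
    exact isClosed_iInter fun G ↦ isClosed_iInter fun _ ↦
      isClosed_le continuous_const (continuous_apply G)
  have hsub : nestedCell M N' ⊆ T '' Q := by
    intro ν hν
    obtain ⟨-, b, hb⟩ := mem_nestedCell.1 hν
    refine ⟨fun G ↦ b G.1, fun G hG ↦ (hb.pos G.1 hG).le, ?_⟩
    have : extendByZero P (fun G ↦ b G.1) = b := by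
      funext G
      by_cases hG : G ∈ P
      · exact extendByZero_apply P _ ⟨G, hG⟩
      · rw [extendByZero_of_notMem P _ G hG, hb.support G hG]
    funext e
    rw [hb.eq, LinearMap.neg_apply, flatCombLinear_apply, this]
    rfl
  obtain ⟨c, hc, rfl⟩ := closure_minimal hsub (hTc.isClosedMap _ hQ) hcl
  have hcone : IsConeVector (N'.filter (0 < extendByZero P c ·)) (extendByZero P c) (T c) := by
    refine ⟨fun G hG ↦ (Finset.mem_filter.1 hG).2, fun G hG hGm ↦ ?_, fun e ↦ rfl⟩
    by_cases hGN : G ∈ N'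
    · have hGP : G ∈ P := mem_withMaximal.2 (.inl hGN)
      refine le_antisymm (not_lt.1 fun hpos ↦ hG (Finset.mem_filter.2 ⟨hGN, hpos⟩)) ?_
      exact (hc ⟨G, hGP⟩ hGN).trans_eq (extendByZero_apply P c ⟨G, hGP⟩).symm
    · exact extendByZero_of_notMem P c G (by simp [P, mem_withMaximal, hGN, hGm])
  rw [(h.isConeVector_unique hN (hN'.mono (Finset.filter_subset _ _)) ha hcone).1]
  exact Finset.filter_subset _ _

end IsVectorMatroid

end Realization

/-! ### The geometric realization of the nested set complex -/

/-- Faces are closed under nonempty subsets, so the open simplices have the same union as the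
finitely many closed ones. Compactness later turns the continuous bijection into a homeomorphism. -/
lemma isCompact_realization {ι : Type*} [Fintype ι] (K : PreAbstractSimplicialComplex ι) :
    IsCompact (realization K) := by
  classical
  set D : Finset ι → Set (ι → ℝ) := fun X ↦ stdSimplex ℝ ι ∩ {t | ∀ i ∉ X, t i = 0}
  have hD : ∀ X, IsCompact (D X) := fun X ↦ by
    refine (isCompact_stdSimplex ℝ ι).inter_right ?_
    simp only [ofPred_forall]
    exact isClosed_iInter fun i ↦ isClosed_iInter fun _ ↦
      isClosed_eq (continuous_apply i) continuous_const
  have heq : realization K = ⋃ X ∈ K.faces, D X := by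
    refine Subset.antisymm (fun t ht ↦ ?_) (fun t ht ↦ ?_)
    · simp only [realization, mem_iUnion] at ht ⊢
      obtain ⟨X, hX, hpos, hzero, hsum⟩ := ht
      refine ⟨X, hX, ⟨fun i ↦ ?_, hsum⟩, hzero⟩
      by_cases hi : i ∈ X
      exacts [(hpos i hi).le, (hzero i hi).ge]
    · simp only [realization, mem_iUnion] at ht ⊢
      obtain ⟨X, hX, ⟨hnonneg, hsum⟩, hzero⟩ := ht
      set Y := X.filter (0 < t ·)
      have hY0 : ∀ i ∉ Y, t i = 0 := fun i hi ↦ by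
        by_cases hiX : i ∈ X
        · exact le_antisymm (not_lt.1 fun hp ↦ hi (Finset.mem_filter.2 ⟨hiX, hp⟩)) (hnonneg i)
        · exact hzero i hiX
      have hYne : Y.Nonempty := by
        by_contra hne
        rw [Finset.not_nonempty_iff_eq_empty] at hne
        rw [Finset.sum_eq_zero fun i _ ↦ hY0 i (by simp [hne])] at hsum
        exact zero_ne_one hsum
      exact ⟨Y, (K.isRelLowerSet_faces hX).2 (Finset.filter_subset _ _) hYne,
        fun i hi ↦ (Finset.mem_filter.1 hi).2, hY0, hsum⟩
  rw [heq]
  exact (Set.toFinite K.faces).isCompact_biUnion fun X _ ↦ hD X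

section NestedRealization

variable {α V : Type*} [AddCommGroup V] [Module ℝ V] [Fintype α] {M : Matroid α} {v : α → V}

variable (M) in
/-- The linear map which sends `t` to the projection of `-∑ t_G 1_G`. -/
def simplexMap : (Flats M → ℝ) →ₗ[ℝ] (α → ℝ) where
  toFun t := componentProj M ((-1 : ℝ) • flatComb t)
  map_add' s t := by
    rw [← componentProj_add, ← smul_add]
    congr 2
    exact funext (flatComb_add s t)
  map_smul' c t := by
    have : flatComb (c • t) = c • flatComb t := funext (flatComb_smul c t)
    rw [this, smul_comm, componentProj_smul, RingHom.id_apply]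

lemma isConeVector_of_mem_openSimplex {N : Finset (Flats M)} (hN : IsReducedNested N)
    {t : Flats M → ℝ} (ht : t ∈ openSimplex N) :
    IsConeVector N (t + componentMean M ((-1 : ℝ) • flatComb t)) (simplexMap M t) :=
  IsConeVector.componentProj hN ⟨ht.1, fun G hG _ ↦ ht.2.1 G hG, fun e ↦ by simp⟩

namespace IsVectorMatroid

variable (h : IsVectorMatroid M v)

include h

lemma simplexMap_ne_zero {N : Finset (Flats M)} (hN : IsReducedNested N) (hne : N.Nonempty)
    {t : Flats M → ℝ} (ht : t ∈ openSimplex N) : simplexMap M t ≠ 0 := by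
  intro h0
  have h1 := isConeVector_of_mem_openSimplex hN ht
  rw [h0] at h1
  have h2 : IsConeVector (∅ : Finset (Flats M)) 0 0 :=
    ⟨by simp, fun _ _ _ ↦ rfl, fun e ↦ by simp [flatComb]⟩
  exact hne.ne_empty (h.isConeVector_unique hN (hN.mono (Finset.empty_subset N)) h1 h2).1

lemma normalize_simplexMap_mem {N : Finset (Flats M)} (hN : IsReducedNested N) (hne : N.Nonempty)
    {t : Flats M → ℝ} (ht : t ∈ openSimplex N) :
    normalize (simplexMap M t) ∈ nestedCell M N ∩ componentSumZero M := by
  have h0 := h.simplexMap_ne_zero hN hne ht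
  have hU : simplexMap M t ∈ componentSumZero M := h.componentProj_mem _
  exact ⟨mem_nestedCell.2
    ⟨normalize_mem_weightSphere h0 (h.sum_eq_zero_of_mem_componentSumZero hU), _,
      (isConeVector_of_mem_openSimplex hN ht).smul (inv_sqrt_sum_sq_pos h0)⟩,
    smul_mem_componentSumZero hU _⟩

lemma nestedCell_subset_bergmanComplex {N : Finset (Flats M)} (hN : IsReducedNested N) :
    nestedCell M N ⊆ bergmanComplex M := fun _ hω ↦ by
  obtain ⟨hωs, a, ha⟩ := mem_nestedCell.1 hω
  exact ⟨hωs, h.loopless_of_isConeVector hN.1 ha⟩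

/-- Points of open simplices with the same image coincide. -/
lemma eq_of_normalize_simplexMap_eq {N N' : Finset (Flats M)} (hN : IsReducedNested N)
    (hN' : IsReducedNested N') (hne : N.Nonempty) (hne' : N'.Nonempty) {t t' : Flats M → ℝ}
    (ht : t ∈ openSimplex N) (ht' : t' ∈ openSimplex N')
    (heq : normalize (simplexMap M t) = normalize (simplexMap M t')) : t = t' := by
  set c := (√(∑ e, simplexMap M t e ^ 2))⁻¹
  set c' := (√(∑ e, simplexMap M t' e ^ 2))⁻¹
  have hc : 0 < c := inv_sqrt_sum_sq_pos (h.simplexMap_ne_zero hN hne ht)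
  have h1 := (isConeVector_of_mem_openSimplex hN ht).smul hc
  have h2 := (isConeVector_of_mem_openSimplex hN' ht').smul
    (inv_sqrt_sum_sq_pos (h.simplexMap_ne_zero hN' hne' ht'))
  change IsConeVector N _ (normalize (simplexMap M t)) at h1
  rw [heq] at h1
  obtain ⟨rfl, hab⟩ := h.isConeVector_unique hN hN' h1 h2
  have hcc : ∀ G, c * t G = c' * t' G := fun G ↦ by
    by_cases hG : G ∈ N
    · simpa [componentMean, hN.2 G hG] using congrFun hab G
    · rw [ht.2.1 G hG, ht'.2.1 G hG, mul_zero, mul_zero]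
  -- Barycentric coordinates sum to `1`, which determines the scaling factor.
  have hc1 : c = c' := by
    have := Finset.sum_congr rfl fun G (_ : G ∈ Finset.univ) ↦ hcc G
    rwa [← Finset.mul_sum, ← Finset.mul_sum, ht.2.2, ht'.2.2, mul_one, mul_one] at this
  funext G
  have := hcc G
  rw [← hc1] at this
  exact mul_left_cancel₀ hc.ne' this

/-- Every point of a cell with sum zero on the components is the image of a point of the open
simplex. -/
lemma exists_normalize_simplexMap_eq {N : Finset (Flats M)} {ω : α → ℝ}
    (hω : ω ∈ nestedCell M N ∩ componentSumZero M) :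
    N.Nonempty ∧ ∃ t ∈ openSimplex N, normalize (simplexMap M t) = ω := by
  classical
  obtain ⟨hωc, hωU⟩ := hω
  obtain ⟨hωs, a, ha⟩ := mem_nestedCell.1 hωc
  set a' : Flats M → ℝ := fun G ↦ if G ∈ N then a G else 0
  have hproj : simplexMap M a' = ω := by
    -- Dropping the coefficients of the components changes the vector only by something the
    -- projection kills.
    set d := a - a'
    have hd : ∀ G, ¬ Maximal IsIrred G → d G = 0 := fun G hG ↦ by
      by_cases hGN : G ∈ N
      · simp [d, a', hGN]
      · simp [d, a', hGN, ha.eq_zero G hGN hG]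
    have h1 : simplexMap M a = ω := by
      have : (-1 : ℝ) • flatComb a = ω := funext fun e ↦ by simp [ha.eq e]
      change componentProj M _ = ω
      rw [this, componentProj_eq_self hωU]
    have h2 : simplexMap M d = 0 := by
      change componentProj M _ = 0
      rw [componentProj_smul, h.componentProj_flatComb hd, smul_zero]
    rw [map_sub, sub_eq_zero] at h2
    rw [← h2, h1]
  have hne : N.Nonempty := by
    by_contra hne
    rw [Finset.not_nonempty_iff_eq_empty] at hne
    have ha0 : a' = 0 := by funext G; simp [a', hne]
    rw [ha0, map_zero] at hproj
    exact ne_zero_of_mem_weightSphere hωs hproj.symm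
  have hpos : ∀ G ∈ N, 0 < a' G := fun G hG ↦ by simpa [a', hG] using ha.pos G hG
  have hzero : ∀ G ∉ N, a' G = 0 := fun G hG ↦ by simp [a', hG]
  have hsum : 0 < ∑ G, a' G := by
    obtain ⟨G, hG⟩ := hne
    refine Finset.sum_pos' (fun K _ ↦ ?_) ⟨G, Finset.mem_univ G, hpos G hG⟩
    by_cases hK : K ∈ N
    exacts [(hpos K hK).le, (hzero K hK).ge]
  refine ⟨hne, (∑ G, a' G)⁻¹ • a', ⟨fun G hG ↦ mul_pos (inv_pos.2 hsum) (hpos G hG),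
    fun G hG ↦ by simp [hzero G hG], ?_⟩, ?_⟩
  · simp only [Pi.smul_apply, smul_eq_mul, ← Finset.mul_sum]
    exact inv_mul_cancel₀ hsum.ne'
  · rw [map_smul, normalize_smul (inv_pos.2 hsum), hproj, normalize_eq_self hωs]

/-- The vectors of the Bergman complex with sum zero on the components realize the nested set
complex. -/
lemma isRealizationOf_nestedSetComplex : IsRealizationOf (nestedSetComplex (Flats M))
    (bergmanComplex M ∩ componentSumZero M) (fun N ↦ nestedCell M N ∩ componentSumZero M) := by
  have hmem : ∀ t ∈ realization (nestedSetComplex (Flats M)),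
      ∃ N : Finset (Flats M), N.Nonempty ∧ IsReducedNested N ∧ t ∈ openSimplex N := fun t ht ↦ by
    simp only [realization, mem_iUnion] at ht
    obtain ⟨N, hN, ht⟩ := ht
    exact ⟨N, hN.1, hN.2, ht⟩
  have hmem' : ∀ {N : Finset (Flats M)} {t}, N.Nonempty → IsReducedNested N → t ∈ openSimplex N →
      t ∈ realization (nestedSetComplex (Flats M)) := fun hne hN ht ↦
    mem_biUnion (show _ ∈ (nestedSetComplex (Flats M)).faces from ⟨hne, hN⟩) ht
  let f : realization (nestedSetComplex (Flats M)) → ↥(bergmanComplex M ∩ componentSumZero M) :=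
    fun t ↦ ⟨normalize (simplexMap M t), by
      obtain ⟨N, hne, hN, ht⟩ := hmem t t.2
      have := h.normalize_simplexMap_mem hN hne ht
      exact ⟨h.nestedCell_subset_bergmanComplex hN this.1, this.2⟩⟩
  have hf : Continuous f := by
    refine Continuous.subtype_mk (continuous_iff_continuousAt.2 fun t ↦ ?_) _
    obtain ⟨N, hne, hN, ht⟩ := hmem t t.2
    have hcont : Continuous fun t : realization (nestedSetComplex (Flats M)) ↦
        simplexMap M (t : Flats M → ℝ) :=
      (LinearMap.continuous_of_finiteDimensional (simplexMap M)).comp continuous_subtype_val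
    exact ContinuousAt.comp (f := fun t : realization (nestedSetComplex (Flats M)) ↦
      simplexMap M (t : Flats M → ℝ)) (g := normalize)
      (continuousAt_normalize (h.simplexMap_ne_zero hN hne ht)) hcont.continuousAt
  have hinj : Function.Injective f := by
    intro t t' heq
    obtain ⟨N, hne, hN, ht⟩ := hmem t t.2
    obtain ⟨N', hne', hN', ht'⟩ := hmem t' t'.2
    exact Subtype.ext (h.eq_of_normalize_simplexMap_eq hN hN' hne hne' ht ht'
      (congrArg Subtype.val heq))
  have hsurj : Function.Surjective f := by
    rintro ⟨ω, hω, hωU⟩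
    obtain ⟨N, a, hN, ha⟩ := h.exists_isConeVector_of_loopless hω.2
    obtain ⟨hne, t, ht, htω⟩ := h.exists_normalize_simplexMap_eq
      ⟨mem_nestedCell.2 ⟨hω.1, a, ha⟩, hωU⟩
    exact ⟨⟨t, hmem' hne hN ht⟩, Subtype.ext htω⟩
  have : CompactSpace (realization (nestedSetComplex (Flats M))) :=
    isCompact_iff_compactSpace.1 (isCompact_realization _)
  refine ⟨Continuous.homeoOfEquivCompactToT2 (f := Equiv.ofBijective f ⟨hinj, hsurj⟩) hf,
    fun N hN ↦ Subset.antisymm ?_ fun ω hω ↦ ?_⟩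
  · rintro _ ⟨t, ht, rfl⟩
    exact h.normalize_simplexMap_mem hN.2 hN.1 ht
  · obtain ⟨hne, t, ht, htω⟩ := h.exists_normalize_simplexMap_eq hω
    exact ⟨⟨t, hmem' hne hN.2 ht⟩, ht, htω⟩

end IsVectorMatroid

end NestedRealization

/-! ### The matroid of a root system -/

section RootMatroid

variable {B W : Type*} [Group W] [Fintype B] [DecidableEq B] {M : CoxeterMatrix B}
  (cs : CoxeterSystem M W)

/-- The positive roots as vectors. -/
abbrev rootVec : positiveRoots cs → (B → ℝ) := Subtype.val

lemma isVectorMatroid_rootMatroid : IsVectorMatroid (rootMatroid cs) (rootVec cs) where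
  ground_eq := rfl
  indep_iff _ := by simp [rootMatroid]
  ne_zero e h0 := by
    have := coxeterForm_root_self cs e.2.1
    rw [show (e : B → ℝ) = 0 from h0] at this
    simp at this

variable {cs}

/-- The reflection of a positive root in another one is a positive root up to sign. -/
lemma exists_reflection_eq (e f : positiveRoots cs) : ∃ g : positiveRoots cs, ∃ c : ℝ,
    c ≠ 0 ∧ (e : B → ℝ) = c • (g : B → ℝ) + (2 * coxeterForm M e f) • (f : B → ℝ) := by
  rcases mem_positiveRoots_or_neg_mem cs (reflection_mem_rootSystem cs f.2.1 e.2.1) with h | h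
  · exact ⟨⟨_, h⟩, 1, one_ne_zero, by module⟩
  · exact ⟨⟨_, h⟩, -1, by norm_num, by module⟩

/-! ### Separations of contractions of root systems -/

section Separation

variable {F G T T' : Set (positiveRoots cs)}

lemma notMem_vspan_of_separation (hF : vclosure (rootVec cs) F = F) (hT : T ∪ T' = G \ F)
    (hsep : vspan (rootVec cs) (F ∪ T) ⊓ vspan (rootVec cs) (F ∪ T') ≤ vspan (rootVec cs) F)
    {e : positiveRoots cs} (he : e ∈ T) : (e : B → ℝ) ∉ vspan (rootVec cs) (F ∪ T') := by
  intro hmem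
  have heF : e ∈ F := mem_of_mem_vspan hF (hsep ⟨mem_vspan (Or.inr he), hmem⟩)
  exact (hT ▸ Or.inl he : e ∈ G \ F).2 heF

/-- The root `g` with `e = c g + 2 (e, f) f` lies in every flat containing `e` and `f`. -/
lemma mem_of_reflection_eq (hG : vclosure (rootVec cs) G = G) {e f g : positiveRoots cs}
    (he : e ∈ G) (hf : f ∈ G) {c : ℝ} (hc : c ≠ 0)
    (heq : (e : B → ℝ) = c • (g : B → ℝ) + (2 * coxeterForm M e f) • (f : B → ℝ)) : g ∈ G := by
  apply mem_of_mem_vspan hG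
  have h1 : c • (g : B → ℝ) ∈ vspan (rootVec cs) G := by
    rw [← sub_eq_iff_eq_add.2 heq]
    exact sub_mem (mem_vspan he) (Submodule.smul_mem _ _ (mem_vspan hf))
  exact (Submodule.smul_mem_iff _ hc).1 h1

/-- Otherwise the reflection of `e` in `f` is, up to sign, a root `g` of `G` that combines `e` and
`f` with nonzero coefficients. If `g` is in `F ∪ T`, then `f` is in the span of `F ∪ T`; if `g` is
in `T'`, then `e` is in the span of `F ∪ T'`. The separation excludes both. -/
lemma coxeterForm_eq_zero_of_separation (hF : vclosure (rootVec cs) F = F)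
    (hG : vclosure (rootVec cs) G = G) (hT : T ∪ T' = G \ F)
    (hsep : vspan (rootVec cs) (F ∪ T) ⊓ vspan (rootVec cs) (F ∪ T') ≤ vspan (rootVec cs) F)
    {e f : positiveRoots cs} (he : e ∈ T) (hf : f ∈ T') : coxeterForm M e f = 0 := by
  by_contra hne
  obtain ⟨g, c, hc, heq⟩ := exists_reflection_eq e f
  have hg : g ∈ G := mem_of_reflection_eq hG (hT ▸ Or.inl he : e ∈ G \ F).1
    (hT ▸ Or.inr hf : f ∈ G \ F).1 hc heq
  have hf' := notMem_vspan_of_separation hF (union_comm T T' ▸ hT) (by rwa [inf_comm]) hf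
  have he' := notMem_vspan_of_separation hF hT hsep he
  by_cases hgT : g ∈ F ∪ T
  · apply hf'
    have h1 : (2 * coxeterForm M e f) • (f : B → ℝ) ∈ vspan (rootVec cs) (F ∪ T) := by
      rw [← sub_eq_iff_eq_add'.2 heq]
      exact sub_mem (mem_vspan (Or.inr he)) (Submodule.smul_mem _ _ (mem_vspan hgT))
    exact (Submodule.smul_mem_iff _ (mul_ne_zero two_ne_zero hne)).1 h1
  · apply he'
    have hgT' : g ∈ T' := by
      rw [mem_union, not_or] at hgT
      exact (hT.symm ▸ ⟨hg, hgT.1⟩ : g ∈ T ∪ T').resolve_left hgT.2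
    rw [heq]
    exact add_mem (Submodule.smul_mem _ _ (mem_vspan (Or.inr hgT')))
      (Submodule.smul_mem _ _ (mem_vspan (Or.inr hf)))

end Separation

variable (cs)

/-- Contractions of connected flats of a root system are connected. -/
theorem hasConnectedContractions_rootVec [Finite W] : HasConnectedContractions (rootVec cs) := by
  intro F G hF hG hFG hconn T T' hT hsep
  by_contra! hne
  have hTG : ∀ e ∈ T, e ∈ G \ F := fun e he ↦ hT ▸ Or.inl he
  have hTG' : ∀ e ∈ T', e ∈ G \ F := fun e he ↦ hT ▸ Or.inr he
  have horth : ∀ e ∈ T, ∀ f ∈ T', coxeterForm M e f = 0 := fun e he f hf ↦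
    coxeterForm_eq_zero_of_separation hF hG hT hsep he hf
  -- The separation of the contraction is lifted to a splitting of `G`: `X` contains `T`, `Y`
  -- contains `T'`, and the roots of `F` are distributed according to their orthogonality to `T`.
  set X := {x ∈ G | ∃ e ∈ T, coxeterForm M x e ≠ 0}
  set Y := {x ∈ G | ∀ e ∈ T, coxeterForm M x e = 0}
  have hXY : X ∪ Y = G := by
    ext x
    simp only [X, Y, mem_union, mem_ofPred_eq]
    constructor
    · rintro (h | h) <;> exact h.1
    · intro hx
      by_cases h : ∀ e ∈ T, coxeterForm M x e = 0
      · exact .inr ⟨hx, h⟩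
      · push Not at h
        exact .inl ⟨hx, h⟩
  have hXYorth : ∀ x ∈ X, ∀ y ∈ Y, coxeterForm M x y = 0 := by
    rintro x ⟨hxG, e, he, hxe⟩ y ⟨hyG, hy⟩
    by_cases hxF : x ∈ F
    -- The reflection `g` of `e` in a root `x` of `F` again lies in `T`, since otherwise `e` would
    -- be in the span of `F ∪ T'`. As `y` is orthogonal to `e` and `g`, it is orthogonal to `x`.
    · obtain ⟨g, c, hc, heq⟩ := exists_reflection_eq e x
      have hg := mem_of_reflection_eq hG (hTG e he).1 hxG hc heq
      have hgn : g ∉ F ∪ T' := fun hg' ↦ by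
        apply notMem_vspan_of_separation hF hT hsep he
        rw [heq]
        exact add_mem (Submodule.smul_mem _ _ (mem_vspan hg'))
          (Submodule.smul_mem _ _ (mem_vspan (Or.inl hxF)))
      rw [mem_union, not_or] at hgn
      have hgT : g ∈ T := (hT.symm ▸ ⟨hg, hgn.1⟩ : g ∈ T ∪ T').resolve_right hgn.2
      have h1 := hy e he
      rw [heq, map_add, map_smul, map_smul, hy g hgT, smul_zero, zero_add, smul_eq_mul] at h1
      rw [coxeterForm_comm]
      refine (mul_eq_zero.1 h1).resolve_left (mul_ne_zero two_ne_zero ?_)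
      rwa [coxeterForm_comm]
    · rcases (hT.symm ▸ ⟨hxG, hxF⟩ : x ∈ T ∪ T') with hx | hx
      · rw [coxeterForm_comm]
        exact hy x hx
      · rw [coxeterForm_comm] at hxe
        exact absurd (horth e he x hx) hxe
  have hd : Disjoint (vspan (rootVec cs) X) (vspan (rootVec cs) Y) := by
    refine disjoint_span_of_orthogonal cs ?_ ?_
    · rintro _ ⟨y, -, rfl⟩
      exact y.2.1
    · rintro _ ⟨x, hx, rfl⟩ _ ⟨y, hy, rfl⟩
      exact hXYorth x hx y hy
  obtain ⟨e, he⟩ := hne.1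
  obtain ⟨f, hf⟩ := hne.2
  rcases hconn.2 X Y hXY hd with h | h
  · have : e ∈ X := ⟨(hTG e he).1, e, he, by rw [coxeterForm_root_self cs e.2.1]; exact one_ne_zero⟩
    exact notMem_empty e (h ▸ this)
  · have : f ∈ Y := ⟨(hTG' f hf).1, fun x hx ↦ by rw [coxeterForm_comm]; exact horth x hx f hf⟩
    exact notMem_empty f (h ▸ this)

lemma cos_pi_div_ne_zero {m : ℕ} (h1 : m ≠ 1) (h2 : m ≠ 2) : Real.cos (Real.pi / m) ≠ 0 := by
  -- For `m = 0`, which encodes `∞`, division by zero gives the angle `0`, with cosine `1`.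
  rcases Nat.eq_zero_or_pos m with rfl | hpos
  · simp
  have hm : (3 : ℝ) ≤ m := by
    have : 3 ≤ m := by omega
    exact_mod_cast this
  refine (Real.cos_pos_of_mem_Ioo ⟨?_, ?_⟩).ne'
  · have := Real.pi_pos
    have : 0 < Real.pi / m := by positivity
    linarith
  · have := Real.pi_pos
    rw [div_lt_div_iff₀ (by linarith) two_pos]
    nlinarith

/-- The roots of an irreducible Coxeter system are connected. -/
theorem vconnected_univ_of_connected (hconn : (coxeterDiagram M).Connected) :
    VConnected (rootVec cs) univ := by
  have h := isVectorMatroid_rootMatroid cs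
  obtain ⟨s₀⟩ := hconn.nonempty
  let r : B → positiveRoots cs := fun s ↦ ⟨simpleRoot s, simpleRoot_mem_positiveRoots cs s⟩
  have key : ∀ Y Z : Set (positiveRoots cs), Y ∪ Z = univ →
      Disjoint (vspan (rootVec cs) Y) (vspan (rootVec cs) Z) → r s₀ ∈ Y → Z = ∅ := by
    intro Y Z hYZ hd hs₀
    have hstep : ∀ s t, (coxeterDiagram M).Adj s t → r s ∈ Y → r t ∈ Y := by
      intro s t hst hs
      by_contra ht
      have ht' : r t ∈ Z := (hYZ.symm ▸ mem_univ (r t) : r t ∈ Y ∪ Z).resolve_left ht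
      -- With `F` empty, the two sides of a splitting are orthogonal, while adjacent simple roots
      -- are not. Hence all simple roots lie on one side, and they span the space.
      have h0 := coxeterForm_eq_zero_of_separation (cs := cs) (F := ∅) (G := univ) (T := Y)
        (T' := Z) h.vclosure_empty vclosure_univ (by rw [hYZ, sdiff_empty])
        (by rw [empty_union, empty_union, hd.eq_bot]; exact bot_le) hs ht'
      change coxeterForm M (simpleRoot s) (simpleRoot t) = 0 at h0
      rw [coxeterForm_simpleRoot, neg_eq_zero] at h0
      exact cos_pi_div_ne_zero (M.off_diagonal s t hst.1) hst.2 h0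
    have hall : ∀ t, r t ∈ Y := fun t ↦ by
      obtain ⟨p⟩ := hconn.preconnected s₀ t
      induction p with
      | nil => exact hs₀
      | cons hadj _ ih => exact ih (hstep _ _ hadj hs₀)
    refine eq_empty_of_forall_notMem fun z hz ↦ ?_
    refine h.ne_zero z (Submodule.disjoint_def.1 hd _ ?_ (mem_vspan hz))
    rw [pi_eq_sum_univ' (rootVec cs z)]
    exact Submodule.sum_mem _ fun s _ ↦ Submodule.smul_mem _ _ (mem_vspan (hall s))
  refine ⟨⟨r s₀, mem_univ _⟩, fun Y Z hYZ hd ↦ ?_⟩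
  rcases (hYZ.symm ▸ mem_univ (r s₀) : r s₀ ∈ Y ∪ Z) with hs | hs
  · exact .inr (key Y Z hYZ hd hs)
  · exact .inl (key Z Y (union_comm Y Z ▸ hYZ) hd.symm hs)

end RootMatroid

/-! ### The irreducible case -/

section Irreducible

variable {α V : Type*} [AddCommGroup V] [Module ℝ V] [Fintype α] {M : Matroid α} {v : α → V}

/-- The whole ground set is the only component, so the single condition is the vanishing of the
total sum. -/
lemma IsVectorMatroid.weightSphere_subset_componentSumZero (h : IsVectorMatroid M v)
    (hconn : VConnected v univ) : weightSphere α ⊆ componentSumZero M := by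
  intro ω hω C hC
  have hCu : C.1 = univ :=
    (h.maximal_isIrred_iff.1 hC).eq_of_subset hconn Subset.rfl (subset_univ _)
  rw [hCu, weight]
  simpa using hω.1

end Irreducible

end CoxeterBergman

end

theorem theorem2 {B W : Type*} [Fintype B] [DecidableEq B] [Group W] [Finite W]
    {M : CoxeterMatrix B} (cs : CoxeterSystem M W) :
    -- the coarse cells are exactly the (nonempty) cells of the nested sets
    coarseCells (rootMatroid cs) =
        {C | C.Nonempty ∧ ∃ N, IsReducedNested N ∧ C = nestedCell (rootMatroid cs) N} ∧
    -- the incidences of cells are the inclusions of nested sets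
    (∀ N N' : Finset (Flats (rootMatroid cs)), IsReducedNested N → IsReducedNested N' →
      (nestedCell (rootMatroid cs) N).Nonempty →
      (nestedCell (rootMatroid cs) N ⊆ closure (nestedCell (rootMatroid cs) N') ↔ N ⊆ N')) ∧
    -- transversally to the lineality space, the cells form a simplicial complex
    IsRealizationOf (nestedSetComplex (Flats (rootMatroid cs)))
      (bergmanComplex (rootMatroid cs) ∩ componentSumZero (rootMatroid cs))
      (fun N ↦ nestedCell (rootMatroid cs) N ∩ componentSumZero (rootMatroid cs)) ∧
    -- if the Coxeter system is irreducible, the Bergman complex itself is a simplicial complex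
    ((coxeterDiagram M).Connected →
      IsRealizationOf (nestedSetComplex (Flats (rootMatroid cs)))
        (bergmanComplex (rootMatroid cs)) (nestedCell (rootMatroid cs))) := by
  have h := isVectorMatroid_rootMatroid cs
  have hreal := h.isRealizationOf_nestedSetComplex
  refine ⟨h.coarseCells_eq (hasConnectedContractions_rootVec cs),
    fun N N' hN hN' ⟨ω, hω⟩ ↦ ⟨fun hsub ↦ h.subset_of_mem_closure hN hN' hω (hsub hω),
      h.nestedCell_subset_closure hN'⟩, hreal, fun hconn ↦ ?_⟩
  have hsub := h.weightSphere_subset_componentSumZero (vconnected_univ_of_connected cs hconn)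
  have h1 : bergmanComplex (rootMatroid cs) ∩ componentSumZero (rootMatroid cs) =
      bergmanComplex (rootMatroid cs) :=
    Set.inter_eq_left.2 fun ω hω ↦ hsub hω.1
  have h2 : (fun N ↦ nestedCell (rootMatroid cs) N ∩ componentSumZero (rootMatroid cs)) =
      nestedCell (rootMatroid cs) :=
    funext fun N ↦ Set.inter_eq_left.2 fun ω hω ↦ hsub hω.1
  rwa [h1, h2] at hreal
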